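/- Let $\mathbb G$ be a stratified (Carnot) group, identified through the exponential map with its Lie algebra $\mathbb G=H^1\oplus\dots\oplus H^\iota$, $[H^1,H^j]=H^{j+1}$, with the group law given by the Baker–Campbell–Hausdorff formula. Fix a scalar product on $\mathbb G$ and an orthonormal graded basis; let $dx=\mu$ be the Haar measure that is Lebesgue measure in the corresponding coordinates, $X_1,\dots,X_m$ the left invariant vector fields extending the basis of $H^1$, $\delta_r$ the dilations ($\delta_r=r^i$ on $H^i$) and $Q=\sum_i i\dim H^i$. Let $d$ be a homogeneous distance, $B(0,1)$ its open unit ball, $d^{\mathcal R}(x,y)=d(xy^{-1},0)$, and for an open set $\Omega\subset\mathbb G$ put $\Omega^{\mathcal R}_{\varepsilon}=\{x: \operatorname{dist}^{\mathcal R}(x,\Omega^c)>\varepsilon\}$, where $\operatorname{dist}^{\mathcal R}(x,\emptyset)=\infty$. A horizontal field $\phi=\sum_j\phi_jX_j$ has $|\phi|^2=\sum_j\phi_j^2$ and $\operatorname{div}\phi=\sum_j X_j\phi_j$. For open $U$ let $$|D_Hf|(U)=\sup\Big\{\int_U f\operatorname{div}\phi\,dx:\ \phi\in C^1_c(HU),\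 |\phi|\le1\Big\},$$ and let $f\in BV_{H,\mathrm{loc}}(\Omega)$ mean that $f\in L^1(U)$ and $|D_Hf|(U)<\infty$ for every open $U$ with compact closure in $\Omega$. A measurable set $E$ has locally finite h-perimeter in $\Omega$ if $\chi_E\in BV_{H,\mathrm{loc}}(\Omega)$. Let $E\subset\Omega$ be a set of locally finite h-perimeter in $\Omega$, and let $\rho\in C_c(B(0,1))$ satisfy $\rho\ge0$, $\rho(x)=\rho(x^{-1})$ and $\int_{B(0,1)}\rho\,dx=1$. Put $\rho_\varepsilon=\varepsilon^{-Q}\rho\circ\delta_{1/\varepsilon}$ and $(\rho_\varepsilon*\chi_E)(x)=\int_\Omega\rho_\varepsilon(xy^{-1})\chi_E(y)\,dy$. The distributional horizontal gradient of $\chi_E$ is a vector measure $D_H\chi_E=\sigma\,|D_H\chi_E|$ in $H\Omega$: the set function $|D_H\chi_E|$ above extends from the open sets to a Radon measure on $\Omega$, and $\sigma$ is a horizontal field, measurable with $|\sigma|=1$ $|D_H\chi_E|$-a.e., with $\int_\Omega\chi_E\operatorname{div}\phi\,dx=-\int_\Omega\langle\phi,\sigma\rangle\,d|D_H\chi_E|$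 for all $\phi\in C^1_c(H\Omega)$. Put $(\rho_\varepsilon*D_H\chi_E)(x)=\int_\Omega\rho_\varepsilon(xy^{-1})\,\sigma(y)\,d|D_H\chi_E|(y)$, computed in the frame $(X_j)$. Then: 1. For every $\varepsilon>0$ with $\Omega^{\mathcal R}_{2\varepsilon}\ne\emptyset$, the function $(\rho_\varepsilon*\chi_E)\chi_E$ belongs to $BV_{H,\mathrm{loc}}(\Omega^{\mathcal R}_{2\varepsilon})$, its distributional horizontal gradient is (in the same sense) a vector measure in $H\Omega^{\mathcal R}_{2\varepsilon}$, and the Leibniz rule $$D_H\big((\rho_\varepsilon*\chi_E)\chi_E\big)=(\rho_\varepsilon*\chi_E)\,D_H\chi_E+\chi_E\,(\rho_\varepsilon*D_H\chi_E)\,\mu$$ holds as an equality of vector measures in $H\Omega^{\mathcal R}_{2\varepsilon}$, that is, when both sides are integrated against any $\phi\in C_c(H\Omega^{\mathcal R}_{2\varepsilon})$. These measures are finite on $\Omega^{\mathcal R}_{2\varepsilon}$ if $|D_H\chi_E|(\Omega)<\infty$. 2. $\rho_\varepsilon*\chi_E\in L^\infty(\Omega;|D_H\chi_E|)$ for every $\varepsilon>0$,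 and $\rho_\varepsilon*\chi_E$ converges weakly* to the constant $1/2$ in $L^\infty(\Omega;|D_H\chi_E|)$ as $\varepsilon\to0^+$: for every $u\in L^1(\Omega;|D_H\chi_E|)$, $$\lim_{\varepsilon\to0^+}\int_\Omega(\rho_\varepsilon*\chi_E)\,u\,d|D_H\chi_E|=\frac12\int_\Omega u\,d|D_H\chi_E|.$$ -/

import Mathlib

open MeasureTheory Filter Topology Set
open scoped ENNReal

noncomputable section

section BakerCampbellHausdorff

variable {G : Type*}

/-- The right-nested bracket `[x₁, [x₂, […, xₙ]]]` of a word `x₁ x₂ … xₙ`. -/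
def nestedBracket [Zero G] (br : G → G → G) : List G → G
  | [] => 0
  | [x] => x
  | x :: y :: l => br x (nestedBracket br (y :: l))

/-- The word `x^{r₁} y^{s₁} ⋯ x^{rₙ} y^{sₙ}`, where `p i = (rᵢ, sᵢ)`. -/
def dynkinWord {n : ℕ} (p : Fin n → ℕ × ℕ) (x y : G) : List G :=
  (List.ofFn fun i => List.replicate (p i).1 x ++ List.replicate (p i).2 y).flatten

/-- The Baker–Campbell–Hausdorff product `log (exp x exp y)` of a nilpotent real Lie algebra of
step at most `s`, in Dynkin's form
`∑_{n ≥ 1} (-1)^{n-1}/n ∑_{rᵢ + sᵢ > 0} [x^{r₁} y^{s₁} ⋯ x^{rₙ} y^{sₙ}] / ((∑ᵢ (rᵢ + sᵢ)) ∏ᵢ rᵢ! sᵢ!)`.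
Brackets of more than `s` elements vanish, so that the restriction to `n ≤ s` and `rᵢ, sᵢ ≤ s`
loses nothing. -/
def bchProduct [AddCommGroup G] [Module ℝ G] (br : G → G → G) (s : ℕ) (x y : G) : G :=
  ∑ n ∈ Finset.Icc 1 s, ((-1 : ℝ) ^ (n - 1) / (n : ℝ)) •
    ∑ p ∈ Fintype.piFinset fun _ : Fin n =>
        ((Finset.range (s + 1)) ×ˢ (Finset.range (s + 1))).erase (0, 0),
      (((∑ i, (((p i).1 : ℝ) + ((p i).2 : ℝ))) *
          ∏ i, (((p i).1.factorial : ℝ) * ((p i).2.factorial : ℝ)))⁻¹ : ℝ) •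
        nestedBracket br (dynkinWord p x y)

end BakerCampbellHausdorff

/-- A stratified (Carnot) group, identified with its Lie algebra through the exponential map.
The vector space `G` carries a Lie bracket and a graded basis `e₁, …, e_q`, orthonormal for the
fixed scalar product of `G`; `deg j` is the degree of `e_j`. The layers
`H^i = span {e_j : deg j = i}` satisfy `G = H^1 ⊕ ⋯ ⊕ H^step`, `H^step ≠ 0`,
`[H^1, H^i] = H^{i+1}`, and the group operation of `G` is given by the
Baker–Campbell–Hausdorff formula. The identity element is `0`. -/
structure StratifiedGroup (G : Type*) [NormedAddCommGroup G] [InnerProductSpace ℝ G]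
    [Group G] where
  /-- the Lie bracket -/
  bracket : G →ₗ[ℝ] G →ₗ[ℝ] G
  bracket_self : ∀ x, bracket x x = 0
  jacobi : ∀ x y z,
    bracket x (bracket y z) + bracket y (bracket z x) + bracket z (bracket x y) = 0
  /-- the topological dimension -/
  dim : ℕ
  /-- the graded basis -/
  basis : OrthonormalBasis (Fin dim) ℝ G
  /-- the degrees of the basis vectors -/
  deg : Fin dim → ℕ
  /-- the step of nilpotence -/
  step : ℕ
  one_le_deg : ∀ j, 1 ≤ deg j
  deg_le_step : ∀ j, deg j ≤ step
  exists_deg_eq_step : ∃ j, deg j = step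
  bracket_layer : ∀ i, 1 ≤ i →
    Submodule.span ℝ {z : G |
        ∃ v ∈ Submodule.span ℝ (basis '' {j | deg j = 1}),
        ∃ w ∈ Submodule.span ℝ (basis '' {j | deg j = i}), z = bracket v w} =
      Submodule.span ℝ (basis '' {j | deg j = i + 1})
  mul_eq_bchProduct : ∀ x y : G, x * y = bchProduct (fun a b => bracket a b) step x y

namespace StratifiedGroup

variable {G : Type*} [NormedAddCommGroup G] [InnerProductSpace ℝ G] [Group G]

/-- The homogeneous dimension `Q = ∑ᵢ i dim H^i`. -/
def homDim (S : StratifiedGroup G) : ℕ := ∑ j, S.deg j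

/-- The dilation `δ_r`, the linear map equal to `r^i` on the layer `H^i`. -/
def dilation (S : StratifiedGroup G) (r : ℝ) (x : G) : G :=
  ∑ j, (r ^ S.deg j * inner ℝ (S.basis j) x) • S.basis j

/-- The indices `j` of the horizontal frame `X_j`, `deg j = 1`. -/
abbrev HIndex (S : StratifiedGroup G) : Type := {j : Fin S.dim // S.deg j = 1}

/-- The horizontal fibres, described by coordinates in the left invariant orthonormal frame
`(X_j)`: the horizontal vector field `∑_j φ_j X_j` is the map `φ : G → S.HFiber`. -/
abbrev HFiber (S : StratifiedGroup G) : Type := EuclideanSpace ℝ S.HIndex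

/-- The derivative `X_j f (x)` along the left invariant vector field `X_j` with `X_j(0) = e_j`. -/
def X (S : StratifiedGroup G) (j : S.HIndex) (f : G → ℝ) (x : G) : ℝ :=
  deriv (fun t : ℝ => f (x * (t • S.basis j.1))) 0

/-- The divergence `∑_j X_j φ_j` of the horizontal vector field `∑_j φ_j X_j`. -/
def hdiv (S : StratifiedGroup G) (φ : G → S.HFiber) (x : G) : ℝ :=
  ∑ j, S.X j (fun z => φ z j) x

/-- The space `C^1_c(HΩ)` of horizontal vector fields of class `C^1` with compact support
in `Ω`. -/
def C1c (S : StratifiedGroup G) (Ω : Set G) : Set (G → S.HFiber) :=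
  {φ | ContDiff ℝ 1 φ ∧ HasCompactSupport φ ∧ tsupport φ ⊆ Ω}

/-- The space `C_c(HΩ)` of continuous horizontal vector fields with compact support in `Ω`. -/
def Cc (S : StratifiedGroup G) (Ω : Set G) : Set (G → S.HFiber) :=
  {φ | Continuous φ ∧ HasCompactSupport φ ∧ tsupport φ ⊆ Ω}

/-- A homogeneous distance: a continuous, left invariant distance with
`d (δ_r p) (δ_r q) = r d p q` for `r > 0`. -/
structure HomogeneousDistance (S : StratifiedGroup G) where
  dist : G → G → ℝ
  dist_eq_zero_iff : ∀ p q, dist p q = 0 ↔ p = q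
  dist_symm : ∀ p q, dist p q = dist q p
  dist_triangle : ∀ p q z, dist p z ≤ dist p q + dist q z
  continuous_dist : Continuous fun pq : G × G => dist pq.1 pq.2
  dist_mul_left : ∀ z p q, dist (z * p) (z * q) = dist p q
  dist_dilation : ∀ r, 0 < r → ∀ p q, dist (S.dilation r p) (S.dilation r q) = r * dist p q

namespace HomogeneousDistance

variable {S : StratifiedGroup G}

/-- The open unit ball `B(0,1)`. -/
def unitBall (d : S.HomogeneousDistance) : Set G := {x | d.dist x 0 < 1}

/-- The right invariant distance `d^R(x,y) = ‖x y⁻¹‖ = d(x y⁻¹, 0)`. -/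
def distR (d : S.HomogeneousDistance) (x y : G) : ℝ := d.dist (x * y⁻¹) 0

/-- The set `Ω^R_ε` of points `x` with `dist^R(x, Ωᶜ) > ε`, where the distance from the empty set
is `∞`. -/
def innerR (d : S.HomogeneousDistance) (Ω : Set G) (ε : ℝ) : Set G :=
  {x | ENNReal.ofReal ε < ⨅ y ∈ Ωᶜ, ENNReal.ofReal (d.distR x y)}

end HomogeneousDistance

/-- The rescaled kernel `ρ_ε = ε^{-Q} ρ ∘ δ_{1/ε}`. -/
def rescale (S : StratifiedGroup G) (ρ : G → ℝ) (ε : ℝ) (x : G) : ℝ :=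
  ε⁻¹ ^ S.homDim * ρ (S.dilation ε⁻¹ x)

variable [FiniteDimensional ℝ G] [MeasurableSpace G] [BorelSpace G]

/-- A nonnegative mollifier `ρ ∈ C_c(B(0,1))` with `ρ(x) = ρ(x⁻¹)` and `∫_{B(0,1)} ρ dx = 1`.
Here `dx` is the Haar measure which is the Lebesgue measure in the graded coordinates, that is,
the volume of the scalar product of `G`. -/
structure IsMollifier (S : StratifiedGroup G) (d : S.HomogeneousDistance) (ρ : G → ℝ) :
    Prop where
  continuous : Continuous ρ
  hasCompactSupport : HasCompactSupport ρ
  tsupport_subset : tsupport ρ ⊆ d.unitBall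
  nonneg : ∀ x, 0 ≤ ρ x
  symm : ∀ x, ρ x⁻¹ = ρ x
  integral_eq_one : ∫ x in d.unitBall, ρ x = 1

/-- The mollification `ρ_ε * f (x) = ∫_Ω ρ_ε(x y⁻¹) f(y) dy` of a function on `Ω`. -/
def mollify (S : StratifiedGroup G) (ρ : G → ℝ) (ε : ℝ) (Ω : Set G) (f : G → ℝ) (x : G) : ℝ :=
  ∫ y in Ω, S.rescale ρ ε (x * y⁻¹) * f y

/-- The mollification `ρ_ε * (σ γ) (x) = ∫_Ω ρ_ε(x y⁻¹) σ(y) dγ(y)` of the vector measure `σ γ`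
in `HΩ`, in the coordinates of the frame `(X_j)`. -/
def mollifyMeasure (S : StratifiedGroup G) (ρ : G → ℝ) (ε : ℝ) (Ω : Set G) (γ : Measure G)
    (σ : G → S.HFiber) (x : G) : S.HFiber :=
  ∫ y in Ω, S.rescale ρ ε (x * y⁻¹) • σ y ∂γ

/-- The h-variation
`|D_H f|(Ω) = sup {∫_Ω f div φ dx : φ ∈ C^1_c(HΩ), |φ| ≤ 1}`. -/
def hVariation (S : StratifiedGroup G) (Ω : Set G) (f : G → ℝ) : ℝ≥0∞ :=
  ⨆ φ ∈ {φ ∈ S.C1c Ω | ∀ x, ‖φ x‖ ≤ 1}, ENNReal.ofReal (∫ x in Ω, f x * S.hdiv φ x)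

/-- `f ∈ BV_{H,loc}(Ω)`: for every open `U` with compact closure in `Ω`, `f ∈ L¹(U)` and
`|D_H f|(U) < ∞`. -/
def IsBVLoc (S : StratifiedGroup G) (Ω : Set G) (f : G → ℝ) : Prop :=
  ∀ U : Set G, IsOpen U → IsCompact (closure U) → closure U ⊆ Ω →
    IntegrableOn f U ∧ S.hVariation U f < ∞

/-- The distributional horizontal gradient of `f` in `Ω` is the vector measure
`D_H f = σ γ` in polar form: `γ = |D_H f|` is the total variation measure, a Radon measure on `Ω`
(viewed as a measure on `G` vanishing outside `Ω`), `|σ| = 1` almost everywhere, and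
`∫_Ω f div φ dx = - ∫_Ω ⟨φ, σ⟩ dγ` for all `φ ∈ C^1_c(HΩ)`. These conditions determine `γ`, and
determine `σ` up to `γ`-negligible sets. -/
structure IsHGradient (S : StratifiedGroup G) (Ω : Set G) (f : G → ℝ) (γ : Measure G)
    (σ : G → S.HFiber) : Prop where
  measure_compl : γ Ωᶜ = 0
  measure_compact : ∀ K : Set G, IsCompact K → K ⊆ Ω → γ K < ∞
  measure_open : ∀ U : Set G, IsOpen U → U ⊆ Ω → γ U = S.hVariation U f
  aestronglyMeasurable : AEStronglyMeasurable σ γ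
  norm_eq_one : ∀ᵐ x ∂γ, ‖σ x‖ = 1
  integral_hdiv : ∀ φ ∈ S.C1c Ω,
    ∫ x in Ω, f x * S.hdiv φ x = - ∫ x in Ω, inner ℝ (φ x) (σ x) ∂γ

/-- The characteristic function of `E`. -/
def chi (E : Set G) : G → ℝ := E.indicator fun _ => 1

/-- A measurable set `E` has locally finite h-perimeter in `Ω` if `χ_E ∈ BV_{H,loc}(Ω)`. -/
def HasLocallyFiniteHPerimeter (S : StratifiedGroup G) (Ω E : Set G) : Prop :=
  NullMeasurableSet E ∧ S.IsBVLoc Ω (chi E)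

end StratifiedGroup

end

set_option linter.unusedSectionVars false

noncomputable section

/-! ### Nested brackets and the Baker–Campbell–Hausdorff product -/

section NestedBracket

variable {G : Type*}

/-! Write `f = χ_E`, `D_H f = σγ` and `u_ε = ρ_ε * f`. Everything rests on one computation in the
group: `x exp(t e_j) y⁻¹ = x (y exp(-t e_j))⁻¹`, so a left invariant derivative of `k(x y⁻¹)` in `x`
is minus the same derivative in `y`. For a `C^1` kernel this gives `X_j(k * f) = (k * D_H f)_j` at
the points from which the kernel does not leave `Ω` (`IsHGradient.X_kernelIntegral_eq`). Testing
`D_H f` on the field `(k * f)φ` then yields `∫ (k * f) f div φ = -∫ (k * f)⟨φ, σ⟩ dγ - ∫ f ⟨φ, k *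
D_H f⟩ dx`. Neither side involves a derivative of `k`, so the identity passes to continuous kernels
by dominated convergence (`IsHGradient.leibniz`). It also bounds the h-variation of `(k * f) f`,
which gives the BV and finiteness claims.

For the limit, take `k = ρ_ε`. Fubini and the symmetry of `ρ` move the mollifier in the last
integral from `D_H f` to `fφ`. Since `φ` is continuous, `ρ_ε * (fφ) - u_ε φ` tends to `0`, so the
two integrals on the right have asymptotically equal values
(`IsMollifier.tendsto_integral_inner_sub`). The left side tends to `∫ f² div φ = ∫ f div φ = -∫ ⟨φ,
σ⟩ dγ`, because `f² = f`. Hence `2 ∫ u_ε ⟨φ, σ⟩ dγ` tends to `∫ ⟨φ, σ⟩ dγ` for every test field. As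
`|u_ε σ| ≤ 1` almost everywhere, density of test fields in `L¹(γ)` allows `φ` to be replaced by
`uσ`, and `|σ| = 1` turns this into the scalar statement.

That `D_H f` is a vector measure at all is a Riesz theorem for locally bounded functionals on `C^1`
fields (`IsLocallyBounded.exists_polar`), and its mass on open sets is recovered in
`measure_eq_iSup_of_polar`. The facts needed about the group are that `x⁻¹ = -x`, that the product
is smooth, that dilations are automorphisms, and that Lebesgue measure is invariant under right
translation and inversion. -/

theorem nestedBracket_map [Zero G] {H : Type*} [Zero H] (br : G → G → G) (br' : H → H → H)
    (f : G → H) (h0 : f 0 = 0) (hf : ∀ x y, f (br x y) = br' (f x) (f y)) :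
    ∀ l : List G, f (nestedBracket br l) = nestedBracket br' (l.map f)
  | [] => h0
  | [_] => rfl
  | x :: y :: l => by
    have := nestedBracket_map br br' f h0 hf (y :: l)
    simp only [List.map_cons, nestedBracket] at this ⊢
    rw [hf, this]

theorem dynkinWord_map {H : Type*} {n : ℕ} (p : Fin n → ℕ × ℕ) (x y : G) (f : G → H) :
    (dynkinWord p x y).map f = dynkinWord p (f x) (f y) := by
  simp only [dynkinWord, List.map_flatten, List.map_ofFn]
  congr 2
  funext i
  simp

theorem mem_dynkinWord {n : ℕ} {p : Fin n → ℕ × ℕ} {x y z : G} (h : z ∈ dynkinWord p x y) :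
    z = x ∨ z = y := by
  simp only [dynkinWord, List.mem_flatten, List.mem_ofFn] at h
  obtain ⟨l, ⟨i, rfl⟩, hz⟩ := h
  rcases List.mem_append.1 hz with h | h
  · exact Or.inl (List.eq_of_mem_replicate h)
  · exact Or.inr (List.eq_of_mem_replicate h)

theorem length_dynkinWord {n : ℕ} (p : Fin n → ℕ × ℕ) (x y : G) :
    (dynkinWord p x y).length = ∑ i, ((p i).1 + (p i).2) := by
  simp only [dynkinWord, List.length_flatten, List.map_ofFn, List.sum_ofFn]
  exact Finset.sum_congr rfl fun i _ => by simp

/-- Brackets of at least two commuting elements vanish. -/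
theorem nestedBracket_eq_zero [Zero G] (br : G → G → G) (A : Set G)
    (hA : ∀ x ∈ A, ∀ y ∈ A, br x y = 0) (h0 : ∀ x ∈ A, br x 0 = 0) :
    ∀ l : List G, (∀ z ∈ l, z ∈ A) → 2 ≤ l.length → nestedBracket br l = 0
  | [], _, h => by simp at h
  | [_], _, h => by simp at h
  | [x, y], hl, _ => hA x (hl x (by simp)) y (hl y (by simp))
  | x :: y :: z :: l, hl, _ => by
    have := nestedBracket_eq_zero br A hA h0 (y :: z :: l)
      (fun w hw => hl w (List.mem_cons_of_mem _ hw)) (by simp)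
    change br x (nestedBracket br (y :: z :: l)) = 0
    rw [this]
    exact h0 x (hl x (by simp))

/-- The product is a linear combination of bracket words with universal coefficients, so it is
natural under Lie algebra endomorphisms. It is applied to dilations. -/
theorem bchProduct_map [AddCommGroup G] [Module ℝ G] (br : G → G → G) (s : ℕ)
    (f : G →ₗ[ℝ] G) (hf : ∀ x y, f (br x y) = br (f x) (f y)) (x y : G) :
    f (bchProduct br s x y) = bchProduct br s (f x) (f y) := by
  simp only [bchProduct, map_sum, map_smul]
  refine Finset.sum_congr rfl fun n _ => ?_
  congr 1
  refine Finset.sum_congr rfl fun p _ => ?_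
  rw [nestedBracket_map br br f (map_zero f) hf, dynkinWord_map]

/-- The Baker–Campbell–Hausdorff product of commuting elements is their sum. -/
theorem bchProduct_of_commute [AddCommGroup G] [Module ℝ G] (br : G → G → G) {s : ℕ}
    (hs : 1 ≤ s) (A : Set G) (hA : ∀ x ∈ A, ∀ y ∈ A, br x y = 0) (h0 : ∀ x ∈ A, br x 0 = 0)
    {x y : G} (hx : x ∈ A) (hy : y ∈ A) : bchProduct br s x y = x + y := by
  have hmem : ∀ {n : ℕ} (p : Fin n → ℕ × ℕ), ∀ z ∈ dynkinWord p x y, z ∈ A := by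
    intro n p z hz
    rcases mem_dynkinWord hz with rfl | rfl <;> assumption
  have hvan : ∀ {n : ℕ} (p : Fin n → ℕ × ℕ), 2 ≤ ∑ i, ((p i).1 + (p i).2) →
      nestedBracket br (dynkinWord p x y) = 0 := fun p hp =>
    nestedBracket_eq_zero br A hA h0 _ (hmem p) (by rwa [length_dynkinWord])
  -- Every pair `(rᵢ, sᵢ)` is nonzero, so a word with `n` pairs has length at least `n`. Words of
  -- length at least two vanish, which leaves only the one-letter words `x` and `y` in the term `n =
  -- 1`.
  rw [bchProduct, Finset.sum_eq_single 1]
  · let p₁ : Fin 1 → ℕ × ℕ := fun _ => (1, 0)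
    let p₂ : Fin 1 → ℕ × ℕ := fun _ => (0, 1)
    have hne : p₁ ≠ p₂ := fun h => by simpa [p₁, p₂] using congrFun h 0
    rw [← Finset.sum_subset (s₁ := {p₁, p₂})]
    · rw [Finset.sum_pair hne]
      simp [p₁, p₂, dynkinWord, nestedBracket]
    · intro p hp
      simp only [Finset.mem_insert, Finset.mem_singleton] at hp
      rcases hp with rfl | rfl <;> simp [p₁, p₂] <;> omega
    · intro p hp hp'
      rw [hvan, smul_zero]
      simp only [Fintype.mem_piFinset, Finset.mem_erase] at hp
      simp only [Finset.mem_insert, Finset.mem_singleton, not_or] at hp'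
      rw [Fin.sum_univ_one]
      by_contra hlt
      have h1 := (hp 0).1
      rcases hab : p 0 with ⟨a, b⟩
      rw [hab] at hlt h1
      have : (a = 1 ∧ b = 0) ∨ (a = 0 ∧ b = 1) := by
        simp only [ne_eq, Prod.mk.injEq] at h1
        simp only at hlt
        omega
      rcases this with ⟨rfl, rfl⟩ | ⟨rfl, rfl⟩
      · exact hp'.1 (funext fun i => by rw [Subsingleton.elim i 0, hab])
      · exact hp'.2 (funext fun i => by rw [Subsingleton.elim i 0, hab])
  · intro n hn hn1
    rw [Finset.sum_eq_zero, smul_zero]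
    intro p hp
    rw [hvan, smul_zero]
    simp only [Fintype.mem_piFinset, Finset.mem_erase] at hp
    have hone : ∀ i, 1 ≤ (p i).1 + (p i).2 := by
      intro i
      by_contra h
      exact (hp i).1 (Prod.ext (by simp; omega) (by simp; omega))
    calc 2 ≤ n := by have := (Finset.mem_Icc.1 hn).1; omega
      _ = ∑ _i : Fin n, 1 := by simp
      _ ≤ _ := Finset.sum_le_sum fun i _ => hone i
  · intro h
    exact absurd (Finset.mem_Icc.2 ⟨le_rfl, hs⟩) h

end NestedBracket

/-! ### Algebra of the group law and the dilations -/

namespace StratifiedGroup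

variable {G : Type*} [NormedAddCommGroup G] [InnerProductSpace ℝ G] [Group G]

theorem one_le_step (S : StratifiedGroup G) : 1 ≤ S.step := by
  obtain ⟨j, hj⟩ := S.exists_deg_eq_step
  exact hj ▸ S.one_le_deg j

/-- Multiples of one vector commute, so lines through the origin are one-parameter subgroups. This
identifies the unit with `0` and the inverse with `-x`. -/
theorem smul_mul_smul (S : StratifiedGroup G) (a b : ℝ) (v : G) :
    (a • v) * (b • v) = (a + b) • v := by
  rw [S.mul_eq_bchProduct, add_smul]
  refine bchProduct_of_commute _ S.one_le_step (Set.range fun c : ℝ => c • v) ?_ ?_ ⟨a, rfl⟩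
    ⟨b, rfl⟩
  · rintro _ ⟨c, rfl⟩ _ ⟨e, rfl⟩
    simp [S.bracket_self]
  · simp

theorem one_eq_zero (S : StratifiedGroup G) : (1 : G) = 0 := by
  have h := S.smul_mul_smul 0 0 (0 : G)
  simp only [smul_zero] at h
  exact (mul_eq_left.1 h).symm

theorem mul_zero' (S : StratifiedGroup G) (x : G) : x * 0 = x := by
  rw [← S.one_eq_zero, mul_one]

theorem zero_mul' (S : StratifiedGroup G) (x : G) : 0 * x = x := by
  rw [← S.one_eq_zero, one_mul]

theorem inv_eq_neg (S : StratifiedGroup G) (x : G) : x⁻¹ = -x := by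
  refine inv_eq_of_mul_eq_one_right ?_
  have h := S.smul_mul_smul 1 (-1) x
  simpa [S.one_eq_zero] using h

theorem bracket_swap (S : StratifiedGroup G) (x y : G) : S.bracket x y = -S.bracket y x := by
  have h := S.bracket_self (x + y)
  simp only [map_add, LinearMap.add_apply, S.bracket_self, zero_add, add_zero] at h
  exact eq_neg_of_add_eq_zero_right h

/-- The layer `H^i`. -/
def layer (S : StratifiedGroup G) (i : ℕ) : Submodule ℝ G :=
  Submodule.span ℝ (S.basis '' {j | S.deg j = i})

/-- The structure only gives `[H^1, H^k] = H^{k+1}`. Since `H^{i+1}` is spanned by brackets `[v, w]`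
with `v ∈ H^1` and `w ∈ H^i`, the Jacobi identity reduces `[[v, w], y]` to brackets already
controlled by induction on `i`. -/
theorem bracket_mem_layer (S : StratifiedGroup G) {i k : ℕ} (hi : 1 ≤ i) (hk : 1 ≤ k) {x y : G}
    (hx : x ∈ S.layer i) (hy : y ∈ S.layer k) : S.bracket x y ∈ S.layer (i + k) := by
  have base : ∀ {k : ℕ}, 1 ≤ k → ∀ {x y : G}, x ∈ S.layer 1 → y ∈ S.layer k →
      S.bracket x y ∈ S.layer (k + 1) := by
    intro k hk x y hx hy
    rw [layer, ← S.bracket_layer k hk]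
    exact Submodule.subset_span ⟨x, hx, y, hy, rfl⟩
  induction i, hi using Nat.le_induction generalizing k x y with
  | base => simpa only [add_comm] using base hk hx hy
  | succ i hi ih =>
    rw [layer, ← S.bracket_layer i hi] at hx
    induction hx using Submodule.span_induction with
    | mem z hz =>
      obtain ⟨v, hv, w, hw, rfl⟩ := hz
      have h1 := base (by omega) hv (ih hk hw hy)
      have h2 := ih (k := k + 1) (by omega) hw (base hk hv hy)
      have hj := S.jacobi v w y
      rw [S.bracket_swap y (S.bracket v w), S.bracket_swap y v, map_neg] at hj
      have : S.bracket (S.bracket v w) y =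
          S.bracket v (S.bracket w y) - S.bracket w (S.bracket v y) := by
        rw [← sub_eq_zero, ← neg_eq_zero, ← hj]
        abel
      rw [this]
      have e1 : i + k + 1 = i + 1 + k := by omega
      have e2 : i + (k + 1) = i + 1 + k := by omega
      exact Submodule.sub_mem _ (e1 ▸ h1) (e2 ▸ h2)
    | zero => simp
    | add a b _ _ ha hb =>
      rw [map_add, LinearMap.add_apply]
      exact Submodule.add_mem _ ha hb
    | smul c a _ ha =>
      rw [map_smul, LinearMap.smul_apply]
      exact Submodule.smul_mem _ _ ha

/-- The dilation as a linear map. -/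
def dilationₗ (S : StratifiedGroup G) (r : ℝ) : G →ₗ[ℝ] G where
  toFun := S.dilation r
  map_add' x y := by
    simp only [dilation, inner_add_right, mul_add, add_smul, Finset.sum_add_distrib]
  map_smul' c x := by
    simp only [dilation, inner_smul_right, Finset.smul_sum, smul_smul, RingHom.id_apply]
    exact Finset.sum_congr rfl fun j _ => by ring_nf

@[simp]
theorem dilationₗ_apply (S : StratifiedGroup G) (r : ℝ) (x : G) :
    S.dilationₗ r x = S.dilation r x := rfl

theorem dilation_basis (S : StratifiedGroup G) (r : ℝ) (i : Fin S.dim) :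
    S.dilation r (S.basis i) = r ^ S.deg i • S.basis i := by
  rw [dilation, Finset.sum_eq_single i]
  · simp
  · intro j _ hj
    simp [S.basis.inner_eq_zero hj]
  · simp

theorem dilation_of_mem_layer (S : StratifiedGroup G) (r : ℝ) {i : ℕ} {x : G}
    (hx : x ∈ S.layer i) : S.dilation r x = r ^ i • x := by
  induction hx using Submodule.span_induction with
  | mem z hz =>
    obtain ⟨j, rfl, rfl⟩ := hz
    exact S.dilation_basis r j
  | zero => rw [← dilationₗ_apply, map_zero, smul_zero]
  | add a b _ _ ha hb =>
    rw [← dilationₗ_apply, map_add, dilationₗ_apply, dilationₗ_apply, ha, hb, smul_add]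
  | smul c a _ ha => rw [← dilationₗ_apply, map_smul, dilationₗ_apply, ha, smul_comm]

/-- By bilinearity it suffices to compare basis vectors, where additivity of degrees makes both
sides scale by `r ^ (deg i + deg j)`. -/
theorem dilation_bracket (S : StratifiedGroup G) (r : ℝ) (x y : G) :
    S.dilation r (S.bracket x y) = S.bracket (S.dilation r x) (S.dilation r y) := by
  have h : S.bracket.compr₂ (S.dilationₗ r) =
      S.bracket.compl₁₂ (S.dilationₗ r) (S.dilationₗ r) := by
    refine S.basis.toBasis.ext fun i => S.basis.toBasis.ext fun j => ?_
    have hmem : ∀ i, S.basis i ∈ S.layer (S.deg i) := fun i =>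
      Submodule.subset_span ⟨i, rfl, rfl⟩
    simp only [OrthonormalBasis.coe_toBasis, LinearMap.compr₂_apply, LinearMap.compl₁₂_apply,
      dilationₗ_apply, dilation_basis, map_smul, LinearMap.smul_apply]
    rw [S.dilation_of_mem_layer r
      (S.bracket_mem_layer (S.one_le_deg i) (S.one_le_deg j) (hmem i) (hmem j)), smul_smul,
      pow_add, mul_comm]
  exact LinearMap.congr_fun₂ h x y

theorem dilation_mul (S : StratifiedGroup G) (r : ℝ) (x y : G) :
    S.dilation r (x * y) = S.dilation r x * S.dilation r y := by
  rw [S.mul_eq_bchProduct, S.mul_eq_bchProduct]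
  exact bchProduct_map (fun a b => S.bracket a b) S.step (S.dilationₗ r)
    (S.dilation_bracket r) x y

theorem dilation_zero (S : StratifiedGroup G) (x : G) : S.dilation 0 x = 0 := by
  refine Finset.sum_eq_zero fun j _ => ?_
  rw [zero_pow (by have := S.one_le_deg j; omega), zero_mul, zero_smul]

theorem dilation_one (S : StratifiedGroup G) (x : G) : S.dilation 1 x = x := by
  simpa [dilation] using S.basis.sum_repr' x

theorem dilation_dilation (S : StratifiedGroup G) (r s : ℝ) (x : G) :
    S.dilation r (S.dilation s x) = S.dilation (r * s) x := by
  conv_lhs => rw [dilation.eq_1 S s]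
  rw [← dilationₗ_apply, map_sum]
  refine Finset.sum_congr rfl fun j _ => ?_
  rw [map_smul, dilationₗ_apply, dilation_basis, smul_smul, mul_pow]
  ring_nf

theorem continuous_dilation (S : StratifiedGroup G) :
    Continuous fun p : ℝ × G => S.dilation p.1 p.2 := by
  unfold dilation
  fun_prop

theorem det_dilationₗ (S : StratifiedGroup G) (r : ℝ) :
    LinearMap.det (S.dilationₗ r) = r ^ S.homDim := by
  rw [← LinearMap.det_toMatrix S.basis.toBasis]
  have : LinearMap.toMatrix S.basis.toBasis S.basis.toBasis (S.dilationₗ r) =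
      Matrix.diagonal fun j => r ^ S.deg j := by
    ext i j
    rw [LinearMap.toMatrix_apply, Matrix.diagonal_apply]
    simp only [OrthonormalBasis.coe_toBasis, dilationₗ_apply, dilation_basis]
    by_cases h : i = j
    · subst h; simp
    · simp [h]
  rw [this, Matrix.det_diagonal, homDim, Finset.prod_pow_eq_pow_sum]

theorem continuous_inv_comp (S : StratifiedGroup G) {H : Type*} [TopologicalSpace H]
    {f : H → G} (hf : Continuous f) : Continuous fun h => (f h)⁻¹ := by
  simp only [S.inv_eq_neg]
  exact hf.neg

/-! ### Smoothness of the product and Jacobian of translations -/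

section Smooth

variable [FiniteDimensional ℝ G]

theorem contDiff_nestedBracket (S : StratifiedGroup G) {H : Type*} [NormedAddCommGroup H]
    [NormedSpace ℝ H] {n : WithTop ℕ∞} :
    ∀ l : List (H → G), (∀ f ∈ l, ContDiff ℝ n f) →
      ContDiff ℝ n fun h => nestedBracket (fun a b => S.bracket a b) (l.map fun f => f h)
  | [], _ => contDiff_const
  | [f], hl => hl f (by simp)
  | f :: g :: l, hl => by
    have h1 := hl f (by simp)
    have h2 := contDiff_nestedBracket S (g :: l) fun f hf => hl f (List.mem_cons_of_mem _ hf)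
    have : ContDiff ℝ n fun h => (S.bracket.toContinuousBilinearMap) (f h)
        (nestedBracket (fun a b => S.bracket a b) ((g :: l).map fun f => f h)) :=
      (ContinuousLinearMap.contDiff _ |>.comp h1).clm_apply h2
    exact this

/-- In exponential coordinates the product is a finite sum of nested brackets, hence polynomial. The
words are taken in the two projections, viewed as functions on `G × G`. -/
theorem contDiff_mul (S : StratifiedGroup G) {n : WithTop ℕ∞} :
    ContDiff ℝ n fun p : G × G => p.1 * p.2 := by
  simp only [S.mul_eq_bchProduct, bchProduct]
  refine ContDiff.sum fun m _ => ContDiff.const_smul _ <| ContDiff.sum fun p _ =>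
    ContDiff.const_smul _ ?_
  have := contDiff_nestedBracket S (n := n)
    (dynkinWord p (Prod.fst : G × G → G) (Prod.snd : G × G → G)) (by
      intro f hf
      rcases mem_dynkinWord hf with rfl | rfl
      · exact contDiff_fst
      · exact contDiff_snd)
  convert this using 2 with q
  rw [dynkinWord_map]

theorem contDiff_mul_comp (S : StratifiedGroup G) {H : Type*} [NormedAddCommGroup H]
    [NormedSpace ℝ H] {n : WithTop ℕ∞} {f g : H → G} (hf : ContDiff ℝ n f) (hg : ContDiff ℝ n g) :
    ContDiff ℝ n fun h => f h * g h :=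
  S.contDiff_mul.comp (hf.prodMk hg)

theorem continuous_mul_comp (S : StratifiedGroup G) {H : Type*} [TopologicalSpace H]
    {f g : H → G} (hf : Continuous f) (hg : Continuous g) : Continuous fun h => f h * g h :=
  (S.contDiff_mul (n := 0)).continuous.comp (hf.prodMk hg)

/-- The derivative of the right translation `x ↦ x a`. -/
def rightDeriv (_S : StratifiedGroup G) (a x : G) : G →L[ℝ] G := fderiv ℝ (fun z => z * a) x

theorem hasFDerivAt_mul_right (S : StratifiedGroup G) (a x : G) :
    HasFDerivAt (fun z => z * a) (S.rightDeriv a x) x :=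
  ((S.contDiff_mul_comp (n := 1) contDiff_id contDiff_const).differentiable
    (by norm_num) x).hasFDerivAt

theorem continuous_rightDeriv (S : StratifiedGroup G) :
    Continuous fun p : G × G => S.rightDeriv p.1 p.2 := by
  have h : ∀ p : G × G, S.rightDeriv p.1 p.2 =
      (fderiv ℝ (fun q : G × G => q.1 * q.2) (p.2, p.1)).comp (ContinuousLinearMap.inl ℝ G G) := by
    intro p
    refine (S.hasFDerivAt_mul_right p.1 p.2).unique ?_
    have h1 := (S.contDiff_mul (n := 1)).differentiable (by norm_num) (p.2, p.1) |>.hasFDerivAt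
    have h2 : HasFDerivAt (fun z : G => (z, p.1)) (ContinuousLinearMap.inl ℝ G G) p.2 :=
      hasFDerivAt_prodMk_left _ _
    exact h1.comp p.2 h2
  simp only [h]
  have hc := (S.contDiff_mul (n := 1)).continuous_fderiv (by norm_num)
  exact (hc.comp continuous_swap).clm_comp continuous_const

/-- Dilations are automorphisms, so conjugating by `δ_r` leaves the Jacobian unchanged: its value at
`(a, x)` equals its value at `(δ_r a, δ_r x)`. Letting `r → 0`, continuity gives the value at `(0,
0)`, where the translation is the identity. -/
theorem det_rightDeriv (S : StratifiedGroup G) (a x : G) : (S.rightDeriv a x).det = 1 := by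
  have hinv : ∀ r : ℝ, r ≠ 0 →
      (S.rightDeriv (S.dilation r a) (S.dilation r x)).det = (S.rightDeriv a x).det := by
    intro r hr
    let D : G →L[ℝ] G := (S.dilationₗ r).toContinuousLinearMap
    have hD : ∀ z, D z = S.dilation r z := fun z => rfl
    have h1 : HasFDerivAt (fun z => S.dilation r z * S.dilation r a)
        ((S.rightDeriv (S.dilation r a) (S.dilation r x)).comp D) x :=
      (S.hasFDerivAt_mul_right (S.dilation r a) (S.dilation r x)).comp x (D.hasFDerivAt (x := x))
    have h2 : HasFDerivAt (fun z => S.dilation r (z * a)) (D.comp (S.rightDeriv a x)) x :=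
      HasFDerivAt.comp (g := D) x (D.hasFDerivAt (x := x * a)) (S.hasFDerivAt_mul_right a x)
    have h3 : (S.rightDeriv (S.dilation r a) (S.dilation r x)).comp D =
        D.comp (S.rightDeriv a x) := by
      refine h1.unique (h2.congr_of_eventuallyEq (.of_forall fun z => ?_))
      exact (S.dilation_mul r z a).symm
    have h4 := congrArg (fun A : G →L[ℝ] G => LinearMap.det (A : G →ₗ[ℝ] G)) h3
    simp only [ContinuousLinearMap.toLinearMap_comp, LinearMap.det_comp] at h4
    have h5 : LinearMap.det (D : G →ₗ[ℝ] G) ≠ 0 := by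
      have : (D : G →ₗ[ℝ] G) = S.dilationₗ r := rfl
      rw [this, S.det_dilationₗ]
      exact pow_ne_zero _ hr
    rw [mul_comm] at h4
    exact mul_left_cancel₀ h5 h4
  have hcont : Continuous fun r : ℝ =>
      (S.rightDeriv (S.dilation r a) (S.dilation r x)).det := by
    have hδ : ∀ z : G, Continuous fun r : ℝ => S.dilation r z := fun z =>
      S.continuous_dilation.comp (continuous_id.prodMk continuous_const)
    exact ContinuousLinearMap.continuous_det.comp
      (S.continuous_rightDeriv.comp ((hδ a).prodMk (hδ x)))
  have h0 : Tendsto (fun r : ℝ => (S.rightDeriv (S.dilation r a) (S.dilation r x)).det) (𝓝[≠] 0)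
      (𝓝 (S.rightDeriv a x).det) :=
    tendsto_const_nhds.congr' (by
      filter_upwards [self_mem_nhdsWithin] with r hr using (hinv r hr).symm)
  have h1 := (hcont.tendsto 0).mono_left (nhdsWithin_le_nhds (s := {0}ᶜ))
  rw [tendsto_nhds_unique h0 h1, S.dilation_zero, S.dilation_zero]
  have : S.rightDeriv 0 0 = ContinuousLinearMap.id ℝ G := by
    refine (S.hasFDerivAt_mul_right 0 0).unique ?_
    simp only [S.mul_zero']
    exact hasFDerivAt_id _
  rw [this]
  exact LinearMap.det_id

end Smooth

/-! ### Invariance of Lebesgue measure -/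

section Measure

variable [FiniteDimensional ℝ G] [MeasurableSpace G] [BorelSpace G]

theorem measurePreserving_mul_right (S : StratifiedGroup G) (a : G) :
    MeasurePreserving (fun x : G => x * a) volume volume := by
  refine ⟨(S.continuous_mul_comp continuous_id continuous_const).measurable, ?_⟩
  have h := map_withDensity_abs_det_fderiv_eq_addHaar (volume : Measure G) (s := univ)
    (f := fun x => x * a) (f' := S.rightDeriv a) nullMeasurableSet_univ
    (fun x _ => (S.hasFDerivAt_mul_right a x).hasFDerivWithinAt) (mul_left_injective a).injOn
  simp only [S.det_rightDeriv, abs_one, ENNReal.ofReal_one, Measure.restrict_univ, image_univ,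
    (Group.mulRight_bijective a).surjective.range_eq] at h
  have h1 : (fun _ : G => (1 : ℝ≥0∞)) = 1 := rfl
  rw [h1, withDensity_one] at h
  exact h

theorem measurePreserving_inv (S : StratifiedGroup G) :
    MeasurePreserving (fun x : G => x⁻¹) volume volume := by
  simp only [S.inv_eq_neg]
  exact Measure.measurePreserving_neg volume

theorem measurableEmbedding_mul_right (S : StratifiedGroup G) (a : G) :
    MeasurableEmbedding fun x : G => x * a :=
  Homeomorph.measurableEmbedding
    { Equiv.mulRight a with
      continuous_toFun := S.continuous_mul_comp continuous_id continuous_const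
      continuous_invFun := S.continuous_mul_comp continuous_id continuous_const }

end Measure

end StratifiedGroup

/-! ### Compactly supported fields: approximation and density in `L¹` -/

section CompactlySupportedFields

variable {G F : Type*} [NormedAddCommGroup G] [NormedSpace ℝ G] [NormedAddCommGroup F]
  [NormedSpace ℝ F]

variable (G F) in
/-- The continuous maps `G → F` with compact support in `U`. -/
def contFields (U : Set G) : Submodule ℝ (G → F) where
  carrier := {φ | Continuous φ ∧ HasCompactSupport φ ∧ tsupport φ ⊆ U}
  add_mem' := fun ha hb => ⟨ha.1.add hb.1, ha.2.1.add hb.2.1,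
    (tsupport_add _ _).trans (union_subset ha.2.2 hb.2.2)⟩
  zero_mem' := ⟨continuous_const, HasCompactSupport.zero, by
    rw [tsupport_eq_empty_iff.2 rfl]; exact empty_subset _⟩
  smul_mem' := fun c _ ha => ⟨ha.1.const_smul c, ha.2.1.smul_left (f := fun _ => c),
    (tsupport_smul_subset_right (fun _ => c) _).trans ha.2.2⟩

variable (G F) in
/-- The `C^1` maps `G → F` with compact support in `U`. -/
def c1Fields (U : Set G) : Submodule ℝ (G → F) where
  carrier := {φ | ContDiff ℝ 1 φ ∧ HasCompactSupport φ ∧ tsupport φ ⊆ U}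
  add_mem' := fun ha hb => ⟨ha.1.add hb.1, ha.2.1.add hb.2.1,
    (tsupport_add _ _).trans (union_subset ha.2.2 hb.2.2)⟩
  zero_mem' := ⟨contDiff_const, HasCompactSupport.zero, by
    rw [tsupport_eq_empty_iff.2 rfl]; exact empty_subset _⟩
  smul_mem' := fun c _ ha => ⟨ha.1.const_smul c, ha.2.1.smul_left (f := fun _ => c),
    (tsupport_smul_subset_right (fun _ => c) _).trans ha.2.2⟩

theorem c1Fields_le_contFields (U : Set G) : c1Fields G F U ≤ contFields G F U :=
  fun _ h => ⟨h.1.continuous, h.2⟩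

theorem c1Fields_mono {U V : Set G} (h : U ⊆ V) : c1Fields G F U ≤ c1Fields G F V :=
  fun _ hφ => ⟨hφ.1, hφ.2.1, hφ.2.2.trans h⟩

theorem exists_norm_le_of_mem_contFields {U : Set G} {φ : G → F} (hφ : φ ∈ contFields G F U) :
    ∃ C, 0 ≤ C ∧ ∀ x, ‖φ x‖ ≤ C := by
  obtain ⟨C, hC⟩ := hφ.1.norm.bddAbove_range_of_hasCompactSupport hφ.2.1.norm
  exact ⟨C, (norm_nonneg _).trans (hC ⟨0, rfl⟩), fun x => hC ⟨x, rfl⟩⟩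

theorem smul_mem_contFields {U : Set G} {c : G → ℝ} (hc : Continuous c) {φ : G → F}
    (hφ : φ ∈ contFields G F U) : (fun x => c x • φ x) ∈ contFields G F U :=
  ⟨hc.smul hφ.1, hφ.2.1.smul_left (f := c), (tsupport_smul_subset_right c φ).trans hφ.2.2⟩

/-- Uniform approximation of continuous fields by `C^1` fields with smaller norm and support. -/
theorem exists_c1Fields_approx [FiniteDimensional ℝ G] {U : Set G} {φ : G → F}
    (hφ : φ ∈ contFields G F U) {η : ℝ} (hη : 0 < η) :
    ∃ ψ ∈ c1Fields G F U, tsupport ψ ⊆ tsupport φ ∧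
      ∀ x, ‖ψ x - φ x‖ ≤ η ∧ ‖ψ x‖ ≤ ‖φ x‖ := by
  obtain ⟨δ, hδ, rfl⟩ : ∃ δ, 0 < δ ∧ η = δ + δ := ⟨η / 2, by positivity, by ring⟩
  have hmax : ∀ x, 0 < max δ ‖φ x‖ := fun x => lt_max_of_lt_left hδ
  -- Soft thresholding: `cφ` has norm `max (|φ| - δ) 0`. A `δ`-approximation of `cφ` supported where
  -- `cφ ≠ 0` therefore has norm at most `|φ|`, and the total error is at most `δ + δ`.
  set c : G → ℝ := fun x => 1 - δ / max δ ‖φ x‖ with hc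
  have hcc : Continuous c :=
    continuous_const.sub (continuous_const.div (continuous_const.max hφ.1.norm)
      fun x => (hmax x).ne')
  have hc0 : ∀ x, ‖φ x‖ ≤ δ → c x = 0 := by
    intro x hx
    simp [hc, max_eq_left hx, hδ.ne']
  have hc1 : ∀ x, δ < ‖φ x‖ → ‖c x • φ x‖ = ‖φ x‖ - δ := by
    intro x hx
    have hpos : 0 < ‖φ x‖ := hδ.trans hx
    have : 0 ≤ c x := by
      simp only [hc, max_eq_right hx.le, sub_nonneg]
      exact (div_le_one hpos).2 hx.le
    rw [norm_smul, Real.norm_of_nonneg this]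
    simp only [hc, max_eq_right hx.le]
    field_simp
  have hdist : ∀ x, ‖c x • φ x - φ x‖ ≤ δ := by
    intro x
    have : c x • φ x - φ x = -((δ / max δ ‖φ x‖) • φ x) := by
      simp only [hc, sub_smul, one_smul]; abel
    rw [this, norm_neg, norm_smul, Real.norm_of_nonneg (div_nonneg hδ.le (hmax x).le), div_mul_eq_mul_div,
      div_le_iff₀ (hmax x)]
    exact mul_le_mul_of_nonneg_left (le_max_right _ _) hδ.le
  obtain ⟨ψ, hψ1, hψ2, hψ3⟩ := (hcc.smul hφ.1).exists_contDiff_approx 1 (continuous_const (y := δ))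
    (fun _ => hδ)
  have hsupp : Function.support ψ ⊆ Function.support φ := hψ3.trans
    (Function.support_smul_subset_right c φ)
  refine ⟨ψ, ⟨hψ1, hφ.2.1.mono hsupp, (closure_mono hsupp).trans hφ.2.2⟩, closure_mono hsupp,
    fun x => ⟨?_, ?_⟩⟩
  · have h1 := hψ2 x
    rw [dist_eq_norm] at h1
    calc ‖ψ x - φ x‖ = ‖(ψ x - c x • φ x) + (c x • φ x - φ x)‖ := by congr 1; abel
      _ ≤ _ := (norm_add_le _ _).trans (add_le_add h1.le (hdist x))
  · by_cases hx : ‖φ x‖ ≤ δ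
    · have : ψ x = 0 := by
        by_contra h
        exact hψ3 h (by simp [hc0 x hx])
      simp [this]
    · have h1 := hψ2 x
      rw [dist_eq_norm] at h1
      have h2 := hc1 x (not_le.1 hx)
      have h3 := norm_sub_norm_le (ψ x) (c x • φ x)
      simp only [Pi.smul_apply'] at h1
      linarith

theorem exists_c1Fields_seq [FiniteDimensional ℝ G] {U : Set G} {φ : G → F}
    (hφ : φ ∈ contFields G F U) :
    ∃ ψ : ℕ → G → F, (∀ n, ψ n ∈ c1Fields G F U ∧ tsupport (ψ n) ⊆ tsupport φ ∧
      ∀ x, ‖ψ n x‖ ≤ ‖φ x‖) ∧ ∀ x, Tendsto (fun n => ψ n x) atTop (𝓝 (φ x)) := by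
  have h : ∀ n : ℕ, ∃ ψ ∈ c1Fields G F U, tsupport ψ ⊆ tsupport φ ∧
      ∀ x, ‖ψ x - φ x‖ ≤ 1 / ((n : ℝ) + 1) ∧ ‖ψ x‖ ≤ ‖φ x‖ := fun n =>
    exists_c1Fields_approx hφ (by positivity)
  choose ψ h1 h2 h3 using h
  refine ⟨ψ, fun n => ⟨h1 n, h2 n, fun x => (h3 n x).2⟩, fun x => ?_⟩
  rw [tendsto_iff_norm_sub_tendsto_zero]
  exact squeeze_zero (fun _ => norm_nonneg _) (fun n => (h3 n x).1)
    tendsto_one_div_add_atTop_nhds_zero_nat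

variable [FiniteDimensional ℝ G] [MeasurableSpace G] [BorelSpace G]

theorem integrableOn_of_mem_contFields {U : Set G} {ν : Measure G}
    (hν : ∀ K, IsCompact K → K ⊆ U → ν K < ∞) {φ : G → F} (hφ : φ ∈ contFields G F U) :
    Integrable φ ν := by
  have : IntegrableOn φ (tsupport φ) ν :=
    hφ.1.continuousOn.integrableOn_of_subset_isCompact hφ.2.1 (isClosed_tsupport φ).measurableSet
      Subset.rfl (hν _ hφ.2.1 hφ.2.2).ne
  exact (integrableOn_iff_integrable_of_support_subset (subset_tsupport φ)).1 this

/-- The measure is finite only on compact subsets of `U`, so `g` is first cut off to a compact `K`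
carrying almost all of its `L¹` mass. A relatively compact open `W` around `K` has finite measure,
so the usual density theorem applies there, and a continuous cutoff brings the support into `closure
W ⊆ U`. -/
theorem exists_contFields_dist_integral_lt {U : Set G} (hU : IsOpen U) {ν : Measure G}
    (hν : ∀ K, IsCompact K → K ⊆ U → ν K < ∞) {g : G → F} (hg : IntegrableOn g U ν) {ε : ℝ}
    (hε : 0 < ε) : ∃ φ ∈ contFields G F U, ∫ x in U, ‖φ x - g x‖ ∂ν < ε := by
  have : ProperSpace G := FiniteDimensional.proper ℝ G
  -- Inner regularity of the finite measure `|g| ν` produces the compact set `K`.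
  set m : Measure G := (ν.restrict U).withDensity fun x => ‖g x‖ₑ with hm
  have hmfin : IsFiniteMeasure m := isFiniteMeasure_withDensity hg.2.ne
  obtain ⟨K, hKU, hK, hKm⟩ := hU.measurableSet.exists_isCompact_sdiff_lt (μ := m)
    (measure_ne_top _ _) (ε := ENNReal.ofReal (ε / 3)) (by simpa using by positivity)
  obtain ⟨W, hW, hKW, hWU, hWc⟩ := exists_open_between_and_isCompact_closure hK hU hKU
  have hfin : IsFiniteMeasure (ν.restrict W) :=
    ⟨by simpa using (measure_mono subset_closure).trans_lt (hν _ hWc hWU)⟩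
  have hWU' : W ⊆ U := subset_closure.trans hWU
  have hgW : IntegrableOn g W ν := hg.mono_set hWU'
  obtain ⟨ψ, hψ1, hψ2, hψ3, hψ4⟩ := (hgW.indicator hK.measurableSet).exists_hasCompactSupport_integral_sub_le
    (ε := ε / 3) (by positivity)
  obtain ⟨c, hc1, hc0, hcs, hc⟩ := exists_continuous_one_zero_of_isCompact hK hW.isClosed_compl
    (disjoint_compl_right_iff_subset.2 hKW)
  have hcW : Function.support (fun x => c x • ψ x) ⊆ W := by
    intro x hx
    by_contra h
    exact hx (by simp [hc0 h])
  refine ⟨fun x => c x • ψ x, ⟨c.continuous.smul hψ3, hψ1.smul_left (f := c),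
    (closure_mono hcW).trans hWU⟩, ?_⟩
  set gK : G → F := K.indicator g with hgK
  have hI1 : IntegrableOn (fun x => c x • ψ x - gK x) U ν := by
    refine Integrable.sub ?_ (hg.indicator hK.measurableSet)
    refine (integrableOn_iff_integrable_of_support_subset (μ := ν.restrict U) hcW).1 ?_
    rw [IntegrableOn, Measure.restrict_restrict hW.measurableSet, inter_eq_self_of_subset_left hWU']
    exact hψ4.bdd_smul 1 c.continuous.aestronglyMeasurable (.of_forall fun x => by
      rw [Real.norm_of_nonneg (hc x).1]; exact (hc x).2)
  have hI2 : IntegrableOn (fun x => gK x - g x) U ν := (hg.indicator hK.measurableSet).sub hg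
  have hA : ∫ x in U, ‖c x • ψ x - gK x‖ ∂ν ≤ ε / 3 := by
    have h1 : ∫ x in U, ‖c x • ψ x - gK x‖ ∂ν = ∫ x in W, ‖c x • ψ x - gK x‖ ∂ν := by
      refine setIntegral_eq_of_subset_of_forall_sdiff_eq_zero hU.measurableSet hWU' fun x hx => ?_
      have h2 : x ∉ K := fun h => hx.2 (hKW h)
      have h3 : c x = 0 := hc0 hx.2
      simp [hgK, h2, h3]
    rw [h1]
    refine le_trans (integral_mono (hI1.mono_set hWU').norm
      (((hgW.indicator hK.measurableSet).sub hψ4).norm) fun x => ?_) hψ2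
    -- The cutoff equals `1` on `K` and `gK` vanishes off `K`, so `c gK = gK`, and multiplication by
    -- `c ≤ 1` cannot increase the error.
    have : c x • ψ x - gK x = c x • (ψ x - gK x) := by
      by_cases h : x ∈ K
      · simp [hc1 h]
      · simp [hgK, h]
    rw [this, norm_smul, Real.norm_of_nonneg (hc x).1, Pi.sub_apply, norm_sub_rev (K.indicator g x)]
    exact mul_le_of_le_one_left (norm_nonneg _) (hc x).2
  have hB : ∫ x in U, ‖gK x - g x‖ ∂ν ≤ ε / 3 := by
    have h1 : ∀ x, ‖gK x - g x‖ = Kᶜ.indicator (fun x => ‖g x‖) x := by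
      intro x
      by_cases h : x ∈ K <;> simp [hgK, h]
    simp only [h1]
    rw [integral_indicator hK.measurableSet.compl, Measure.restrict_restrict hK.measurableSet.compl,
      inter_comm, ← sdiff_eq]
    rw [integral_norm_eq_lintegral_enorm (hg.1.mono_measure
      (Measure.restrict_mono_set _ sdiff_subset))]
    refine ENNReal.toReal_le_of_le_ofReal (by positivity) (le_trans ?_ hKm.le)
    rw [hm, withDensity_apply _ (hU.measurableSet.diff hK.measurableSet),
      Measure.restrict_restrict (hU.measurableSet.diff hK.measurableSet),
      inter_eq_self_of_subset_left sdiff_subset]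
  calc ∫ x in U, ‖c x • ψ x - g x‖ ∂ν
      ≤ ∫ x in U, (‖c x • ψ x - gK x‖ + ‖gK x - g x‖) ∂ν := by
        have hI3 : IntegrableOn (fun x => c x • ψ x - g x) U ν := by
          refine (hI1.add hI2).congr (.of_forall fun x => ?_)
          simp
        refine integral_mono hI3.norm (hI1.norm.add hI2.norm) fun x => ?_
        have h1 := norm_add_le (c x • ψ x - gK x) (gK x - g x)
        simpa using h1
    _ = _ := integral_add hI1.norm hI2.norm
    _ ≤ ε / 3 + ε / 3 := add_le_add hA hB
    _ < ε := by linarith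

theorem exists_c1Fields_dist_integral_lt_of_contFields {U : Set G} {ν : Measure G}
    (hν : ∀ K, IsCompact K → K ⊆ U → ν K < ∞) {g : G → F} (hg : IntegrableOn g U ν) {ε : ℝ}
    {φ : G → F} (hφ : φ ∈ contFields G F U) (hφg : ∫ x in U, ‖φ x - g x‖ ∂ν < ε) :
    ∃ ψ ∈ c1Fields G F U, ∫ x in U, ‖ψ x - g x‖ ∂ν < ε ∧ ∀ x, ‖ψ x‖ ≤ ‖φ x‖ := by
  obtain ⟨ψ, hψ1, hψ2⟩ := exists_c1Fields_seq hφ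
  have hlim : Tendsto (fun n => ∫ x in U, ‖ψ n x - g x‖ ∂ν) atTop
      (𝓝 (∫ x in U, ‖φ x - g x‖ ∂ν)) := by
    refine tendsto_integral_of_dominated_convergence (fun x => ‖φ x‖ + ‖g x‖) (fun n => ?_) ?_
      (fun n => .of_forall fun x => ?_) (.of_forall fun x => ((hψ2 x).sub_const _).norm)
    · exact ((hψ1 n).1.1.continuous.aestronglyMeasurable.sub hg.1).norm
    · exact (integrableOn_of_mem_contFields hν hφ).norm.integrableOn.add hg.norm
    · rw [norm_norm]
      exact (norm_sub_le _ _).trans (by gcongr; exact (hψ1 n).2.2 x)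
  obtain ⟨n, hn⟩ := (hlim.eventually_lt_const hφg).exists
  exact ⟨ψ n, (hψ1 n).1, hn, (hψ1 n).2.2⟩

/-- The `C^1` fields with compact support in `U` are dense in `L^1(U; ν)`. -/
theorem exists_c1Fields_dist_integral_lt {U : Set G} (hU : IsOpen U) {ν : Measure G}
    (hν : ∀ K, IsCompact K → K ⊆ U → ν K < ∞) {g : G → F} (hg : IntegrableOn g U ν) {ε : ℝ}
    (hε : 0 < ε) : ∃ φ ∈ c1Fields G F U, ∫ x in U, ‖φ x - g x‖ ∂ν < ε := by
  obtain ⟨φ, hφ, h⟩ := exists_contFields_dist_integral_lt hU hν hg hε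
  obtain ⟨ψ, h1, h2, -⟩ := exists_c1Fields_dist_integral_lt_of_contFields hν hg hφ h
  exact ⟨ψ, h1, h2⟩

theorem exists_c1Fields_norm_le_one_dist_integral_lt {U : Set G} (hU : IsOpen U) {ν : Measure G}
    (hν : ∀ K, IsCompact K → K ⊆ U → ν K < ∞) {g : G → F} (hg : IntegrableOn g U ν)
    (hg1 : ∀ᵐ x ∂ν.restrict U, ‖g x‖ ≤ 1) {ε : ℝ} (hε : 0 < ε) :
    ∃ φ ∈ c1Fields G F U, ∫ x in U, ‖φ x - g x‖ ∂ν < ε ∧ ∀ x, ‖φ x‖ ≤ 1 := by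
  obtain ⟨φ, hφ, h⟩ := exists_contFields_dist_integral_lt hU hν hg (half_pos hε)
  have hmax : ∀ x, 0 < max 1 ‖φ x‖ := fun x => lt_max_of_lt_left one_pos
  -- Radial retraction onto the unit ball. Where `|φ| > 1` it moves `φ` by `|φ| - 1 ≤ |φ - g|`,
  -- because `|g| ≤ 1`; the error at most doubles, which is why the initial tolerance is `ε / 2`.
  have hφ' := smul_mem_contFields (c := fun x => (max 1 ‖φ x‖)⁻¹)
    ((continuous_const.max hφ.1.norm).inv₀ fun x => (hmax x).ne') hφ
  have hI := integrableOn_of_mem_contFields hν hφ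
  have hI' := integrableOn_of_mem_contFields hν hφ'
  have hle : ∫ x in U, ‖(max 1 ‖φ x‖)⁻¹ • φ x - g x‖ ∂ν < ε := by
    calc _ ≤ ∫ x in U, 2 * ‖φ x - g x‖ ∂ν := by
          refine integral_mono_ae (hI'.integrableOn.sub hg).norm
            ((hI.integrableOn.sub hg).norm.const_mul 2) ?_
          filter_upwards [hg1] with x hx
          by_cases hx1 : ‖φ x‖ ≤ 1
          · simp only [max_eq_left hx1, inv_one, one_smul]
            linarith [norm_nonneg (φ x - g x)]
          · have hx2 : 1 < ‖φ x‖ := not_le.1 hx1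
            simp only [max_eq_right hx2.le]
            have h1 : ‖‖φ x‖⁻¹ • φ x - φ x‖ = ‖φ x‖ - 1 := by
              have h2 : ‖φ x‖⁻¹ • φ x - φ x = -((1 - ‖φ x‖⁻¹) • φ x) := by
                rw [sub_smul, one_smul]; abel
              rw [h2, norm_neg, norm_smul, Real.norm_of_nonneg
                (sub_nonneg.2 (inv_le_one_of_one_le₀ hx2.le))]
              field_simp
            have h3 := norm_sub_le_norm_sub_add_norm_sub (‖φ x‖⁻¹ • φ x) (φ x) (g x)
            have h4 := norm_sub_norm_le (φ x) (g x)
            linarith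
      _ = 2 * ∫ x in U, ‖φ x - g x‖ ∂ν := integral_const_mul _ _
      _ < ε := by linarith
  obtain ⟨ψ, h1, h2, h3⟩ := exists_c1Fields_dist_integral_lt_of_contFields hν hg hφ' hle
  refine ⟨ψ, h1, h2, fun x => (h3 x).trans ?_⟩
  rw [norm_smul, Real.norm_of_nonneg (inv_nonneg.2 (hmax x).le), inv_mul_le_iff₀ (hmax x), mul_one]
  exact le_max_right _ _

end CompactlySupportedFields

section

open scoped NNReal CompactlySupported

/-! ### Variation of a functional on vector fields -/

section VectorRiesz

variable {G F : Type*} [NormedAddCommGroup G] [NormedSpace ℝ G] [NormedAddCommGroup F]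
  [NormedSpace ℝ F]

/-- The functional `L` on `C^1` fields is locally bounded for the uniform norm in `Ω`. -/
def IsLocallyBounded (L : (G → F) →ₗ[ℝ] ℝ) (Ω : Set G) : Prop :=
  ∀ K, IsCompact K → K ⊆ Ω → ∃ C, ∀ φ ∈ c1Fields G F Ω, tsupport φ ⊆ K → (∀ x, ‖φ x‖ ≤ 1) →
    L φ ≤ C

/-- The variation `sup {L ψ : |ψ| ≤ g}` of a functional `L` on `C^1` fields. -/
def variationOf (L : (G → F) →ₗ[ℝ] ℝ) (Ω : Set G) (g : G → ℝ) : ℝ :=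
  sSup (L '' {ψ | ψ ∈ c1Fields G F Ω ∧ ∀ x, ‖ψ x‖ ≤ g x})

variable {L : (G → F) →ₗ[ℝ] ℝ} {Ω : Set G}

theorem tsupport_subset_of_norm_le {ψ : G → F} {g : G → ℝ} (h : ∀ x, ‖ψ x‖ ≤ g x) :
    tsupport ψ ⊆ tsupport g := by
  refine closure_mono fun x hx => ?_
  simp only [Function.mem_support] at hx ⊢
  exact ((norm_pos_iff.2 hx).trans_le (h x)).ne'

theorem IsLocallyBounded.exists_le (hL : IsLocallyBounded L Ω) {K : Set G} (hK : IsCompact K)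
    (hKΩ : K ⊆ Ω) : ∃ C, 0 ≤ C ∧ ∀ φ ∈ c1Fields G F Ω, tsupport φ ⊆ K → ∀ M, 0 ≤ M →
      (∀ x, ‖φ x‖ ≤ M) → L φ ≤ C * M := by
  obtain ⟨C, hC⟩ := hL K hK hKΩ
  refine ⟨max C 0, le_max_right _ _, fun φ hφ hφK M hM hφM => ?_⟩
  rcases hM.eq_or_lt with rfl | hM
  · have : φ = 0 := funext fun x => norm_le_zero_iff.1 (hφM x)
    simp [this]
  · have h := hC (M⁻¹ • φ) (Submodule.smul_mem _ _ hφ)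
      ((tsupport_smul_subset_right (fun _ => M⁻¹) φ).trans hφK) fun x => by
        rw [Pi.smul_apply, norm_smul, Real.norm_of_nonneg (inv_nonneg.2 hM.le),
          inv_mul_le_iff₀ hM, mul_one]
        exact hφM x
    rw [map_smul, smul_eq_mul, inv_mul_le_iff₀ hM, mul_comm] at h
    exact h.trans (mul_le_mul_of_nonneg_right (le_max_left _ _) hM.le)

theorem bddAbove_variationOf (hL : IsLocallyBounded L Ω) {g : G → ℝ}
    (hg : g ∈ contFields G ℝ Ω) :
    BddAbove (L '' {ψ | ψ ∈ c1Fields G F Ω ∧ ∀ x, ‖ψ x‖ ≤ g x}) := by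
  obtain ⟨C, -, hC⟩ := hL.exists_le hg.2.1 hg.2.2
  obtain ⟨M, hM, hgM⟩ := exists_norm_le_of_mem_contFields hg
  refine ⟨C * M, ?_⟩
  rintro _ ⟨ψ, ⟨hψ, hψg⟩, rfl⟩
  exact hC ψ hψ (tsupport_subset_of_norm_le hψg) M hM fun x =>
    (hψg x).trans ((le_abs_self _).trans (hgM x))

theorem le_variationOf (hL : IsLocallyBounded L Ω) {g : G → ℝ} (hg : g ∈ contFields G ℝ Ω)
    {ψ : G → F} (hψ : ψ ∈ c1Fields G F Ω) (hψg : ∀ x, ‖ψ x‖ ≤ g x) :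
    L ψ ≤ variationOf L Ω g :=
  le_csSup (bddAbove_variationOf hL hg) ⟨ψ, ⟨hψ, hψg⟩, rfl⟩

theorem variationOf_le {g : G → ℝ} (hg0 : ∀ x, 0 ≤ g x) {C : ℝ}
    (h : ∀ ψ ∈ c1Fields G F Ω, (∀ x, ‖ψ x‖ ≤ g x) → L ψ ≤ C) : variationOf L Ω g ≤ C := by
  refine csSup_le ⟨_, 0, ⟨Submodule.zero_mem _, by simpa using hg0⟩, rfl⟩ ?_
  rintro _ ⟨ψ, ⟨hψ, hψg⟩, rfl⟩
  exact h ψ hψ hψg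

theorem variationOf_nonneg (hL : IsLocallyBounded L Ω) {g : G → ℝ} (hg : g ∈ contFields G ℝ Ω)
    (hg0 : ∀ x, 0 ≤ g x) : 0 ≤ variationOf L Ω g := by
  have := le_variationOf hL hg (Submodule.zero_mem _) (by simpa using hg0)
  simpa using this

theorem variationOf_smul_le (hL : IsLocallyBounded L Ω) {g : G → ℝ} (hg : g ∈ contFields G ℝ Ω)
    (hg0 : ∀ x, 0 ≤ g x) {c : ℝ} (hc : 0 ≤ c) :
    variationOf L Ω (c • g) ≤ c * variationOf L Ω g := by
  refine variationOf_le (fun x => mul_nonneg hc (hg0 x)) fun ψ hψ hψg => ?_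
  rcases hc.eq_or_lt with rfl | hc
  · have : ψ = 0 := funext fun x => norm_le_zero_iff.1 (by simpa using hψg x)
    simp [this]
  · have h := le_variationOf hL hg (Submodule.smul_mem _ c⁻¹ hψ) fun x => by
      rw [Pi.smul_apply, norm_smul, Real.norm_of_nonneg (inv_nonneg.2 hc.le), inv_mul_le_iff₀ hc]
      exact hψg x
    rwa [map_smul, smul_eq_mul, inv_mul_le_iff₀ hc] at h

theorem variationOf_smul (hL : IsLocallyBounded L Ω) {g : G → ℝ} (hg : g ∈ contFields G ℝ Ω)
    (hg0 : ∀ x, 0 ≤ g x) {c : ℝ} (hc : 0 ≤ c) :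
    variationOf L Ω (c • g) = c * variationOf L Ω g := by
  refine le_antisymm (variationOf_smul_le hL hg hg0 hc) ?_
  rcases hc.eq_or_lt with rfl | hc
  · rw [zero_mul]
    exact variationOf_nonneg hL (Submodule.smul_mem _ _ hg) fun x => by simp
  · have h := variationOf_smul_le hL (Submodule.smul_mem _ c hg)
      (fun x => mul_nonneg hc.le (hg0 x)) (inv_nonneg.2 hc.le)
    rwa [inv_smul_smul₀ hc.ne', le_inv_mul_iff₀ hc] at h

/-- The quotient may be discontinuous where `g + h = 0`, but there the bound forces `φ = 0`; the
quotient lies in `[0, 1]`, so the product is squeezed to `0`. -/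
theorem continuous_div_smul {φ : G → F} {g h : G → ℝ} (hφ : Continuous φ) (hg : Continuous g)
    (hh : Continuous h) (hg0 : ∀ x, 0 ≤ g x) (hh0 : ∀ x, 0 ≤ h x)
    (hφg : ∀ x, ‖φ x‖ ≤ g x + h x) : Continuous fun x => (g x / (g x + h x)) • φ x := by
  rw [continuous_iff_continuousAt]
  intro x
  by_cases hx : g x + h x = 0
  · have hφx : φ x = 0 := norm_le_zero_iff.1 ((hφg x).trans hx.le)
    have : Tendsto (fun y => (g y / (g y + h y)) • φ y) (𝓝 x) (𝓝 0) := by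
      refine squeeze_zero_norm (a := fun y => ‖φ y‖) (fun y => ?_) ?_
      · rw [norm_smul, Real.norm_of_nonneg (div_nonneg (hg0 y) (add_nonneg (hg0 y) (hh0 y)))]
        exact mul_le_of_le_one_left (norm_nonneg _)
          (div_le_one_of_le₀ (le_add_of_nonneg_right (hh0 y)) (add_nonneg (hg0 y) (hh0 y)))
      · simpa [hφx] using hφ.norm.tendsto x
    rw [ContinuousAt, hφx, smul_zero]
    exact this
  · exact (hg.continuousAt.div (hg.add hh).continuousAt hx).smul hφ.continuousAt

variable [FiniteDimensional ℝ G]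

/-- Superadditivity is immediate by adding competitors. For subadditivity, a competitor `φ` is split
in the ratio `g : h`. The pieces are only continuous, so each is replaced by a `C^1` field of no
larger norm, and local boundedness of `L` makes the leftover negligible. -/
theorem variationOf_add (hL : IsLocallyBounded L Ω) {g h : G → ℝ} (hg : g ∈ contFields G ℝ Ω)
    (hh : h ∈ contFields G ℝ Ω) (hg0 : ∀ x, 0 ≤ g x) (hh0 : ∀ x, 0 ≤ h x) :
    variationOf L Ω (g + h) = variationOf L Ω g + variationOf L Ω h := by
  have hgh := Submodule.add_mem _ hg hh
  have hgh0 : ∀ x, 0 ≤ (g + h) x := fun x => add_nonneg (hg0 x) (hh0 x)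
  refine le_antisymm (variationOf_le hgh0 fun φ hφ hφg => ?_) ?_
  · obtain ⟨C, hC0, hC⟩ := hL.exists_le (K := tsupport φ) hφ.2.1 hφ.2.2
    have key : ∀ {g h : G → ℝ}, g ∈ contFields G ℝ Ω → h ∈ contFields G ℝ Ω →
        (∀ x, 0 ≤ g x) → (∀ x, 0 ≤ h x) → (∀ x, ‖φ x‖ ≤ g x + h x) → ∀ η : ℝ, 0 < η →
        ∃ ψ ∈ c1Fields G F Ω, tsupport ψ ⊆ tsupport φ ∧
          (∀ x, ‖ψ x - (g x / (g x + h x)) • φ x‖ ≤ η) ∧ ∀ x, ‖ψ x‖ ≤ g x := by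
      intro g h hg hh hg0 hh0 hφg η hη
      have hts := tsupport_smul_subset_right (fun x => g x / (g x + h x)) φ
      obtain ⟨ψ, h1, h2, h3⟩ := exists_c1Fields_approx (U := Ω)
        (φ := fun x => (g x / (g x + h x)) • φ x)
        ⟨continuous_div_smul hφ.1.continuous hg.1 hh.1 hg0 hh0 hφg,
          hφ.2.1.smul_left (f := fun x => g x / (g x + h x)), hts.trans hφ.2.2⟩ hη
      refine ⟨ψ, h1, h2.trans hts, fun x => (h3 x).1, fun x => (h3 x).2.trans ?_⟩
      rw [norm_smul, Real.norm_of_nonneg (div_nonneg (hg0 x) (add_nonneg (hg0 x) (hh0 x)))]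
      calc g x / (g x + h x) * ‖φ x‖ ≤ g x / (g x + h x) * (g x + h x) :=
            mul_le_mul_of_nonneg_left (hφg x) (div_nonneg (hg0 x) (add_nonneg (hg0 x) (hh0 x)))
        _ ≤ g x := by
          rcases eq_or_ne (g x + h x) 0 with hx | hx
          · rw [hx, mul_zero]; exact hg0 x
          · rw [div_mul_cancel₀ _ hx]
    refine le_of_forall_pos_le_add fun δ hδ => ?_
    -- The leftover has sup norm at most `2η`, so its contribution is at most `2Cη ≤ δ`; `C + 1`
    -- avoids dividing by zero.
    have hη : 0 < δ / (2 * (C + 1)) := by positivity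
    obtain ⟨ψ₁, a1, a2, a3, a4⟩ := key hg hh hg0 hh0 hφg _ hη
    obtain ⟨ψ₂, b1, b2, b3, b4⟩ := key hh hg hh0 hg0
      (fun x => (hφg x).trans (add_comm _ _).le) _ hη
    have hrem : L (φ - ψ₁ - ψ₂) ≤ C * (2 * (δ / (2 * (C + 1)))) := by
      have hmem : φ - ψ₁ - ψ₂ ∈ c1Fields G F Ω :=
        Submodule.sub_mem _ (Submodule.sub_mem _ hφ a1) b1
      refine hC _ hmem ?_ _ (by positivity) fun x => ?_
      · have h1 : tsupport (φ - ψ₁) ⊆ tsupport φ :=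
          (tsupport_sub _ _).trans (union_subset Subset.rfl a2)
        exact (tsupport_sub _ _).trans (union_subset h1 b2)
      · have hsum : φ x = (g x / (g x + h x)) • φ x + (h x / (h x + g x)) • φ x := by
          by_cases hx : g x + h x = 0
          · have hφx : φ x = 0 := norm_le_zero_iff.1 ((hφg x).trans hx.le)
            simp [hφx]
          · rw [add_comm (h x), ← add_smul, ← add_div, div_self hx, one_smul]
        have e : (φ - ψ₁ - ψ₂) x = -(ψ₁ x - (g x / (g x + h x)) • φ x) -
            (ψ₂ x - (h x / (h x + g x)) • φ x) := by
          simp only [Pi.sub_apply]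
          nth_rw 1 [hsum]
          abel
        rw [e]
        refine (norm_sub_le _ _).trans ?_
        rw [norm_neg]
        linarith [a3 x, b3 x]
    have h1 := le_variationOf hL hg a1 a4
    have h2 := le_variationOf hL hh b1 b4
    have h3 : L φ = L ψ₁ + L ψ₂ + L (φ - ψ₁ - ψ₂) := by
      rw [← map_add, ← map_add]; congr 1; abel
    have h4 : C * (2 * (δ / (2 * (C + 1)))) ≤ δ := by
      have : C * (2 * (δ / (2 * (C + 1)))) = δ * (C / (C + 1)) := by field_simp
      rw [this]
      exact mul_le_of_le_one_right hδ.le (div_le_one_of_le₀ (by linarith) (by linarith))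
    linarith
  · rw [← le_sub_iff_add_le]
    refine variationOf_le hg0 fun ψ₁ a1 a2 => ?_
    rw [le_sub_comm]
    refine variationOf_le hh0 fun ψ₂ b1 b2 => ?_
    rw [le_sub_iff_add_le', ← map_add]
    exact le_variationOf hL hgh (Submodule.add_mem _ a1 b1) fun x =>
      (norm_add_le _ _).trans (add_le_add (a2 x) (b2 x))

/-! ### Transfer between `Ω` and the ambient space -/

section ExtendZero

variable {E : Type*} [NormedAddCommGroup E] [NormedSpace ℝ E]

/-- Extension by zero of a map on `Ω`. -/
abbrev extendZero (f : Ω → E) : G → E := Function.extend Subtype.val f 0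

theorem extendZero_apply (f : Ω → E) (x : Ω) : extendZero f (x : G) = f x :=
  Subtype.val_injective.extend_apply _ _ _

theorem extendZero_of_notMem (f : Ω → E) {x : G} (hx : x ∉ Ω) : extendZero f x = 0 :=
  Function.extend_apply' _ _ _ fun ⟨y, hy⟩ => hx (hy ▸ y.2)

theorem extendZero_add (f g : Ω → E) : extendZero (f + g) = extendZero f + extendZero g := by
  funext x
  by_cases hx : x ∈ Ω
  · lift x to Ω using hx
    simp only [Pi.add_apply, extendZero_apply]
  · simp only [Pi.add_apply, extendZero_of_notMem _ hx, add_zero]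

theorem extendZero_smul (c : ℝ) (f : Ω → E) : extendZero (c • f) = c • extendZero f := by
  funext x
  by_cases hx : x ∈ Ω
  · lift x to Ω using hx
    simp only [Pi.smul_apply, extendZero_apply]
  · simp only [Pi.smul_apply, extendZero_of_notMem _ hx, smul_zero]

theorem extendZero_nonneg {f : Ω → ℝ} (hf : ∀ x, 0 ≤ f x) (x : G) : 0 ≤ extendZero f x := by
  by_cases hx : x ∈ Ω
  · have := extendZero_apply f ⟨x, hx⟩
    simp only at this
    exact this ▸ hf _
  · rw [extendZero_of_notMem _ hx]

theorem extendZero_mem_contFields (hΩ : IsOpen Ω) {f : Ω → E} (hf : Continuous f)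
    (hfs : HasCompactSupport f) : extendZero f ∈ contFields G E Ω := by
  refine ⟨hfs.continuous_extend_zero hΩ hf, hfs.extend_zero continuous_subtype_val, ?_⟩
  rw [hfs.tsupport_extend_zero continuous_subtype_val Subtype.val_injective]
  exact Subtype.coe_image_subset _ _

/-- The restriction to `Ω` of a continuous function with compact support in `Ω`. -/
def restrictCompactlySupported {E : Type*} [NormedAddCommGroup E] [NormedSpace ℝ E] (g : G → E)
    (hg : g ∈ contFields G E Ω) : C_c(Ω, E) where
  toFun := fun x => g x
  continuous_toFun := hg.1.comp continuous_subtype_val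
  hasCompactSupport' := by
    refine HasCompactSupport.of_support_subset_isCompact
      (K := Subtype.val ⁻¹' tsupport g) ?_ fun x hx => subset_tsupport g hx
    exact Topology.IsInducing.subtypeVal.isCompact_preimage_iff (by simpa using hg.2.2) |>.2 hg.2.1

theorem extendZero_restrict {g : G → E} (hg : g ∈ contFields G E Ω) :
    extendZero (fun x : Ω => g x) = g := by
  funext x
  by_cases hx : x ∈ Ω
  · exact extendZero_apply (fun x : Ω => g x) ⟨x, hx⟩
  · rw [extendZero_of_notMem _ hx]
    exact (image_eq_zero_of_notMem_tsupport fun h => hx (hg.2.2 h)).symm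

end ExtendZero

end VectorRiesz

end

section

open scoped NNReal CompactlySupported

/-! ### Riesz measures on an open set and extension of functionals -/

section VectorRieszRepresentation

variable {G F : Type*} [NormedAddCommGroup G] [NormedSpace ℝ G] [NormedAddCommGroup F]
  [NormedSpace ℝ F] [FiniteDimensional ℝ G] [MeasurableSpace G] [BorelSpace G]
  {L : (G → F) →ₗ[ℝ] ℝ} {Ω : Set G}

/-- A measure on `G` that vanishes outside `Ω` and is finite on compact subsets of `Ω`. -/
structure IsRadonOn (ν : Measure G) (Ω : Set G) : Prop where
  measure_compl : ν Ωᶜ = 0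
  measure_compact : ∀ K, IsCompact K → K ⊆ Ω → ν K < ∞

theorem exists_compact_iUnion_eq (hΩ : IsOpen Ω) :
    ∃ K : ℕ → Set G, (∀ n, IsCompact (K n)) ∧ ⋃ n, K n = Ω := by
  have : LocallyCompactSpace Ω := hΩ.locallyCompactSpace
  exact isSigmaCompact_iff_sigmaCompactSpace.2 inferInstance

theorem IsRadonOn.sigmaFinite {ν : Measure G} (hν : IsRadonOn ν Ω) (hΩ : IsOpen Ω) :
    SigmaFinite ν := by
  obtain ⟨K, hK, hKΩ⟩ := exists_compact_iUnion_eq hΩ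
  refine ⟨⟨⟨fun n => K n ∪ Ωᶜ, fun _ => trivial, fun n => ?_, ?_⟩⟩⟩
  · exact (measure_union_le _ _).trans_lt (ENNReal.add_lt_top.2
      ⟨hν.measure_compact _ (hK n) (hKΩ ▸ subset_iUnion K n), by simp [hν.measure_compl]⟩)
  · rw [← iUnion_union, hKΩ, union_compl_self]

theorem IsRadonOn.restrict_eq {ν : Measure G} (hν : IsRadonOn ν Ω) : ν.restrict Ω = ν :=
  Measure.restrict_eq_self_of_ae_mem (by
    rw [ae_iff]; exact hν.measure_compl)

theorem isRadonOn_map (hΩ : IsOpen Ω) (ν : Measure Ω) [IsFiniteMeasureOnCompacts ν] :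
    IsRadonOn (ν.map Subtype.val) Ω := by
  have he := MeasurableEmbedding.subtype_coe hΩ.measurableSet
  refine ⟨?_, fun K hK hKΩ => ?_⟩
  · rw [he.map_apply]
    simp
  · rw [he.map_apply]
    exact (Topology.IsInducing.subtypeVal.isCompact_preimage_iff (by simpa using hKΩ) |>.2
      hK).measure_lt_top

/-- The Riesz measure of the variation of a locally bounded functional. -/
theorem exists_isRadonOn_variationOf (hΩ : IsOpen Ω) (hL : IsLocallyBounded L Ω) :
    ∃ ν : Measure G, IsRadonOn ν Ω ∧ ∀ g ∈ contFields G ℝ Ω, (∀ x, 0 ≤ g x) →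
      ∫ x, g x ∂ν = variationOf L Ω g := by
  have : LocallyCompactSpace Ω := hΩ.locallyCompactSpace
  have he := MeasurableEmbedding.subtype_coe hΩ.measurableSet
  -- The Riesz theorem is applied on the locally compact space `Ω`, since the variation may blow up
  -- at the boundary; the resulting measure is pushed forward to `G`.
  let e : C_c(Ω, ℝ≥0) → G → ℝ := fun f => extendZero fun x : Ω => (f x : ℝ)
  have hcs : ∀ f : C_c(Ω, ℝ≥0), HasCompactSupport fun x : Ω => (f x : ℝ) := fun f =>
    f.hasCompactSupport.comp_left (g := ((↑) : ℝ≥0 → ℝ)) rfl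
  have hemem : ∀ f, e f ∈ contFields G ℝ Ω := fun f =>
    extendZero_mem_contFields hΩ (NNReal.continuous_coe.comp f.continuous) (hcs f)
  have he0 : ∀ f x, 0 ≤ e f x := fun f => extendZero_nonneg fun x => (f x).2
  let Λ : C_c(Ω, ℝ≥0) →ₗ[ℝ≥0] ℝ≥0 :=
    { toFun := fun f => ⟨variationOf L Ω (e f), variationOf_nonneg hL (hemem f) (he0 f)⟩
      map_add' := fun f g => by
        apply NNReal.coe_injective
        have h : e (f + g) = e f + e g := by
          rw [← extendZero_add]
          rfl
        change variationOf L Ω (e (f + g)) = variationOf L Ω (e f) + variationOf L Ω (e g)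
        rw [h, variationOf_add hL (hemem f) (hemem g) (he0 f) (he0 g)]
      map_smul' := fun c f => by
        apply NNReal.coe_injective
        have h : e (c • f) = (c : ℝ) • e f := by
          rw [← extendZero_smul]
          rfl
        change variationOf L Ω (e (c • f)) = c * variationOf L Ω (e f)
        rw [h]
        exact variationOf_smul hL (hemem f) (he0 f) c.2 }
  refine ⟨(NNRealRMK.rieszMeasure Λ).map Subtype.val, isRadonOn_map hΩ _, fun g hg hg0 => ?_⟩
  rw [he.integral_map]
  let f : C_c(Ω, ℝ≥0) :=
    { toFun := fun x => ⟨g x, hg0 x⟩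
      continuous_toFun := (hg.1.comp continuous_subtype_val).subtype_mk _
      hasCompactSupport' := by
        refine (restrictCompactlySupported g hg).hasCompactSupport.mono fun x hx => ?_
        intro h
        exact hx (NNReal.coe_injective h) }
  have hf : e f = g := extendZero_restrict hg
  have := NNRealRMK.integral_rieszMeasure Λ f
  change ∫ x : Ω, g x ∂_ = variationOf L Ω (e f) at this
  rw [this, hf]

/-- A functional dominated by the integral of the norm extends to continuous fields. -/
theorem exists_extension_contFields {ν : Measure G} (hν : IsRadonOn ν Ω)
    (hLν : ∀ φ ∈ c1Fields G F Ω, L φ ≤ ∫ x, ‖φ x‖ ∂ν) :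
    ∃ L' : (G → F) →ₗ[ℝ] ℝ, (∀ φ ∈ c1Fields G F Ω, L' φ = L φ) ∧
      ∀ φ ∈ contFields G F Ω, |L' φ| ≤ ∫ x, ‖φ x‖ ∂ν := by
  let p : Seminorm ℝ (contFields G F Ω) := Seminorm.of (fun φ => ∫ x, ‖(φ : G → F) x‖ ∂ν)
    (fun φ ψ => by
      have h1 := (integrableOn_of_mem_contFields hν.measure_compact φ.2).norm
      have h2 := (integrableOn_of_mem_contFields hν.measure_compact ψ.2).norm
      rw [← integral_add h1 h2]
      exact integral_mono (integrableOn_of_mem_contFields hν.measure_compact (φ + ψ).2).norm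
        (h1.add h2) fun x => norm_add_le _ _)
    (fun c φ => by
      simp only [Submodule.coe_smul, Pi.smul_apply, norm_smul]
      exact integral_const_mul _ _)
  let T : Submodule ℝ (contFields G F Ω) := (c1Fields G F Ω).comap (contFields G F Ω).subtype
  -- Hahn–Banach for the seminorm `φ ↦ ∫ |φ| dν` on continuous fields.
  obtain ⟨g, hg1, hg2⟩ := Module.Dual.exists_extension_of_le_seminorm_real T
    ((L ∘ₗ (contFields G F Ω).subtype).domRestrict T) (p := p) fun φ => hLν _ φ.2
  -- This further extension is purely algebraic: it makes the functional defined on all maps, and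
  -- its values outside `contFields` carry no information.
  obtain ⟨L', hL'⟩ := LinearMap.exists_extend g
  have hL'' : ∀ φ : contFields G F Ω, L' φ = g φ := fun φ => LinearMap.congr_fun hL' φ
  refine ⟨L', fun φ hφ => ?_, fun φ hφ => ?_⟩
  · rw [hL'' ⟨φ, c1Fields_le_contFields Ω hφ⟩]
    exact hg1 ⟨⟨φ, c1Fields_le_contFields Ω hφ⟩, hφ⟩
  · rw [hL'' ⟨φ, hφ⟩]
    exact hg2 _

/-- Riesz representation of a positive functional on `contFields G ℝ Ω`. -/
theorem exists_isRadonOn_of_nonneg (hΩ : IsOpen Ω) (Λ : (G → ℝ) →ₗ[ℝ] ℝ)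
    (hΛ : ∀ f ∈ contFields G ℝ Ω, (∀ x, 0 ≤ f x) → 0 ≤ Λ f) :
    ∃ ν : Measure G, IsRadonOn ν Ω ∧ ∀ f ∈ contFields G ℝ Ω, ∫ x, f x ∂ν = Λ f := by
  have : LocallyCompactSpace Ω := hΩ.locallyCompactSpace
  have he := MeasurableEmbedding.subtype_coe hΩ.measurableSet
  let Λ' : C_c(Ω, ℝ) →ₗ[ℝ] ℝ :=
    { toFun := fun f => Λ (extendZero f)
      map_add' := fun f g => by
        rw [← map_add, ← extendZero_add]
        rfl
      map_smul' := fun c f => by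
        rw [RingHom.id_apply, ← map_smul, ← extendZero_smul]
        rfl }
  let Λp : C_c(Ω, ℝ) →ₚ[ℝ] ℝ := PositiveLinearMap.mk₀ Λ' fun f hf =>
    hΛ _ (extendZero_mem_contFields hΩ f.continuous f.hasCompactSupport)
      (extendZero_nonneg fun x => hf x)
  refine ⟨(RealRMK.rieszMeasure Λp).map Subtype.val, isRadonOn_map hΩ _, fun f hf => ?_⟩
  rw [he.integral_map]
  refine (RealRMK.integral_rieszMeasure Λp (restrictCompactlySupported f hf)).trans ?_
  change Λ (extendZero fun x : Ω => f x) = Λ f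
  rw [extendZero_restrict hf]

end VectorRieszRepresentation

end

/-! ### Polar representation of locally bounded functionals -/

section VectorRieszPolar

variable {G : Type*} [NormedAddCommGroup G] [NormedSpace ℝ G]
  [FiniteDimensional ℝ G] [MeasurableSpace G] [BorelSpace G]
  {ι : Type*} [Fintype ι] {L : (G → EuclideanSpace ℝ ι) →ₗ[ℝ] ℝ} {Ω : Set G}

theorem coord_mem_contFields {φ : G → EuclideanSpace ℝ ι}
    (hφ : φ ∈ contFields G (EuclideanSpace ℝ ι) Ω) (j : ι) :
    (fun x => φ x j) ∈ contFields G ℝ Ω := by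
  have hs : Function.support (fun x => φ x j) ⊆ Function.support φ := by
    intro x hx h
    exact hx (by simp [h])
  exact ⟨(EuclideanSpace.proj (𝕜 := ℝ) j).continuous.comp hφ.1, hφ.2.1.mono hs,
    (closure_mono hs).trans hφ.2.2⟩

theorem smul_single_mem_contFields [DecidableEq ι] {f : G → ℝ} (hf : f ∈ contFields G ℝ Ω)
    (v : EuclideanSpace ℝ ι) :
    (fun x => f x • v) ∈ contFields G (EuclideanSpace ℝ ι) Ω :=
  ⟨hf.1.smul continuous_const, hf.2.1.smul_right (f' := fun _ => v),
    (tsupport_smul_subset_left f fun _ => v).trans hf.2.2⟩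

/-- The variation measure `γ` dominates `L`, so each coordinate of the extended functional differs
from a positive functional by integration against `γ`. Scalar Riesz represents these, and
Radon–Nikodym with respect to a common dominating measure assembles them into one vector density. -/
theorem IsLocallyBounded.exists_density (hΩ : IsOpen Ω) (hL : IsLocallyBounded L Ω) :
    ∃ (Γ : Measure G) (τ : G → EuclideanSpace ℝ ι), IsRadonOn Γ Ω ∧ Measurable τ ∧
      (∀ K, IsCompact K → K ⊆ Ω → ∫⁻ x in K, ‖τ x‖ₑ ∂Γ < ∞) ∧
      ∀ φ ∈ c1Fields G (EuclideanSpace ℝ ι) Ω, L φ = ∫ x, inner ℝ (φ x) (τ x) ∂Γ := by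
  classical
  obtain ⟨γ, hγ, hγL⟩ := exists_isRadonOn_variationOf hΩ hL
  obtain ⟨L', hL'1, hL'2⟩ := exists_extension_contFields (L := L) hγ fun φ hφ => by
    have hn : (fun x => ‖φ x‖) ∈ contFields G ℝ Ω :=
      ⟨hφ.1.continuous.norm, hφ.2.1.norm, 
        (closure_mono (Function.support_comp_subset norm_zero φ)).trans hφ.2.2⟩
    rw [hγL _ hn fun x => norm_nonneg _]
    exact le_variationOf hL hn hφ fun x => le_rfl
  let e : ι → EuclideanSpace ℝ ι := fun j => EuclideanSpace.single j 1
  -- Adding `∫ f dγ` makes `f ↦ L' (f e_j)` positive, because `|L' (f e_j)| ≤ ∫ f dγ` for `f ≥ 0`.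
  have hν : ∀ j, ∃ ν : Measure G, IsRadonOn ν Ω ∧ ∀ f ∈ contFields G ℝ Ω,
      ∫ x, f x ∂ν = ∫ x, f x ∂γ + L' fun x => f x • e j := by
    intro j
    let E : (G → ℝ) →ₗ[ℝ] (G → EuclideanSpace ℝ ι) :=
      { toFun := fun f x => f x • e j
        map_add' := fun f g => funext fun x => add_smul _ _ _
        map_smul' := fun c f => funext fun x => mul_smul _ _ _ }
    let I₀ : contFields G ℝ Ω →ₗ[ℝ] ℝ :=
      { toFun := fun f => ∫ x, (f : G → ℝ) x ∂γ
        map_add' := fun f g => integral_add (integrableOn_of_mem_contFields hγ.measure_compact f.2)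
          (integrableOn_of_mem_contFields hγ.measure_compact g.2)
        map_smul' := fun c f => integral_const_mul _ _ }
    obtain ⟨I, hI⟩ := LinearMap.exists_extend I₀
    have hI' : ∀ f ∈ contFields G ℝ Ω, I f = ∫ x, f x ∂γ := fun f hf =>
      LinearMap.congr_fun hI ⟨f, hf⟩
    obtain ⟨ν, h1, h2⟩ := exists_isRadonOn_of_nonneg hΩ (I + L' ∘ₗ E) fun f hf hf0 => by
      have h3 := hL'2 _ (smul_single_mem_contFields hf (e j))
      have h4 : ∫ x, ‖f x • e j‖ ∂γ = ∫ x, f x ∂γ := by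
        refine integral_congr_ae (.of_forall fun x => ?_)
        simp [e, norm_smul, abs_of_nonneg (hf0 x)]
      rw [h4] at h3
      have h5 := (abs_le.1 h3).1
      simp only [LinearMap.add_apply, LinearMap.comp_apply, hI' f hf]
      change 0 ≤ _ + L' (fun x => f x • e j)
      linarith
    exact ⟨ν, h1, fun f hf => by rw [h2 f hf, LinearMap.add_apply, hI' f hf]; rfl⟩
  choose ν hν1 hν2 using hν
  set Γ : Measure G := γ + ∑ j, ν j with hΓdef
  have hΓ : IsRadonOn Γ Ω := by
    refine ⟨?_, fun K hK hKΩ => ?_⟩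
    · simp [hΓdef, hγ.measure_compl, (hν1 _).measure_compl]
    · simp only [hΓdef, Measure.add_apply, Measure.finsetSum_apply]
      exact ENNReal.add_lt_top.2 ⟨hγ.measure_compact K hK hKΩ,
        ENNReal.sum_lt_top.2 fun j _ => (hν1 j).measure_compact K hK hKΩ⟩
  have hγΓ : γ ≪ Γ := Measure.absolutelyContinuous_of_le (Measure.le_add_right le_rfl)
  have hνΓ : ∀ j, ν j ≪ Γ := fun j => .mk fun s _ hs => by
    simp only [hΓdef, Measure.add_apply, Measure.finsetSum_apply, add_eq_zero,
      Finset.sum_eq_zero_iff, Finset.mem_univ, true_implies] at hs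
    exact hs.2 j
  have := hΓ.sigmaFinite hΩ
  have := hγ.sigmaFinite hΩ
  have : ∀ j, SigmaFinite (ν j) := fun j => (hν1 j).sigmaFinite hΩ
  let τ : G → EuclideanSpace ℝ ι := fun x =>
    WithLp.toLp 2 fun j => ((ν j).rnDeriv Γ x).toReal - (γ.rnDeriv Γ x).toReal
  have hτm : Measurable τ := by
    refine (PiLp.continuous_toLp 2 _).measurable.comp (measurable_pi_lambda _ fun j => ?_)
    exact ((ν j).measurable_rnDeriv Γ).ennreal_toReal.sub (γ.measurable_rnDeriv Γ).ennreal_toReal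
  refine ⟨Γ, τ, hΓ, hτm, fun K hK hKΩ => ?_, fun φ hφ => ?_⟩
  · have hle : ∀ x, ‖τ x‖ₑ ≤ ∑ j, ((ν j).rnDeriv Γ x + γ.rnDeriv Γ x) := by
      intro x
      have h1 : ‖τ x‖ ≤ ∑ j, ‖τ x j‖ := by
        have h2 : τ x = ∑ j, τ x j • e j := by
          ext i
          simp [e, Finset.sum_apply, Pi.single_apply]
        conv_lhs => rw [h2]
        refine (norm_sum_le _ _).trans (Finset.sum_le_sum fun j _ => ?_)
        simp [e, norm_smul]
      calc ‖τ x‖ₑ = ENNReal.ofReal ‖τ x‖ := (ofReal_norm _).symm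
        _ ≤ ENNReal.ofReal (∑ j, ‖τ x j‖) := ENNReal.ofReal_le_ofReal h1
        _ = ∑ j, ENNReal.ofReal ‖τ x j‖ := ENNReal.ofReal_sum_of_nonneg fun _ _ => norm_nonneg _
        _ ≤ _ := Finset.sum_le_sum fun j _ => ?_
      refine (ENNReal.ofReal_le_ofReal (norm_sub_le _ _)).trans
        ((ENNReal.ofReal_add (norm_nonneg _) (norm_nonneg _)).le.trans ?_)
      rw [Real.norm_of_nonneg ENNReal.toReal_nonneg, Real.norm_of_nonneg ENNReal.toReal_nonneg]
      exact add_le_add ENNReal.ofReal_toReal_le ENNReal.ofReal_toReal_le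
    refine (lintegral_mono hle).trans_lt ?_
    rw [lintegral_finsetSum (f := fun j x => (ν j).rnDeriv Γ x + γ.rnDeriv Γ x) _ fun j _ =>
      ((ν j).measurable_rnDeriv Γ).add (γ.measurable_rnDeriv Γ)]
    refine ENNReal.sum_lt_top.2 fun j _ => ?_
    rw [lintegral_add_left ((ν j).measurable_rnDeriv Γ)]
    exact ENNReal.add_lt_top.2
      ⟨(Measure.setLIntegral_rnDeriv_le K).trans_lt ((hν1 j).measure_compact K hK hKΩ),
        (Measure.setLIntegral_rnDeriv_le K).trans_lt (hγ.measure_compact K hK hKΩ)⟩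
  · have hφc := c1Fields_le_contFields Ω hφ
    have hcoord := fun j => coord_mem_contFields hφc j
    have hsum : φ = ∑ j, fun x => φ x j • e j := by
      funext x
      ext i
      simp [e, Finset.sum_apply, Pi.single_apply]
    have hint : ∀ j, Integrable (fun x => ((ν j).rnDeriv Γ x).toReal • φ x j) Γ := fun j =>
      (integrable_rnDeriv_smul_iff (hνΓ j)).2
        (integrableOn_of_mem_contFields (hν1 j).measure_compact (hcoord j))
    have hint' : ∀ j, Integrable (fun x => (γ.rnDeriv Γ x).toReal • φ x j) Γ := fun j =>
      (integrable_rnDeriv_smul_iff hγΓ).2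
        (integrableOn_of_mem_contFields hγ.measure_compact (hcoord j))
    calc L φ = L' φ := (hL'1 φ hφ).symm
      _ = ∑ j, L' fun x => φ x j • e j := by rw [← map_sum, ← hsum]
      _ = ∑ j, (∫ x, φ x j ∂(ν j) - ∫ x, φ x j ∂γ) :=
        Finset.sum_congr rfl fun j _ => by rw [hν2 j _ (hcoord j)]; ring
      _ = ∑ j, ∫ x, (((ν j).rnDeriv Γ x).toReal • φ x j - (γ.rnDeriv Γ x).toReal • φ x j) ∂Γ :=
        Finset.sum_congr rfl fun j _ => by
          rw [integral_sub (hint j) (hint' j), integral_rnDeriv_smul (hνΓ j),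
            integral_rnDeriv_smul hγΓ]
      _ = ∫ x, inner ℝ (φ x) (τ x) ∂Γ := by
        rw [← integral_finsetSum (f := fun j x =>
          ((ν j).rnDeriv Γ x).toReal • φ x j - (γ.rnDeriv Γ x).toReal • φ x j) _
          fun j _ => (hint j).sub (hint' j)]
        refine integral_congr_ae (.of_forall fun x => ?_)
        simp only [PiLp.inner_apply, τ]
        refine Finset.sum_congr rfl fun j _ => ?_
        simp only [smul_eq_mul, RCLike.inner_apply, conj_trivial]
        ring

/-- Riesz representation of a locally bounded functional on `C^1` fields, in polar form. -/
theorem IsLocallyBounded.exists_polar (hΩ : IsOpen Ω) (hL : IsLocallyBounded L Ω) :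
    ∃ (γ : Measure G) (σ : G → EuclideanSpace ℝ ι), IsRadonOn γ Ω ∧ Measurable σ ∧
      (∀ᵐ x ∂γ, ‖σ x‖ = 1) ∧
      ∀ φ ∈ c1Fields G (EuclideanSpace ℝ ι) Ω, L φ = ∫ x, inner ℝ (φ x) (σ x) ∂γ := by
  obtain ⟨Γ, τ, hΓ, hτ, hτK, hLτ⟩ := hL.exists_density hΩ
  -- Moving `|τ|` into the measure leaves a unit vector. The zero set of `τ`, where the
  -- normalization fails, is null for the new measure.
  refine ⟨Γ.withDensity fun x => ‖τ x‖ₑ, fun x => ‖τ x‖⁻¹ • τ x, ⟨?_, fun K hK hKΩ => ?_⟩,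
    hτ.norm.inv.smul hτ, ?_, fun φ hφ => ?_⟩
  · exact withDensity_absolutelyContinuous Γ _ hΓ.measure_compl
  · rw [withDensity_apply _ hK.measurableSet]
    exact hτK K hK hKΩ
  · rw [ae_withDensity_iff hτ.enorm]
    refine .of_forall fun x hx => ?_
    have : ‖τ x‖ ≠ 0 := by simpa using hx
    rw [norm_smul, norm_inv, norm_norm, inv_mul_cancel₀ this]
  · rw [hLτ φ hφ, integral_withDensity_eq_integral_toReal_smul hτ.enorm
      (.of_forall fun x => enorm_lt_top)]
    refine integral_congr_ae (.of_forall fun x => ?_)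
    simp only [toReal_enorm, smul_eq_mul, inner_smul_right]
    by_cases hx : τ x = 0
    · simp [hx]
    · have : ‖τ x‖ ≠ 0 := norm_ne_zero_iff.2 hx
      field_simp

/-- The mass of a polar vector measure on open sets is its variation. -/
theorem measure_eq_iSup_of_polar {U : Set G} (hU : IsOpen U) {γ : Measure G}
    {σ : G → EuclideanSpace ℝ ι} (hγ : ∀ K, IsCompact K → K ⊆ U → γ K < ∞)
    (hσm : AEStronglyMeasurable σ γ) (hσ : ∀ᵐ x ∂γ, ‖σ x‖ = 1) :
    γ U = ⨆ φ ∈ {φ ∈ c1Fields G (EuclideanSpace ℝ ι) U | ∀ x, ‖φ x‖ ≤ 1},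
      ENNReal.ofReal (∫ x in U, inner ℝ (φ x) (σ x) ∂γ) := by
  have hbound : ∀ φ : G → EuclideanSpace ℝ ι, ∀ᵐ x ∂γ, ‖inner ℝ (φ x) (σ x)‖ ≤ ‖φ x‖ := by
    intro φ
    filter_upwards [hσ] with x hx
    exact (norm_inner_le_norm _ _).trans (by rw [hx, mul_one])
  apply le_antisymm
  · obtain ⟨κ, hκ, hκU⟩ := exists_compact_iUnion_eq hU
    rw [← hκU, measure_iUnion_eq_iSup_accumulate, hκU]
    refine iSup_le fun n => ?_
    have hK : IsCompact (accumulate κ n) := by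
      rw [accumulate_def]
      exact (Set.finite_Iic n).isCompact_biUnion fun i _ => hκ i
    have hKU : accumulate κ n ⊆ U := hκU ▸ accumulate_subset_iUnion n
    generalize accumulate κ n = K at hK hKU
    -- On a compact `K` the ideal competitor is `σ` restricted to `K`, which pairs with `σ` to give
    -- exactly `γ K`; a nearby `C^1` field of norm at most one loses at most `ε`.
    refine ENNReal.le_of_forall_pos_le_add fun ε hε _ => ?_
    have hKfin := hγ K hK hKU
    have hgint : IntegrableOn (K.indicator σ) U γ := by
      refine Integrable.integrableOn ?_
      rw [integrable_indicator_iff hK.measurableSet]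
      exact IntegrableOn.of_bound hKfin hσm.restrict 1
        (ae_restrict_of_ae (hσ.mono fun x hx => hx.le))
    have hg1 : ∀ᵐ x ∂γ.restrict U, ‖K.indicator σ x‖ ≤ 1 := by
      refine ae_restrict_of_ae (hσ.mono fun x hx => ?_)
      by_cases h : x ∈ K <;> simp [h, hx]
    obtain ⟨φ, hφ, hφg, hφ1⟩ := exists_c1Fields_norm_le_one_dist_integral_lt hU hγ hgint hg1
      (NNReal.coe_pos.2 hε)
    have hφint : IntegrableOn φ U γ :=
      (integrableOn_of_mem_contFields hγ (c1Fields_le_contFields _ hφ)).integrableOn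
    have hinner : ∀ {ψ : G → EuclideanSpace ℝ ι}, IntegrableOn ψ U γ →
        IntegrableOn (fun x => inner ℝ (ψ x) (σ x)) U γ := fun {ψ} hψ =>
      Integrable.mono hψ (hψ.1.inner hσm.restrict) (ae_restrict_of_ae (hbound ψ))
    have hKeq : ∫ x in U, inner ℝ (K.indicator σ x) (σ x) ∂γ = (γ K).toReal := by
      have : ∀ᵐ x ∂γ.restrict U, inner ℝ (K.indicator σ x) (σ x) = K.indicator (fun _ => (1 : ℝ)) x := by
        refine ae_restrict_of_ae (hσ.mono fun x hx => ?_)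
        by_cases h : x ∈ K
        · simp [h, hx]
        · simp [h]
      rw [integral_congr_ae this, integral_indicator hK.measurableSet,
        Measure.restrict_restrict hK.measurableSet, inter_eq_self_of_subset_left hKU]
      simp [Measure.real]
    have hlow : (γ K).toReal - ε ≤ ∫ x in U, inner ℝ (φ x) (σ x) ∂γ := by
      have h1 : ∫ x in U, inner ℝ (K.indicator σ x - φ x) (σ x) ∂γ ≤
          ∫ x in U, ‖φ x - K.indicator σ x‖ ∂γ := by
        refine integral_mono_ae (hinner (hgint.sub hφint)) (hφint.sub hgint).norm ?_
        filter_upwards [ae_restrict_of_ae (hbound fun x => K.indicator σ x - φ x)] with x hx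
        rw [norm_sub_rev]
        exact (le_abs_self _).trans hx
      simp only [inner_sub_left] at h1
      rw [integral_sub (hinner hgint) (hinner hφint), hKeq] at h1
      linarith
    calc γ K = ENNReal.ofReal (γ K).toReal := (ENNReal.ofReal_toReal hKfin.ne).symm
      _ ≤ ENNReal.ofReal ((∫ x in U, inner ℝ (φ x) (σ x) ∂γ) + ε) :=
        ENNReal.ofReal_le_ofReal (by linarith)
      _ ≤ ENNReal.ofReal (∫ x in U, inner ℝ (φ x) (σ x) ∂γ) + ε := by
        refine ENNReal.ofReal_add_le.trans ?_
        rw [ENNReal.ofReal_coe_nnreal]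
      _ ≤ _ := by
        gcongr
        exact le_iSup₂_of_le φ ⟨hφ, hφ1⟩ le_rfl
  · refine iSup₂_le fun φ hφ => ?_
    calc ENNReal.ofReal (∫ x in U, inner ℝ (φ x) (σ x) ∂γ)
        ≤ ‖∫ x in U, inner ℝ (φ x) (σ x) ∂γ‖ₑ := Real.ofReal_le_enorm _
      _ ≤ ∫⁻ x in U, ‖inner ℝ (φ x) (σ x)‖ₑ ∂γ := enorm_integral_le_lintegral_enorm _
      _ ≤ ∫⁻ _ in U, 1 ∂γ := by
        refine lintegral_mono_ae ?_
        filter_upwards [ae_restrict_of_ae (hbound φ)] with x hx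
        rw [← ofReal_norm, ← ENNReal.ofReal_one]
        exact ENNReal.ofReal_le_ofReal (hx.trans (hφ.2 x))
      _ = γ U := by simp

end VectorRieszPolar

/-! ### Horizontal derivatives and existence of the gradient measure -/

namespace StratifiedGroup

variable {G : Type*} [NormedAddCommGroup G] [InnerProductSpace ℝ G] [Group G]

section Frame

variable [FiniteDimensional ℝ G]

/-- The left invariant vector field `X_j`. -/
def frame (S : StratifiedGroup G) (j : S.HIndex) (x : G) : G :=
  fderiv ℝ (fun q : G × G => q.1 * q.2) (x, 0) (0, S.basis j.1)

theorem continuous_frame (S : StratifiedGroup G) (j : S.HIndex) : Continuous (S.frame j) :=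
  (((S.contDiff_mul (n := 1)).continuous_fderiv (by norm_num)).comp
    (continuous_id.prodMk continuous_const)).clm_apply continuous_const

theorem hasDerivAt_frame (S : StratifiedGroup G) (j : S.HIndex) (x : G) :
    HasDerivAt (fun t : ℝ => x * (t • S.basis j.1)) (S.frame j x) 0 := by
  have h1 : HasFDerivAt (fun q : G × G => q.1 * q.2)
      (fderiv ℝ (fun q : G × G => q.1 * q.2) (x, (0 : ℝ) • S.basis j.1))
      (x, (0 : ℝ) • S.basis j.1) :=
    ((S.contDiff_mul (n := 1)).differentiable (by norm_num) _).hasFDerivAt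
  have h2 : HasDerivAt (fun t : ℝ => (x, t • S.basis j.1)) ((0 : G), S.basis j.1) 0 := by
    have := (hasDerivAt_id (0 : ℝ)).smul_const (S.basis j.1)
    rw [one_smul] at this
    exact (hasDerivAt_const (0 : ℝ) x).prodMk this
  have h3 := h1.comp_hasDerivAt (0 : ℝ) h2
  rw [zero_smul] at h3
  exact h3

theorem X_eq_fderiv (S : StratifiedGroup G) (j : S.HIndex) {f : G → ℝ} {x : G}
    (hf : DifferentiableAt ℝ f x) : S.X j f x = fderiv ℝ f x (S.frame j x) := by
  have h1 : HasFDerivAt f (fderiv ℝ f x) (x * ((0 : ℝ) • S.basis j.1)) := by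
    rw [zero_smul, S.mul_zero']
    exact hf.hasFDerivAt
  exact (h1.comp_hasDerivAt (0 : ℝ) (S.hasDerivAt_frame j x)).deriv

theorem continuous_X (S : StratifiedGroup G) (j : S.HIndex) {f : G → ℝ} (hf : ContDiff ℝ 1 f) :
    Continuous (S.X j f) := by
  have : S.X j f = fun x => fderiv ℝ f x (S.frame j x) :=
    funext fun x => S.X_eq_fderiv j (hf.differentiable (by norm_num) x)
  rw [this]
  exact (hf.continuous_fderiv (by norm_num)).clm_apply (S.continuous_frame j)

theorem X_mul (S : StratifiedGroup G) (j : S.HIndex) {f g : G → ℝ} {x : G}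
    (hf : DifferentiableAt ℝ f x) (hg : DifferentiableAt ℝ g x) :
    S.X j (fun z => f z * g z) x = f x * S.X j g x + S.X j f x * g x := by
  rw [S.X_eq_fderiv (f := fun z => f z * g z) j (hf.mul hg), S.X_eq_fderiv j hf, S.X_eq_fderiv j hg, fderiv_fun_mul hf hg]
  simp only [add_apply, smul_apply, smul_eq_mul]
  ring

theorem X_of_notMem_tsupport (S : StratifiedGroup G) (j : S.HIndex) {f : G → ℝ} {x : G}
    (hx : x ∉ tsupport f) : S.X j f x = 0 := by
  have h : f =ᶠ[𝓝 x] fun _ => 0 := notMem_tsupport_iff_eventuallyEq.1 hx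
  rw [S.X_eq_fderiv j ((differentiableAt_const 0).congr_of_eventuallyEq h), h.fderiv_eq]
  simp

theorem contDiff_coord (S : StratifiedGroup G) {φ : G → S.HFiber} (hφ : ContDiff ℝ 1 φ)
    (j : S.HIndex) : ContDiff ℝ 1 fun z => φ z j :=
  (EuclideanSpace.proj (𝕜 := ℝ) j).contDiff.comp hφ

theorem hdiv_add (S : StratifiedGroup G) {φ ψ : G → S.HFiber} (hφ : ContDiff ℝ 1 φ)
    (hψ : ContDiff ℝ 1 ψ) (x : G) : S.hdiv (φ + ψ) x = S.hdiv φ x + S.hdiv ψ x := by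
  simp only [hdiv, ← Finset.sum_add_distrib]
  refine Finset.sum_congr rfl fun j _ => ?_
  have h1 := (S.contDiff_coord hφ j).differentiable (by norm_num) x
  have h2 := (S.contDiff_coord hψ j).differentiable (by norm_num) x
  rw [S.X_eq_fderiv j h1, S.X_eq_fderiv j h2, ← add_apply, ← fderiv_add h1 h2]
  exact S.X_eq_fderiv j (h1.add h2)

theorem hdiv_smul (S : StratifiedGroup G) (c : ℝ) (φ : G → S.HFiber) (x : G) :
    S.hdiv (c • φ) x = c * S.hdiv φ x := by
  simp only [hdiv, Finset.mul_sum]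
  refine Finset.sum_congr rfl fun j _ => ?_
  exact deriv_const_mul_field c

theorem hdiv_of_notMem_tsupport (S : StratifiedGroup G) {φ : G → S.HFiber} {x : G}
    (hx : x ∉ tsupport φ) : S.hdiv φ x = 0 := by
  refine Finset.sum_eq_zero fun j _ => S.X_of_notMem_tsupport j fun h => hx ?_
  exact closure_mono (Function.support_subset_iff'.2 fun z hz => by
    simp [Function.notMem_support.1 hz]) h

theorem continuous_hdiv (S : StratifiedGroup G) {φ : G → S.HFiber} (hφ : ContDiff ℝ 1 φ) :
    Continuous (S.hdiv φ) :=
  continuous_finsetSum _ fun j _ => S.continuous_X j (S.contDiff_coord hφ j)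

theorem hdiv_mem_contFields (S : StratifiedGroup G) {Ω : Set G} {φ : G → S.HFiber}
    (hφ : φ ∈ S.C1c Ω) : S.hdiv φ ∈ contFields G ℝ Ω := by
  have hs : Function.support (S.hdiv φ) ⊆ tsupport φ := fun x hx => by
    by_contra h
    exact hx (S.hdiv_of_notMem_tsupport h)
  have hs' : tsupport (S.hdiv φ) ⊆ tsupport φ := closure_minimal hs (isClosed_tsupport φ)
  exact ⟨S.continuous_hdiv hφ.1, hφ.2.1.of_isClosed_subset (isClosed_tsupport _) hs',
    hs'.trans hφ.2.2⟩

end Frame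

variable [FiniteDimensional ℝ G] [MeasurableSpace G] [BorelSpace G]

theorem setIntegral_mul_hdiv_eq (S : StratifiedGroup G) {Ω U : Set G} (hΩ : IsOpen Ω)
    (hUΩ : U ⊆ Ω) {φ : G → S.HFiber} (hφ : φ ∈ S.C1c U) (f : G → ℝ) :
    ∫ x in Ω, f x * S.hdiv φ x = ∫ x in U, f x * S.hdiv φ x := by
  refine setIntegral_eq_of_subset_of_forall_sdiff_eq_zero hΩ.measurableSet hUΩ fun x hx => ?_
  rw [S.hdiv_of_notMem_tsupport fun h => hx.2 (hφ.2.2 h), mul_zero]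

theorem IsBVLoc.integrableOn_mul {S : StratifiedGroup G} {Ω : Set G} (hΩ : IsOpen Ω) {f : G → ℝ}
    (hf : S.IsBVLoc Ω f) {g : G → ℝ} (hg : g ∈ contFields G ℝ Ω) :
    IntegrableOn (fun x => f x * g x) Ω := by
  have : ProperSpace G := FiniteDimensional.proper ℝ G
  obtain ⟨U, hU, hKU, hUΩ, hUc⟩ := exists_open_between_and_isCompact_closure hg.2.1 hΩ hg.2.2
  obtain ⟨C, -, hC⟩ := exists_norm_le_of_mem_contFields hg
  have h1 : IntegrableOn (fun x => f x * g x) U :=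
    (hf U hU hUc hUΩ).1.mul_bdd (c := C) hg.1.aestronglyMeasurable (.of_forall hC)
  have h2 : Integrable (fun x => f x * g x) :=
    (integrableOn_iff_integrable_of_support_subset fun x hx => hKU (subset_tsupport g fun h =>
      hx (by simp [h]))).1 h1
  exact h2.integrableOn

/-- The distributional horizontal gradient of a function of locally bounded h-variation is a
vector measure. -/
theorem IsBVLoc.exists_isHGradient {S : StratifiedGroup G} {Ω : Set G} (hΩ : IsOpen Ω)
    {f : G → ℝ} (hf : S.IsBVLoc Ω f) :
    ∃ (γ : Measure G) (σ : G → S.HFiber), S.IsHGradient Ω f γ σ := by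
  have : ProperSpace G := FiniteDimensional.proper ℝ G
  let L₀ : c1Fields G S.HFiber Ω →ₗ[ℝ] ℝ :=
    { toFun := fun φ => ∫ x in Ω, f x * S.hdiv (φ : G → S.HFiber) x
      map_add' := fun φ ψ => by
        rw [← integral_add (hf.integrableOn_mul hΩ (S.hdiv_mem_contFields φ.2))
          (hf.integrableOn_mul hΩ (S.hdiv_mem_contFields ψ.2))]
        refine integral_congr_ae (.of_forall fun x => ?_)
        simp only [Submodule.coe_add, S.hdiv_add φ.2.1 ψ.2.1]
        ring
      map_smul' := fun c φ => by
        rw [RingHom.id_apply, smul_eq_mul, ← integral_const_mul]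
        refine integral_congr_ae (.of_forall fun x => ?_)
        simp only [Submodule.coe_smul, S.hdiv_smul]
        ring }
  obtain ⟨L, hL⟩ := LinearMap.exists_extend L₀
  have hL' : ∀ φ ∈ c1Fields G S.HFiber Ω, L φ = ∫ x in Ω, f x * S.hdiv φ x := fun φ hφ =>
    LinearMap.congr_fun hL ⟨φ, hφ⟩
  have hLb : IsLocallyBounded L Ω := by
    intro K hK hKΩ
    -- Fields supported in `K` are competitors for the variation on a relatively compact
    -- neighbourhood `U`, which is finite by hypothesis.
    obtain ⟨U, hU, hKU, hUΩ, hUc⟩ := exists_open_between_and_isCompact_closure hK hΩ hKΩ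
    refine ⟨(S.hVariation U f).toReal, fun φ hφ hφK hφ1 => ?_⟩
    have hφU : φ ∈ S.C1c U := ⟨hφ.1, hφ.2.1, hφK.trans hKU⟩
    rw [hL' φ hφ, S.setIntegral_mul_hdiv_eq hΩ (subset_closure.trans hUΩ) hφU]
    refine (ENNReal.ofReal_le_iff_le_toReal (hf U hU hUc hUΩ).2.ne).1 ?_
    exact le_iSup₂_of_le φ ⟨hφU, hφ1⟩ le_rfl
  obtain ⟨γ, σ, hγ, hσm, hσ, hLσ⟩ := hLb.exists_polar hΩ
  -- The sign comes from the minus in the integration by parts formula; the mass on open sets is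
  -- computed with `σ` before the change of sign.
  refine ⟨γ, fun x => -σ x, hγ.measure_compl, hγ.measure_compact, fun U hU hUΩ => ?_,
    hσm.neg.aestronglyMeasurable, by simpa using hσ, fun φ hφ => ?_⟩
  · rw [measure_eq_iSup_of_polar hU (fun K hK hKU => hγ.measure_compact K hK (hKU.trans hUΩ))
      hσm.aestronglyMeasurable hσ, hVariation]
    refine iSup_congr fun φ => iSup_congr fun hφ => ?_
    have hφΩ := c1Fields_mono hUΩ hφ.1
    rw [← S.setIntegral_mul_hdiv_eq hΩ hUΩ hφ.1, ← hL' φ hφΩ, hLσ φ hφΩ]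
    congr 1
    exact setIntegral_eq_integral_of_forall_compl_eq_zero fun x hx => by
      rw [image_eq_zero_of_notMem_tsupport fun h => hx (hφ.1.2.2 h), inner_zero_left]
  · rw [← hL' φ hφ, hLσ φ hφ, hγ.restrict_eq]
    simp [integral_neg]

end StratifiedGroup

/-! ### Convolution on the group -/

namespace StratifiedGroup

variable {G : Type*} [NormedAddCommGroup G] [InnerProductSpace ℝ G] [Group G]
  [FiniteDimensional ℝ G] [MeasurableSpace G] [BorelSpace G]

/-- The points `y` with `x y⁻¹ ∈ T` for some `x ∈ K`. -/
def reach (T K : Set G) : Set G := {y | ∃ x ∈ K, x * y⁻¹ ∈ T}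

theorem isCompact_reach (S : StratifiedGroup G) {T K : Set G} (hT : IsCompact T)
    (hK : IsCompact K) : IsCompact (reach T K) := by
  have : reach T K = (fun p : G × G => p.1⁻¹ * p.2) '' (T ×ˢ K) := by
    ext y
    constructor
    · rintro ⟨x, hx, hxy⟩
      exact ⟨(x * y⁻¹, x), ⟨hxy, hx⟩, by simp⟩
    · rintro ⟨⟨z, x⟩, ⟨hz, hx⟩, rfl⟩
      exact ⟨x, hx, by simpa using hz⟩
  rw [this]
  exact (hT.prod hK).image
    (S.continuous_mul_comp (S.continuous_inv_comp continuous_fst) continuous_snd)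

theorem reach_mono {T T' K K' : Set G} (hT : T ⊆ T') (hK : K ⊆ K') : reach T K ⊆ reach T' K' :=
  fun _ ⟨x, hx, h⟩ => ⟨x, hK hx, hT h⟩

theorem continuous_div_comp (S : StratifiedGroup G) {H : Type*} [TopologicalSpace H]
    {f g : H → G} (hf : Continuous f) (hg : Continuous g) : Continuous fun h => f h * (g h)⁻¹ :=
  S.continuous_mul_comp hf (S.continuous_inv_comp hg)

theorem contDiff_inv_comp (S : StratifiedGroup G) {H : Type*} [NormedAddCommGroup H]
    [NormedSpace ℝ H] {n : WithTop ℕ∞} {f : H → G} (hf : ContDiff ℝ n f) :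
    ContDiff ℝ n fun h => (f h)⁻¹ := by
  simp only [S.inv_eq_neg]
  exact hf.neg

theorem kernel_mem_contFields (S : StratifiedGroup G) {k : G → ℝ} (hk : Continuous k)
    (hks : HasCompactSupport k) {Ω : Set G} {x : G} (hx : reach (tsupport k) {x} ⊆ Ω) :
    (fun y => k (x * y⁻¹)) ∈ contFields G ℝ Ω := by
  have hc := S.isCompact_reach hks (isCompact_singleton (x := x))
  have hs : tsupport (fun y => k (x * y⁻¹)) ⊆ reach (tsupport k) {x} :=
    closure_minimal (fun y hy => ⟨x, rfl, subset_tsupport k hy⟩) hc.isClosed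
  exact ⟨hk.comp (S.continuous_div_comp continuous_const continuous_id),
    hc.of_isClosed_subset (isClosed_tsupport _) hs, hs.trans hx⟩

theorem kernel_mem_c1Fields (S : StratifiedGroup G) {k : G → ℝ} (hk : ContDiff ℝ 1 k)
    (hks : HasCompactSupport k) {Ω : Set G} {x : G} (hx : reach (tsupport k) {x} ⊆ Ω) :
    (fun y => k (x * y⁻¹)) ∈ c1Fields G ℝ Ω :=
  ⟨hk.comp (S.contDiff_mul_comp contDiff_const (S.contDiff_inv_comp contDiff_id)),
    (S.kernel_mem_contFields hk.continuous hks hx).2⟩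

/-- The function `x ↦ ∫_Ω k(x y⁻¹) f(y) dy`. -/
def kernelIntegral (k : G → ℝ) (Ω : Set G) (f : G → ℝ) (x : G) : ℝ :=
  ∫ y in Ω, k (x * y⁻¹) * f y

/-- The field `x ↦ ∫_Ω k(x y⁻¹) σ(y) dγ(y)`. -/
def kernelMeasure (S : StratifiedGroup G) (k : G → ℝ) (Ω : Set G) (γ : Measure G)
    (σ : G → S.HFiber) (x : G) : S.HFiber :=
  ∫ y in Ω, k (x * y⁻¹) • σ y ∂γ

theorem integrable_kernel_mul (S : StratifiedGroup G) {k : G → ℝ} (hk : Continuous k)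
    (hks : HasCompactSupport k) {f : G → ℝ} (hf : AEStronglyMeasurable f)
    (hf1 : ∀ x, ‖f x‖ ≤ 1) (x : G) : Integrable fun y => k (x * y⁻¹) * f y :=
  (integrableOn_of_mem_contFields (fun _ hK _ => hK.measure_lt_top)
    (S.kernel_mem_contFields hk hks (subset_univ _))).mul_bdd hf (.of_forall hf1)

theorem integral_kernel_left (S : StratifiedGroup G) (k : G → ℝ) (y : G) :
    ∫ x, k (x * y⁻¹) = ∫ x, k x :=
  (S.measurePreserving_mul_right y⁻¹).integral_comp (S.measurableEmbedding_mul_right y⁻¹) k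

/-- Since `x y⁻¹ = (y x⁻¹)⁻¹`, invariance under right translation and inversion suffices; left
translations are not needed. -/
theorem integral_kernel_right (S : StratifiedGroup G) (k : G → ℝ) (x : G) :
    ∫ y, k (x * y⁻¹) = ∫ y, k y := by
  have h1 : ∫ y, k (x * y⁻¹) = ∫ y, k ((y * x⁻¹)⁻¹) := by simp
  have hi : MeasurableEmbedding fun x : G => x⁻¹ := by
    simp only [S.inv_eq_neg]
    exact (Homeomorph.neg G).measurableEmbedding
  rw [h1, S.integral_kernel_left (fun z => k z⁻¹) x, S.measurePreserving_inv.integral_comp hi k]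

theorem norm_kernelIntegral_le (S : StratifiedGroup G) {k : G → ℝ} (hk : Continuous k)
    (hks : HasCompactSupport k) (Ω : Set G) {f : G → ℝ} (hf1 : ∀ x, ‖f x‖ ≤ 1) (x : G) :
    ‖kernelIntegral k Ω f x‖ ≤ ∫ y, ‖k y‖ := by
  have hint : Integrable fun y => ‖k (x * y⁻¹)‖ :=
    (integrableOn_of_mem_contFields (fun _ hK _ => hK.measure_lt_top)
      (S.kernel_mem_contFields hk hks (subset_univ _))).norm
  calc ‖kernelIntegral k Ω f x‖ ≤ ∫ y in Ω, ‖k (x * y⁻¹)‖ :=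
        norm_integral_le_of_norm_le hint.integrableOn (.of_forall fun y => by
          rw [norm_mul]
          exact mul_le_of_le_one_right (norm_nonneg _) (hf1 y))
    _ ≤ ∫ y, ‖k (x * y⁻¹)‖ := setIntegral_le_integral hint (.of_forall fun _ => norm_nonneg _)
    _ = ∫ y, ‖k y‖ := S.integral_kernel_right (fun z => ‖k z‖) x

/-- Group convolution is not additive convolution, but it is an additive convolution with a
parameter: take the kernel `(p, z) ↦ k (p * z)` and evaluate at the point `0`, where `z = 0 - y =
y⁻¹`. Restricting `p` to a ball gives the uniform compact support required. -/
theorem contDiff_kernelIntegral (S : StratifiedGroup G) {n : ℕ∞} {k : G → ℝ}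
    (hk : ContDiff ℝ n k) (hks : HasCompactSupport k) {Ω : Set G} (hΩ : IsOpen Ω) {f : G → ℝ}
    (hf : AEStronglyMeasurable f) (hf1 : ∀ x, ‖f x‖ ≤ 1) :
    ContDiff ℝ n (kernelIntegral k Ω f) := by
  have : ProperSpace G := FiniteDimensional.proper ℝ G
  have hloc : LocallyIntegrable (Ω.indicator f) := by
    refine (locallyIntegrable_const (1 : ℝ)).mono (hf.indicator hΩ.measurableSet)
      (.of_forall fun x => ?_)
    rw [norm_one]
    exact (norm_indicator_le_norm_self f x).trans (hf1 x)
  rw [← contDiffOn_univ]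
  intro x₀ _
  refine ContDiffAt.contDiffWithinAt ?_
  have hcomp := S.isCompact_reach hks (isCompact_closedBall x₀ 1)
  have h := contDiffOn_convolution_right_with_param (n := n) (ContinuousLinearMap.mul ℝ ℝ)
    (μ := (volume : Measure G)) (f := Ω.indicator f)
    (g := fun p z : G => k (p * z)) (s := Metric.ball x₀ 1)
    (k := (fun z : G => -z) '' reach (tsupport k) (Metric.closedBall x₀ 1))
    Metric.isOpen_ball (hcomp.image continuous_neg)
    (fun p z hp hz => by
      by_contra hne
      refine hz ⟨-z, ⟨p, Metric.ball_subset_closedBall hp, ?_⟩, neg_neg z⟩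
      rw [S.inv_eq_neg, neg_neg]
      exact subset_tsupport k hne)
    hloc ((hk.comp (S.contDiff_mul_comp contDiff_fst contDiff_snd)).contDiffOn)
  have h2 : ContDiffOn ℝ n (kernelIntegral k Ω f) (Metric.ball x₀ 1) := by
    have h3 := h.comp (contDiffOn_id.prodMk contDiffOn_const)
      (fun x hx => (⟨hx, mem_univ (0 : G)⟩ : (x, (0 : G)) ∈ Metric.ball x₀ 1 ×ˢ univ))
    refine h3.congr fun x _ => ?_
    simp only [Function.comp_apply, id, convolution, ContinuousLinearMap.mul_apply', zero_sub]
    rw [kernelIntegral, ← integral_indicator hΩ.measurableSet]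
    refine integral_congr_ae (.of_forall fun y => ?_)
    by_cases hy : y ∈ Ω
    · simp [hy, S.inv_eq_neg, mul_comm (k _)]
    · simp [hy]
  exact h2.contDiffAt (Metric.ball_mem_nhds x₀ one_pos)

theorem continuous_kernelIntegral (S : StratifiedGroup G) {k : G → ℝ}
    (hk : Continuous k) (hks : HasCompactSupport k) {Ω : Set G} (hΩ : IsOpen Ω) {f : G → ℝ}
    (hf : AEStronglyMeasurable f) (hf1 : ∀ x, ‖f x‖ ≤ 1) :
    Continuous (kernelIntegral k Ω f) :=
  (S.contDiff_kernelIntegral (n := 0) (contDiff_zero.2 hk) hks hΩ hf hf1).continuous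

/-- Differentiate under the integral along `t ↦ x (t e_j)`. Because `x (t e_j) y⁻¹ = x (y (-t
e_j))⁻¹`, the derivative falls on `y` with the opposite sign and is again along the left invariant
field `X_j`. -/
theorem X_kernelIntegral (S : StratifiedGroup G) {k : G → ℝ} (hk : ContDiff ℝ 1 k)
    (hks : HasCompactSupport k) {Ω : Set G} {f : G → ℝ}
    (hf : AEStronglyMeasurable f) (hf1 : ∀ x, ‖f x‖ ≤ 1) (j : S.HIndex) (x : G) :
    S.X j (kernelIntegral k Ω f) x = - ∫ y in Ω, f y * S.X j (fun z => k (x * z⁻¹)) y := by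
  set e : G := S.basis j.1
  let Φ : ℝ × G → ℝ := fun p => k (x * (p.1 • e) * p.2⁻¹)
  have hΦ : ContDiff ℝ 1 Φ := hk.comp (S.contDiff_mul_comp
    (S.contDiff_mul_comp contDiff_const (contDiff_fst.smul contDiff_const))
    (S.contDiff_inv_comp contDiff_snd))
  let Φ' : ℝ → G → ℝ := fun t y => fderiv ℝ Φ (t, y) (1, 0)
  have hΦ'c : Continuous fun p : ℝ × G => Φ' p.1 p.2 :=
    (hΦ.continuous_fderiv (by norm_num)).clm_apply continuous_const
  have hderiv : ∀ t y, HasDerivAt (fun s => Φ (s, y)) (Φ' t y) t := fun t y =>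
    HasFDerivAt.comp_hasDerivAt (l := Φ) t
      (hΦ.differentiable (by norm_num) (t, y)).hasFDerivAt ((hasDerivAt_id t).prodMk (hasDerivAt_const t y))
  have hI : IsCompact (Icc (-1 : ℝ) 1) := isCompact_Icc
  -- For all `|t| ≤ 1` the integrand is supported in this one compact set, which supplies an
  -- integrable dominating function.
  set K := reach (tsupport k) ((fun t : ℝ => x * (t • e)) '' Icc (-1 : ℝ) 1) with hKdef
  have hK : IsCompact K := S.isCompact_reach hks (hI.image
    (S.continuous_mul_comp continuous_const (continuous_id.smul continuous_const)))
  have hzero : ∀ t ∈ Ioo (-1 : ℝ) 1, ∀ y ∉ K, Φ' t y = 0 := by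
    intro t ht y hy
    have : (fun s => Φ (s, y)) =ᶠ[𝓝 t] fun _ => 0 := by
      filter_upwards [isOpen_Ioo.mem_nhds ht] with s hs
      by_contra hne
      exact hy ⟨_, ⟨s, Ioo_subset_Icc_self hs, rfl⟩, subset_tsupport k hne⟩
    rw [← (hderiv t y).deriv, this.deriv_eq, deriv_const]
  obtain ⟨C, hC⟩ := ((hI.prod hK).bddAbove_image (f := fun p : ℝ × G => ‖Φ' p.1 p.2‖)
    hΦ'c.norm.continuousOn)
  have hmain := hasDerivAt_integral_of_dominated_loc_of_deriv_le (μ := volume.restrict Ω)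
    (F := fun t y => Φ (t, y) * f y) (F' := fun t y => Φ' t y * f y) (x₀ := (0 : ℝ))
    (s := Ioo (-1 : ℝ) 1) (bound := K.indicator fun _ => C) (Ioo_mem_nhds (by norm_num) (by norm_num))
    (.of_forall fun t =>
      (hΦ.continuous.comp (continuous_const.prodMk continuous_id)).aestronglyMeasurable.mul
        hf.restrict)
    (S.integrable_kernel_mul hk.continuous hks hf hf1 (x * ((0 : ℝ) • e))).integrableOn
    ((hΦ'c.comp (continuous_const.prodMk continuous_id)).aestronglyMeasurable.mul hf.restrict)
    (.of_forall fun y t ht => by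
      by_cases hy : y ∈ K
      · rw [indicator_of_mem hy, norm_mul]
        exact (mul_le_of_le_one_right (norm_nonneg _) (hf1 y)).trans
          (hC ⟨(t, y), ⟨Ioo_subset_Icc_self ht, hy⟩, rfl⟩)
      · rw [hzero t ht y hy, indicator_of_notMem hy]
        simp)
    (((integrable_indicator_iff hK.measurableSet).2
      (integrableOn_const hK.measure_lt_top.ne)).integrableOn)
    (.of_forall fun y t _ => (hderiv t y).mul_const (f y))
  have h1 : S.X j (kernelIntegral k Ω f) x = ∫ y in Ω, Φ' 0 y * f y := hmain.2.deriv
  rw [h1, ← integral_neg]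
  refine integral_congr_ae (.of_forall fun y => ?_)
  have h2 : S.X j (fun z => k (x * z⁻¹)) y = -Φ' 0 y := by
    rw [← (hderiv 0 y).deriv]
    have h3 := deriv_comp_neg (fun s => Φ (s, y)) 0
    rw [neg_zero] at h3
    rw [← h3, X]
    congr 1
    funext t
    simp only [Φ, e]
    rw [mul_inv_rev, S.inv_eq_neg (t • _), ← neg_smul, mul_assoc]
  simp only [h2]
  ring

end StratifiedGroup

/-! ### The Leibniz rule against `C^1` test fields -/

namespace StratifiedGroup

variable {G : Type*} [NormedAddCommGroup G] [InnerProductSpace ℝ G] [Group G]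
  [FiniteDimensional ℝ G] [MeasurableSpace G] [BorelSpace G]
  {S : StratifiedGroup G} {Ω : Set G} {f : G → ℝ} {γ : Measure G} {σ : G → S.HFiber}

theorem IsHGradient.isRadonOn (h : S.IsHGradient Ω f γ σ) : IsRadonOn γ Ω :=
  ⟨h.measure_compl, h.measure_compact⟩

theorem IsHGradient.integrable_smul (h : S.IsHGradient Ω f γ σ) {g : G → ℝ}
    (hg : g ∈ contFields G ℝ Ω) : Integrable (fun y => g y • σ y) γ :=
  (integrableOn_of_mem_contFields h.measure_compact hg).smul_bdd 1 h.aestronglyMeasurable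
    (h.norm_eq_one.mono fun _ hx => hx.le)

theorem IsHGradient.integrable_inner (h : S.IsHGradient Ω f γ σ) {φ : G → S.HFiber}
    (hφ : Integrable φ γ) : Integrable (fun y => inner ℝ (φ y) (σ y)) γ := by
  refine hφ.mono (hφ.1.inner h.aestronglyMeasurable) ?_
  filter_upwards [h.norm_eq_one] with x hx
  exact (norm_inner_le_norm _ _).trans (by rw [hx, mul_one])

/-- The condition on `x` says that `y ↦ k(x y⁻¹) e_j` has compact support in `Ω`, so it is an
admissible test field, and its divergence is the `X_j` derivative appearing in `X_kernelIntegral`.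
-/
theorem IsHGradient.X_kernelIntegral_eq (h : S.IsHGradient Ω f γ σ) {k : G → ℝ}
    (hk : ContDiff ℝ 1 k) (hks : HasCompactSupport k) (hf : AEStronglyMeasurable f)
    (hf1 : ∀ x, ‖f x‖ ≤ 1) (j : S.HIndex) {x : G} (hx : reach (tsupport k) {x} ⊆ Ω) :
    S.X j (kernelIntegral k Ω f) x = S.kernelMeasure k Ω γ σ x j := by
  classical
  have hkx := S.kernel_mem_c1Fields hk hks hx
  set g : G → ℝ := fun y => k (x * y⁻¹) with hg
  let φ : G → S.HFiber := fun y => g y • EuclideanSpace.single j (1 : ℝ)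
  have hφ : φ ∈ S.C1c Ω := ⟨hkx.1.smul contDiff_const,
    (smul_single_mem_contFields (c1Fields_le_contFields Ω hkx) _).2⟩
  have hdiv : ∀ y, S.hdiv φ y = S.X j g y := by
    intro y
    rw [hdiv, Finset.sum_eq_single j]
    · simp [φ]
    · intro i _ hi
      have : (fun z => φ z i) = fun _ => 0 := by
        funext z
        simp [φ, hi]
      rw [this]
      simp [X]
    · simp
  rw [S.X_kernelIntegral hk hks hf hf1 j x]
  have h1 := h.integral_hdiv φ hφ
  simp only [hdiv] at h1
  rw [h1, neg_neg, kernelMeasure]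
  have h2 := (EuclideanSpace.proj j : S.HFiber →L[ℝ] ℝ).integral_comp_comm (μ := γ.restrict Ω)
    (h.integrable_smul (c1Fields_le_contFields Ω hkx)).integrableOn
  refine Eq.trans ?_ h2
  refine integral_congr_ae (.of_forall fun y => ?_)
  simp [φ, real_inner_smul_left, EuclideanSpace.inner_single_left]

/-- The Leibniz rule for a `C^1` kernel. -/
theorem IsHGradient.leibniz_of_contDiff (h : S.IsHGradient Ω f γ σ) (hΩ : IsOpen Ω) {k : G → ℝ}
    (hk : ContDiff ℝ 1 k) (hks : HasCompactSupport k) (hf : AEStronglyMeasurable f)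
    (hf1 : ∀ x, ‖f x‖ ≤ 1) {φ : G → S.HFiber} (hφ : φ ∈ S.C1c Ω)
    (hreach : reach (tsupport k) (tsupport φ) ⊆ Ω) :
    ∫ x in Ω, kernelIntegral k Ω f x * f x * S.hdiv φ x =
      -(∫ x in Ω, kernelIntegral k Ω f x * inner ℝ (φ x) (σ x) ∂γ) -
        ∫ x in Ω, f x * inner ℝ (φ x) (S.kernelMeasure k Ω γ σ x) := by
  set u := kernelIntegral k Ω f with hu
  have huc : ContDiff ℝ 1 u := S.contDiff_kernelIntegral (n := 1) hk hks hΩ hf hf1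
  -- The Leibniz rule comes from testing the gradient of `f` on `uφ`, with `div (uφ) = u div φ + ∑
  -- X_j u φ_j`.
  have hφu : (fun x => u x • φ x) ∈ S.C1c Ω :=
    ⟨huc.smul hφ.1, (smul_mem_contFields huc.continuous (c1Fields_le_contFields Ω hφ)).2⟩
  let D : G → ℝ := fun x => ∑ j, S.X j u x * φ x j
  have hdiv : ∀ x, S.hdiv (fun x => u x • φ x) x = u x * S.hdiv φ x + D x := by
    intro x
    simp only [hdiv, D, Finset.mul_sum, ← Finset.sum_add_distrib]
    refine Finset.sum_congr rfl fun j _ => ?_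
    exact S.X_mul j (huc.differentiable (by norm_num) x)
      ((S.contDiff_coord hφ.1 j).differentiable (by norm_num) x)
  have hD : ∀ x, f x * D x = f x * inner ℝ (φ x) (S.kernelMeasure k Ω γ σ x) := by
    intro x
    by_cases hx : x ∈ tsupport φ
    · simp only [D, PiLp.inner_apply]
      congr 1
      refine Finset.sum_congr rfl fun j _ => ?_
      rw [h.X_kernelIntegral_eq hk hks hf hf1 j ((reach_mono Subset.rfl
        (singleton_subset_iff.2 hx)).trans hreach)]
      simp
    · have : φ x = 0 := image_eq_zero_of_notMem_tsupport hx
      simp [D, this]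
  have hint : ∀ {g : G → ℝ}, g ∈ contFields G ℝ Ω → IntegrableOn (fun x => f x * g x) Ω := by
    intro g hg
    exact ((integrableOn_of_mem_contFields (fun _ hK _ => hK.measure_lt_top) hg).bdd_mul hf
      (.of_forall hf1)).integrableOn
  have hdm := S.hdiv_mem_contFields hφ
  have hi1 := hint (smul_mem_contFields huc.continuous hdm)
  have hi2 : IntegrableOn (fun x => f x * D x) Ω := by
    refine hint ⟨?_, ?_⟩
    · exact continuous_finsetSum _ fun j _ => (S.continuous_X j huc).mul
        (S.contDiff_coord hφ.1 j).continuous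
    · have hs : Function.support D ⊆ Function.support φ := by
        intro x hx h0
        exact hx (by simp [D, h0])
      exact ⟨hφ.2.1.mono hs, (closure_mono hs).trans hφ.2.2⟩
  have h1 := h.integral_hdiv _ hφu
  have h2 : ∫ x in Ω, f x * S.hdiv (fun x => u x • φ x) x =
      (∫ x in Ω, u x * f x * S.hdiv φ x) + ∫ x in Ω, f x * D x := by
    rw [← integral_add (hi1.congr (.of_forall fun x => by simp only [smul_eq_mul]; ring)) hi2]
    refine integral_congr_ae (.of_forall fun x => ?_)
    simp only [hdiv]
    ring
  rw [h2] at h1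
  simp only [hD, real_inner_smul_left] at h1
  linarith

theorem norm_kernelMeasure_le (h : S.IsHGradient Ω f γ σ) {k : G → ℝ} {T K : Set G}
    (hT : tsupport k ⊆ T) (hfin : γ (reach T K) < ∞) {C : ℝ} (hC : ∀ x, ‖k x‖ ≤ C) {x : G}
    (hx : x ∈ K) : ‖S.kernelMeasure k Ω γ σ x‖ ≤ C * (γ (reach T K)).toReal := by
  have h1 : S.kernelMeasure k Ω γ σ x =
      ∫ y in reach T K, k (x * y⁻¹) • σ y ∂γ.restrict Ω := by
    refine (setIntegral_eq_integral_of_forall_compl_eq_zero fun y hy => ?_).symm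
    rw [image_eq_zero_of_notMem_tsupport fun hk => hy ⟨x, hx, hT hk⟩, zero_smul]
  have hle : (γ.restrict Ω) (reach T K) ≤ γ (reach T K) := Measure.restrict_apply_le _ _
  rw [h1]
  have hC0 : 0 ≤ C := (norm_nonneg _).trans (hC 0)
  refine (norm_setIntegral_le_of_norm_le_const_ae (C := C) (hle.trans_lt hfin) ?_).trans ?_
  · filter_upwards [ae_restrict_of_ae (ae_restrict_of_ae h.norm_eq_one)] with y hy
    rw [norm_smul, hy, mul_one]
    exact hC _
  · exact mul_le_mul_of_nonneg_left (ENNReal.toReal_mono hfin.ne hle) hC0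

theorem aestronglyMeasurable_kernelMeasure (h : S.IsHGradient Ω f γ σ) (hΩ : IsOpen Ω)
    {k : G → ℝ} (hk : Continuous k) : AEStronglyMeasurable (S.kernelMeasure k Ω γ σ) := by
  have := h.isRadonOn.sigmaFinite hΩ
  have hm : AEStronglyMeasurable (fun p : G × G => k (p.1 * p.2⁻¹) • σ p.2)
      ((volume : Measure G).prod (γ.restrict Ω)) :=
    (hk.comp (S.continuous_div_comp continuous_fst continuous_snd)).aestronglyMeasurable.smul
      h.aestronglyMeasurable.restrict.comp_snd
  exact hm.integral_prod_right'

/-- The Leibniz rule for a continuous kernel. -/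
theorem IsHGradient.leibniz (h : S.IsHGradient Ω f γ σ) (hΩ : IsOpen Ω) {k : G → ℝ}
    (hk : Continuous k) (hks : HasCompactSupport k) (hf : AEStronglyMeasurable f)
    (hf1 : ∀ x, ‖f x‖ ≤ 1) {φ : G → S.HFiber} (hφ : φ ∈ S.C1c Ω)
    (hreach : reach (tsupport k) (tsupport φ) ⊆ Ω) :
    ∫ x in Ω, kernelIntegral k Ω f x * f x * S.hdiv φ x =
      -(∫ x in Ω, kernelIntegral k Ω f x * inner ℝ (φ x) (σ x) ∂γ) -
        ∫ x in Ω, f x * inner ℝ (φ x) (S.kernelMeasure k Ω γ σ x) := by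
  have hkc : k ∈ contFields G ℝ univ := ⟨hk, hks, subset_univ _⟩
  -- The approximations have support inside that of `k`, so the reach condition persists, and `|κ n|
  -- ≤ |k|` provides domination in all three integrals.
  obtain ⟨κ, hκ, hκk⟩ := exists_c1Fields_seq hkc
  obtain ⟨M, hM0, hM⟩ := exists_norm_le_of_mem_contFields hkc
  have hφc := c1Fields_le_contFields Ω hφ
  obtain ⟨B, hB0, hB⟩ := exists_norm_le_of_mem_contFields hφc
  have hκs : ∀ n, HasCompactSupport (κ n) := fun n => (hκ n).1.2.1
  have hκc : ∀ n, Continuous (κ n) := fun n => (hκ n).1.1.continuous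
  have hfin : γ (reach (tsupport k) (tsupport φ)) < ∞ :=
    h.measure_compact _ (S.isCompact_reach hks hφ.2.1) hreach
  have hvol : ∀ K : Set G, IsCompact K → K ⊆ Ω → (volume : Measure G) K < ∞ :=
    fun _ hK _ => hK.measure_lt_top
  have huB : ∀ n x, ‖kernelIntegral (κ n) Ω f x‖ ≤ ∫ y, ‖k y‖ := fun n x =>
    (S.norm_kernelIntegral_le (hκc n) (hκs n) Ω hf1 x).trans
      (integral_mono (integrableOn_of_mem_contFields (fun _ hK _ => hK.measure_lt_top)
        (c1Fields_le_contFields _ (hκ n).1)).norm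
        (integrableOn_of_mem_contFields (fun _ hK _ => hK.measure_lt_top) hkc).norm (hκ n).2.2)
  have hu : ∀ x, Tendsto (fun n => kernelIntegral (κ n) Ω f x) atTop
      (𝓝 (kernelIntegral k Ω f x)) := by
    intro x
    refine tendsto_integral_of_dominated_convergence (fun y => ‖k (x * y⁻¹) * f y‖) (fun n => ?_)
      (S.integrable_kernel_mul hk hks hf hf1 x).norm.integrableOn (fun n => .of_forall fun y => ?_)
      (.of_forall fun y => (hκk _).mul_const _)
    · exact (S.integrable_kernel_mul (hκc n) (hκs n) hf hf1 x).integrableOn.1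
    · rw [norm_mul, norm_mul]
      exact mul_le_mul_of_nonneg_right ((hκ n).2.2 _) (norm_nonneg _)
  have hv : ∀ x, reach (tsupport k) {x} ⊆ Ω →
      Tendsto (fun n => S.kernelMeasure (κ n) Ω γ σ x) atTop
        (𝓝 (S.kernelMeasure k Ω γ σ x)) := by
    intro x hx
    refine tendsto_integral_of_dominated_convergence (fun y => ‖k (x * y⁻¹) • σ y‖) (fun n => ?_)
      (h.integrable_smul (S.kernel_mem_contFields hk hks hx)).norm.integrableOn
      (fun n => .of_forall fun y => ?_) (.of_forall fun y => (hκk _).smul_const _)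
    · exact (h.integrable_smul (S.kernel_mem_contFields (hκc n) (hκs n)
        ((reach_mono (hκ n).2.1 Subset.rfl).trans hx))).integrableOn.1
    · rw [norm_smul, norm_smul]
      exact mul_le_mul_of_nonneg_right ((hκ n).2.2 _) (norm_nonneg _)
  have hsm : ∀ n, AEStronglyMeasurable (kernelIntegral (κ n) Ω f) := fun n =>
    (S.continuous_kernelIntegral (hκc n) (hκs n) hΩ hf hf1).aestronglyMeasurable
  have L1 : Tendsto (fun n => ∫ x in Ω, kernelIntegral (κ n) Ω f x * f x * S.hdiv φ x) atTop
      (𝓝 (∫ x in Ω, kernelIntegral k Ω f x * f x * S.hdiv φ x)) := by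
    have hdm := S.hdiv_mem_contFields hφ
    refine tendsto_integral_of_dominated_convergence (fun x => (∫ y, ‖k y‖) * ‖S.hdiv φ x‖)
      (fun n => ?_) ?_ (fun n => .of_forall fun x => ?_)
      (.of_forall fun x => ((hu x).mul_const _).mul_const _)
    · exact (((hsm n).mul hf).mul hdm.1.aestronglyMeasurable).restrict
    · exact ((integrableOn_of_mem_contFields hvol hdm).norm.const_mul _).integrableOn
    · rw [norm_mul, norm_mul]
      refine mul_le_mul_of_nonneg_right ?_ (norm_nonneg _)
      exact (mul_le_of_le_one_right (norm_nonneg _) (hf1 x)).trans (huB n x)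
  have L2 : Tendsto (fun n => ∫ x in Ω, kernelIntegral (κ n) Ω f x * inner ℝ (φ x) (σ x) ∂γ) atTop
      (𝓝 (∫ x in Ω, kernelIntegral k Ω f x * inner ℝ (φ x) (σ x) ∂γ)) := by
    have hi := h.integrable_inner (integrableOn_of_mem_contFields h.measure_compact hφc)
    refine tendsto_integral_of_dominated_convergence
      (fun x => (∫ y, ‖k y‖) * ‖inner ℝ (φ x) (σ x)‖)
      (fun n => ?_) (hi.norm.const_mul _).integrableOn (fun n => .of_forall fun x => ?_)
      (.of_forall fun x => (hu x).mul_const _)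
    · exact ((S.continuous_kernelIntegral (hκc n) (hκs n) hΩ hf
        hf1).aestronglyMeasurable.mul hi.1).restrict
    · rw [norm_mul]
      exact mul_le_mul_of_nonneg_right (huB n x) (norm_nonneg _)
  have L3 : Tendsto (fun n => ∫ x in Ω, f x * inner ℝ (φ x) (S.kernelMeasure (κ n) Ω γ σ x)) atTop
      (𝓝 (∫ x in Ω, f x * inner ℝ (φ x) (S.kernelMeasure k Ω γ σ x))) := by
    refine tendsto_integral_of_dominated_convergence
      (fun x => ‖φ x‖ * (M * (γ (reach (tsupport k) (tsupport φ))).toReal))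
      (fun n => ?_) ?_ (fun n => .of_forall fun x => ?_) (.of_forall fun x => ?_)
    · exact (hf.mul (hφ.1.continuous.aestronglyMeasurable.inner
        (aestronglyMeasurable_kernelMeasure h hΩ (hκc n)))).restrict
    · exact ((integrableOn_of_mem_contFields hvol hφc).norm.mul_const _).integrableOn
    · by_cases hx : x ∈ tsupport φ
      · rw [norm_mul]
        refine (mul_le_of_le_one_left (norm_nonneg _) (hf1 x)).trans
          ((norm_inner_le_norm _ _).trans (mul_le_mul_of_nonneg_left ?_ (norm_nonneg _)))
        exact norm_kernelMeasure_le h (hκ n).2.1 hfin (fun y => ((hκ n).2.2 y).trans (hM y)) hx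
      · simp [image_eq_zero_of_notMem_tsupport hx]
    · by_cases hx : x ∈ tsupport φ
      · exact (tendsto_const_nhds.inner (hv x ((reach_mono Subset.rfl
          (singleton_subset_iff.2 hx)).trans hreach))).const_mul _
      · simp [image_eq_zero_of_notMem_tsupport hx]
  refine tendsto_nhds_unique L1 ((L2.neg.sub L3).congr fun n => ?_)
  exact (h.leibniz_of_contDiff hΩ (hκ n).1.1 (hκs n) hf hf1 hφ
    ((reach_mono (hκ n).2.1 Subset.rfl).trans hreach)).symm

end StratifiedGroup

/-! ### Inner sets for the right invariant distance and rescaled mollifiers -/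

namespace StratifiedGroup

variable {G : Type*} [NormedAddCommGroup G] [InnerProductSpace ℝ G] [Group G]
  {S : StratifiedGroup G}

section InnerR

theorem HomogeneousDistance.innerR_subset (d : S.HomogeneousDistance) (Ω : Set G) (ε : ℝ) :
    d.innerR Ω ε ⊆ Ω := by
  intro x hx
  by_contra h
  have h1 : ⨅ y ∈ Ωᶜ, ENNReal.ofReal (d.distR x y) ≤ ENNReal.ofReal (d.distR x x) :=
    iInf₂_le x h
  have h2 : d.distR x x = 0 := by
    rw [HomogeneousDistance.distR, mul_inv_cancel, S.one_eq_zero]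
    exact (d.dist_eq_zero_iff 0 0).2 rfl
  rw [h2, ENNReal.ofReal_zero] at h1
  exact not_lt_bot (hx.trans_le h1)

/-- Write `x z⁻¹ = (x y⁻¹)(y z⁻¹)` and use left invariance of `d` to cancel the first factor. -/
theorem HomogeneousDistance.distR_triangle (d : S.HomogeneousDistance) (x y z : G) :
    d.distR x z ≤ d.distR x y + d.distR y z := by
  have h1 : x * z⁻¹ = (x * y⁻¹) * (y * z⁻¹) := by group
  have h2 := d.dist_triangle ((x * y⁻¹) * (y * z⁻¹)) ((x * y⁻¹) * 0) 0
  rw [d.dist_mul_left, S.mul_zero', ← h1] at h2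
  rw [HomogeneousDistance.distR, HomogeneousDistance.distR, HomogeneousDistance.distR]
  linarith

variable [FiniteDimensional ℝ G]

theorem HomogeneousDistance.isOpen_innerR (d : S.HomogeneousDistance) (Ω : Set G) (ε : ℝ) :
    IsOpen (d.innerR Ω ε) := by
  rw [isOpen_iff_mem_nhds]
  intro x hx
  -- A finite `r` strictly in between treats the case of infinite distance (`Ωᶜ` empty) together
  -- with the others.
  obtain ⟨r, hr1, hr2⟩ := ENNReal.lt_iff_exists_nnreal_btwn.1 hx
  set η : ℝ := r - (ENNReal.ofReal ε).toReal with hη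
  have hr1' : (ENNReal.ofReal ε).toReal < r := by
    rw [← ENNReal.coe_toReal r]
    exact (ENNReal.toReal_lt_toReal ENNReal.ofReal_ne_top ENNReal.coe_ne_top).2 hr1
  have hcont : Continuous fun z => d.distR x z := d.continuous_dist.comp
    ((S.continuous_mul_comp continuous_const
      (S.continuous_inv_comp continuous_id)).prodMk continuous_const)
  have h0 : d.distR x x < η / 2 := by
    rw [HomogeneousDistance.distR, mul_inv_cancel, S.one_eq_zero,
      (d.dist_eq_zero_iff 0 0).2 rfl]
    linarith
  filter_upwards [(hcont.tendsto x).eventually_lt_const h0] with z hz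
  have key : ∀ y ∈ Ωᶜ, ENNReal.ofReal (r - η / 2) ≤ ENNReal.ofReal (d.distR z y) := by
    intro y hy
    refine ENNReal.ofReal_le_ofReal ?_
    have h1 : (r : ℝ≥0∞) < ENNReal.ofReal (d.distR x y) := hr2.trans_le (iInf₂_le y hy)
    have h2 : (r : ℝ) < d.distR x y := by
      rw [← ENNReal.ofReal_coe_nnreal] at h1
      exact (ENNReal.ofReal_lt_ofReal_iff_of_nonneg r.2).1 h1
    linarith [d.distR_triangle x z y]
  refine lt_of_lt_of_le ?_ (le_iInf₂ key)
  rw [← ENNReal.ofReal_toReal (ENNReal.ofReal_ne_top (r := ε))]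
  exact (ENNReal.ofReal_lt_ofReal_iff_of_nonneg ENNReal.toReal_nonneg).2 (by linarith)

theorem HomogeneousDistance.reach_subset_of_subset_innerR (d : S.HomogeneousDistance)
    {Ω T K : Set G} {ε : ℝ} (hT : ∀ z ∈ T, d.dist z 0 ≤ ε) (hK : K ⊆ d.innerR Ω ε) :
    reach T K ⊆ Ω := by
  rintro y ⟨x, hx, hxy⟩
  by_contra h
  have h1 : ⨅ y ∈ Ωᶜ, ENNReal.ofReal (d.distR x y) ≤ ENNReal.ofReal (d.distR x y) :=
    iInf₂_le y h
  exact ((hK hx).trans_le (h1.trans (ENNReal.ofReal_le_ofReal (hT _ hxy)))).false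

end InnerR

variable [FiniteDimensional ℝ G] [MeasurableSpace G] [BorelSpace G]

section Rescale

variable {d : S.HomogeneousDistance} {ρ : G → ℝ}

theorem IsMollifier.continuous_rescale (hρ : S.IsMollifier d ρ) (ε : ℝ) :
    Continuous (S.rescale ρ ε) :=
  continuous_const.mul (hρ.continuous.comp
    (S.continuous_dilation.comp (continuous_const.prodMk continuous_id)))

theorem IsMollifier.tsupport_rescale (hρ : S.IsMollifier d ρ) {ε : ℝ} (hε : 0 < ε) :
    tsupport (S.rescale ρ ε) ⊆ S.dilation ε '' tsupport ρ := by
  have hc : IsCompact (S.dilation ε '' tsupport ρ) := hρ.hasCompactSupport.isCompact.image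
    (S.continuous_dilation.comp (continuous_const.prodMk continuous_id))
  refine closure_minimal (fun x hx => ⟨S.dilation ε⁻¹ x, subset_tsupport ρ ?_, ?_⟩) hc.isClosed
  · intro h
    exact hx (by simp [rescale, h])
  · rw [S.dilation_dilation, mul_inv_cancel₀ hε.ne', S.dilation_one]

theorem IsMollifier.hasCompactSupport_rescale (hρ : S.IsMollifier d ρ) {ε : ℝ} (hε : 0 < ε) :
    HasCompactSupport (S.rescale ρ ε) :=
  (hρ.hasCompactSupport.isCompact.image
    (S.continuous_dilation.comp (continuous_const.prodMk continuous_id))).of_isClosed_subset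
    (isClosed_tsupport _) (hρ.tsupport_rescale hε)

theorem IsMollifier.rescale_nonneg (hρ : S.IsMollifier d ρ) {ε : ℝ} (hε : 0 < ε) (x : G) :
    0 ≤ S.rescale ρ ε x :=
  mul_nonneg (pow_nonneg (inv_nonneg.2 hε.le) _) (hρ.nonneg _)

theorem IsMollifier.rescale_inv (hρ : S.IsMollifier d ρ) (ε : ℝ) (x : G) :
    S.rescale ρ ε x⁻¹ = S.rescale ρ ε x := by
  have h : S.dilation ε⁻¹ x⁻¹ = (S.dilation ε⁻¹ x)⁻¹ := by
    rw [S.inv_eq_neg, S.inv_eq_neg, ← dilationₗ_apply, map_neg, dilationₗ_apply]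
  rw [rescale, rescale, h, hρ.symm]

theorem IsMollifier.integral_rescale (hρ : S.IsMollifier d ρ) {ε : ℝ} (hε : 0 < ε) :
    ∫ x, S.rescale ρ ε x = 1 := by
  have h1 : ∫ x, ρ x = 1 := by
    rw [← hρ.integral_eq_one]
    exact (setIntegral_eq_integral_of_forall_compl_eq_zero fun x hx =>
      image_eq_zero_of_notMem_tsupport fun h => hx (hρ.tsupport_subset h)).symm
  have hdet : LinearMap.det (S.dilationₗ ε⁻¹) ≠ 0 := by
    rw [S.det_dilationₗ]
    exact pow_ne_zero _ (inv_ne_zero hε.ne')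
  have h2 := Measure.map_linearMap_addHaar_eq_smul_addHaar (volume : Measure G) hdet
  have hc : Continuous (S.dilationₗ ε⁻¹) :=
    S.continuous_dilation.comp (continuous_const.prodMk continuous_id)
  have h3 : ∫ x, ρ (S.dilationₗ ε⁻¹ x) = ∫ x, ρ x ∂(Measure.map (S.dilationₗ ε⁻¹) volume) :=
    (integral_map hc.aemeasurable hρ.continuous.aestronglyMeasurable).symm
  rw [h2, integral_smul_measure, h1, S.det_dilationₗ] at h3
  simp only [rescale, integral_const_mul, ← dilationₗ_apply]
  rw [h3, ENNReal.toReal_ofReal (abs_nonneg _), abs_of_pos (by positivity), smul_eq_mul, mul_one]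
  exact mul_inv_cancel₀ (pow_ne_zero _ (inv_ne_zero hε.ne'))

theorem IsMollifier.integral_norm_rescale (hρ : S.IsMollifier d ρ) {ε : ℝ} (hε : 0 < ε) :
    ∫ x, ‖S.rescale ρ ε x‖ = 1 := by
  rw [← hρ.integral_rescale hε]
  exact integral_congr_ae (.of_forall fun x => Real.norm_of_nonneg (hρ.rescale_nonneg hε x))

theorem IsMollifier.dist_le_of_mem_tsupport_rescale (hρ : S.IsMollifier d ρ) {ε : ℝ} (hε : 0 < ε)
    {x : G} (hx : x ∈ tsupport (S.rescale ρ ε)) : d.dist x 0 ≤ ε := by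
  obtain ⟨w, hw, rfl⟩ := hρ.tsupport_rescale hε hx
  have h0 : S.dilation ε 0 = 0 := by rw [← dilationₗ_apply, map_zero]
  have h1 := d.dist_dilation ε hε w 0
  rw [h0] at h1
  rw [h1]
  exact mul_le_of_le_one_right hε.le (hρ.tsupport_subset hw).le

/-- The dilation is jointly continuous and sends everything to `0` at `ε = 0`, so compactness of the
support gives uniform shrinking. No comparison of `d` with the norm is needed. -/
theorem IsMollifier.eventually_tsupport_rescale_subset (hρ : S.IsMollifier d ρ) {N : Set G}
    (hN : N ∈ 𝓝 (0 : G)) : ∀ᶠ ε in 𝓝[>] (0 : ℝ), tsupport (S.rescale ρ ε) ⊆ N := by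
  have h1 : ∀ᶠ ε in 𝓝 (0 : ℝ), ∀ w ∈ tsupport ρ, S.dilation ε w ∈ N := by
    refine hρ.hasCompactSupport.isCompact.eventually_forall_of_forall_eventually fun w _ => ?_
    have := (S.continuous_dilation.tendsto ((0 : ℝ), w))
    rw [S.dilation_zero] at this
    exact this.eventually hN
  filter_upwards [nhdsWithin_le_nhds h1, self_mem_nhdsWithin] with ε hε1 hε2
  intro x hx
  obtain ⟨w, hw, rfl⟩ := hρ.tsupport_rescale hε2 hx
  exact hε1 w hw

end Rescale

/-! ### The Leibniz rule as an identity of measures on a subdomain -/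

section Leibniz

variable {Ω W : Set G} {f : G → ℝ} {γ : Measure G} {σ : G → S.HFiber} {k : G → ℝ}

theorem IsHGradient.leibniz_on (h : S.IsHGradient Ω f γ σ) (hΩ : IsOpen Ω)
    (hWΩ : W ⊆ Ω) (hk : Continuous k) (hks : HasCompactSupport k)
    (hWk : reach (tsupport k) W ⊆ Ω) (hf : AEStronglyMeasurable f) (hf1 : ∀ x, ‖f x‖ ≤ 1)
    {φ : G → S.HFiber} (hφ : φ ∈ S.C1c W) :
    ∫ x in W, kernelIntegral k Ω f x * f x * S.hdiv φ x =
      -(∫ x in W, kernelIntegral k Ω f x * inner ℝ (φ x) (σ x) ∂γ) -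
        ∫ x in W, f x * inner ℝ (φ x) (S.kernelMeasure k Ω γ σ x) := by
  have h1 := h.leibniz hΩ hk hks hf hf1 (c1Fields_mono hWΩ hφ)
    ((reach_mono Subset.rfl hφ.2.2).trans hWk)
  have hφ0 : ∀ x ∈ Ω \ W, φ x = 0 := fun x hx =>
    image_eq_zero_of_notMem_tsupport fun hm => hx.2 (hφ.2.2 hm)
  rw [S.setIntegral_mul_hdiv_eq hΩ hWΩ hφ (fun x => kernelIntegral k Ω f x * f x)] at h1
  rw [h1]
  congr 1
  · congr 1
    exact setIntegral_eq_of_subset_of_forall_sdiff_eq_zero hΩ.measurableSet hWΩ fun x hx => by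
      simp [hφ0 x hx]
  · exact setIntegral_eq_of_subset_of_forall_sdiff_eq_zero hΩ.measurableSet hWΩ fun x hx => by
      simp [hφ0 x hx]

theorem IsHGradient.hVariation_kernelIntegral_mul_le (h : S.IsHGradient Ω f γ σ) (hΩ : IsOpen Ω)
    (hWΩ : W ⊆ Ω) (hk : Continuous k) (hks : HasCompactSupport k)
    (hWk : reach (tsupport k) W ⊆ Ω) (hf : AEStronglyMeasurable f) (hf1 : ∀ x, ‖f x‖ ≤ 1) :
    S.hVariation W (fun x => kernelIntegral k Ω f x * f x) ≤
      ∫⁻ x in W, ‖kernelIntegral k Ω f x‖ₑ ∂γ + ∫⁻ x in W, ‖S.kernelMeasure k Ω γ σ x‖ₑ := by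
  refine iSup₂_le fun φ hφ => ?_
  rw [h.leibniz_on hΩ hWΩ hk hks hWk hf hf1 hφ.1]
  refine (Real.ofReal_le_enorm _).trans (enorm_sub_le.trans (add_le_add ?_ ?_))
  · rw [enorm_neg]
    refine (enorm_integral_le_lintegral_enorm _).trans (lintegral_mono_ae ?_)
    filter_upwards [ae_restrict_of_ae h.norm_eq_one] with x hx
    rw [← ofReal_norm, ← ofReal_norm]
    refine ENNReal.ofReal_le_ofReal ?_
    rw [norm_mul]
    refine mul_le_of_le_one_right (norm_nonneg _) ((norm_inner_le_norm _ _).trans ?_)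
    rw [hx, mul_one]
    exact hφ.2 x
  · refine (enorm_integral_le_lintegral_enorm _).trans (lintegral_mono fun x => ?_)
    rw [← ofReal_norm, ← ofReal_norm]
    refine ENNReal.ofReal_le_ofReal ?_
    rw [norm_mul]
    refine (mul_le_of_le_one_left (norm_nonneg _) (hf1 x)).trans
      ((norm_inner_le_norm _ _).trans (mul_le_of_le_one_left (norm_nonneg _) (hφ.2 x)))

theorem setLIntegral_enorm_kernelIntegral_le (S : StratifiedGroup G) (hk : Continuous k)
    (hks : HasCompactSupport k) (hf1 : ∀ x, ‖f x‖ ≤ 1) :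
    ∫⁻ x in W, ‖kernelIntegral k Ω f x‖ₑ ∂γ ≤ ENNReal.ofReal (∫ y, ‖k y‖) * γ W := by
  rw [← setLIntegral_const]
  refine lintegral_mono fun x => ?_
  rw [← ofReal_norm]
  exact ENNReal.ofReal_le_ofReal (S.norm_kernelIntegral_le hk hks Ω hf1 x)

theorem IsHGradient.isBVLoc_kernelIntegral_mul (h : S.IsHGradient Ω f γ σ) (hΩ : IsOpen Ω)
    (hWΩ : W ⊆ Ω) (hk : Continuous k) (hks : HasCompactSupport k)
    (hWk : reach (tsupport k) W ⊆ Ω) (hf : AEStronglyMeasurable f) (hf1 : ∀ x, ‖f x‖ ≤ 1) :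
    S.IsBVLoc W fun x => kernelIntegral k Ω f x * f x := by
  intro U hU hUc hUW
  have hUW' : U ⊆ W := subset_closure.trans hUW
  have hUk : reach (tsupport k) (closure U) ⊆ Ω := (reach_mono Subset.rfl hUW).trans hWk
  have hvol : (volume : Measure G) U < ∞ := (measure_mono subset_closure).trans_lt hUc.measure_lt_top
  obtain ⟨M, hM0, hM⟩ := exists_norm_le_of_mem_contFields
    (show k ∈ contFields G ℝ univ from ⟨hk, hks, subset_univ _⟩)
  constructor
  · refine IntegrableOn.of_bound hvol ((S.continuous_kernelIntegral hk hks hΩ hf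
      hf1).aestronglyMeasurable.mul hf).restrict (∫ y, ‖k y‖) (.of_forall fun x => ?_)
    rw [norm_mul]
    exact (mul_le_of_le_one_right (norm_nonneg _) (hf1 x)).trans
      (S.norm_kernelIntegral_le hk hks Ω hf1 x)
  · refine (h.hVariation_kernelIntegral_mul_le hΩ (hUW'.trans hWΩ) hk hks
      ((reach_mono Subset.rfl hUW').trans hWk) hf hf1).trans_lt (ENNReal.add_lt_top.2 ⟨?_, ?_⟩)
    · refine (setLIntegral_enorm_kernelIntegral_le S hk hks hf1).trans_lt
        (ENNReal.mul_lt_top ENNReal.ofReal_lt_top ((measure_mono subset_closure).trans_lt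
          (h.measure_compact _ hUc (hUW.trans hWΩ))))
    · have hfin := h.measure_compact _ (S.isCompact_reach hks hUc) hUk
      calc ∫⁻ x in U, ‖S.kernelMeasure k Ω γ σ x‖ₑ
          ≤ ∫⁻ _ in U, ENNReal.ofReal (M * (γ (reach (tsupport k) (closure U))).toReal) := by
            refine setLIntegral_mono' hU.measurableSet fun x hx => ?_
            rw [← ofReal_norm]
            exact ENNReal.ofReal_le_ofReal
              (norm_kernelMeasure_le h Subset.rfl hfin hM (subset_closure hx))
        _ < ∞ := by
            rw [setLIntegral_const]
            exact ENNReal.mul_lt_top ENNReal.ofReal_lt_top hvol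

/-- The first term of the variation bound is at most `‖k‖₁ γ(W)`. The second is controlled by
Young's inequality for a measure: Tonelli and right invariance give `∫ |k * σγ| dx ≤ ‖k‖₁ γ(Ω)`. -/
theorem IsHGradient.hVariation_kernelIntegral_mul_lt_top (h : S.IsHGradient Ω f γ σ)
    (hΩ : IsOpen Ω) (hWΩ : W ⊆ Ω) (hk : Continuous k) (hks : HasCompactSupport k)
    (hWk : reach (tsupport k) W ⊆ Ω) (hf : AEStronglyMeasurable f) (hf1 : ∀ x, ‖f x‖ ≤ 1)
    (hγ : γ Ω < ∞) : S.hVariation W (fun x => kernelIntegral k Ω f x * f x) < ∞ := by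
  have hkint : Integrable k :=
    integrableOn_of_mem_contFields (U := univ) (fun _ hK _ => hK.measure_lt_top)
      ⟨hk, hks, subset_univ _⟩
  have := h.isRadonOn.sigmaFinite hΩ
  refine (h.hVariation_kernelIntegral_mul_le hΩ hWΩ hk hks hWk hf hf1).trans_lt
    (ENNReal.add_lt_top.2 ⟨?_, ?_⟩)
  · exact (setLIntegral_enorm_kernelIntegral_le S hk hks hf1).trans_lt
      (ENNReal.mul_lt_top ENNReal.ofReal_lt_top ((measure_mono hWΩ).trans_lt hγ))
  · calc ∫⁻ x in W, ‖S.kernelMeasure k Ω γ σ x‖ₑ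
        ≤ ∫⁻ x, ‖S.kernelMeasure k Ω γ σ x‖ₑ := setLIntegral_le_lintegral _ _
      _ ≤ ∫⁻ x, ∫⁻ y in Ω, ‖k (x * y⁻¹)‖ₑ ∂γ := by
          refine lintegral_mono fun x => (enorm_integral_le_lintegral_enorm _).trans
            (lintegral_mono_ae ?_)
          filter_upwards [ae_restrict_of_ae h.norm_eq_one] with y hy
          rw [← ofReal_norm, ← ofReal_norm, norm_smul, hy, mul_one]
      _ = ∫⁻ y in Ω, (∫⁻ x, ‖k (x * y⁻¹)‖ₑ) ∂γ := by
          refine lintegral_lintegral_swap ?_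
          exact (hk.comp (S.continuous_div_comp continuous_fst
            continuous_snd)).enorm.measurable.aemeasurable
      _ = ∫⁻ _ in Ω, (∫⁻ x, ‖k x‖ₑ) ∂γ := by
          refine lintegral_congr fun y => ?_
          exact (S.measurePreserving_mul_right y⁻¹).lintegral_comp hk.enorm.measurable
      _ < ∞ := by
          rw [setLIntegral_const]
          exact ENNReal.mul_lt_top hkint.2 hγ

/-- Passes from `C^1` to continuous test fields. It is applied to each of the three measures in the
Leibniz identity, with densities bounded on the support of `φ`. -/
theorem tendsto_integral_inner_of_approx {ν : Measure G}
    (hν : ∀ K, IsCompact K → K ⊆ W → ν K < ∞) {g φ : G → S.HFiber}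
    (hg : AEStronglyMeasurable g ν) (hφ : φ ∈ contFields G S.HFiber W) {C : ℝ}
    (hC : ∀ᵐ x ∂ν, x ∈ tsupport φ → ‖g x‖ ≤ C) {ψ : ℕ → G → S.HFiber}
    (hψ : ∀ n, ψ n ∈ c1Fields G S.HFiber W ∧ tsupport (ψ n) ⊆ tsupport φ ∧
      ∀ x, ‖ψ n x‖ ≤ ‖φ x‖)
    (hψφ : ∀ x, Tendsto (fun n => ψ n x) atTop (𝓝 (φ x))) :
    Tendsto (fun n => ∫ x in W, inner ℝ (ψ n x) (g x) ∂ν) atTop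
      (𝓝 (∫ x in W, inner ℝ (φ x) (g x) ∂ν)) := by
  refine tendsto_integral_of_dominated_convergence (fun x => ‖φ x‖ * C) (fun n => ?_)
    ((integrableOn_of_mem_contFields hν hφ).norm.mul_const C).integrableOn (fun n => ?_)
    (.of_forall fun x => (hψφ x).inner tendsto_const_nhds)
  · exact ((hψ n).1.1.continuous.aestronglyMeasurable.inner hg).restrict
  · filter_upwards [ae_restrict_of_ae hC] with x hx
    by_cases hxφ : x ∈ tsupport φ
    · exact (norm_inner_le_norm _ _).trans (mul_le_mul ((hψ n).2.2 x) (hx hxφ) (norm_nonneg _)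
        (norm_nonneg _))
    · have h1 : φ x = 0 := image_eq_zero_of_notMem_tsupport hxφ
      have h2 : ψ n x = 0 := image_eq_zero_of_notMem_tsupport fun hm => hxφ ((hψ n).2.1 hm)
      simp [h1, h2]

/-- The Leibniz rule as an equality of vector measures. -/
theorem IsHGradient.integral_inner_kernelIntegral_mul (h : S.IsHGradient Ω f γ σ)
    (hΩ : IsOpen Ω) (hWΩ : W ⊆ Ω) (hk : Continuous k) (hks : HasCompactSupport k)
    (hWk : reach (tsupport k) W ⊆ Ω) (hf : AEStronglyMeasurable f) (hf1 : ∀ x, ‖f x‖ ≤ 1)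
    {γ' : Measure G} {σ' : G → S.HFiber}
    (h' : S.IsHGradient W (fun x => kernelIntegral k Ω f x * f x) γ' σ')
    {φ : G → S.HFiber} (hφ : φ ∈ S.Cc W) :
    ∫ x in W, inner ℝ (φ x) (σ' x) ∂γ' =
      (∫ x in W, kernelIntegral k Ω f x * inner ℝ (φ x) (σ x) ∂γ) +
        ∫ x in W, f x * inner ℝ (φ x) (S.kernelMeasure k Ω γ σ x) := by
  obtain ⟨ψ, hψ, hψφ⟩ := exists_c1Fields_seq hφ
  obtain ⟨M, hM0, hM⟩ := exists_norm_le_of_mem_contFields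
    (show k ∈ contFields G ℝ univ from ⟨hk, hks, subset_univ _⟩)
  have hreach : reach (tsupport k) (tsupport φ) ⊆ Ω := (reach_mono Subset.rfl hφ.2.2).trans hWk
  have hfin := h.measure_compact _ (S.isCompact_reach hks hφ.2.1) hreach
  have hu := S.continuous_kernelIntegral hk hks hΩ hf hf1
  have L0 := tendsto_integral_inner_of_approx h'.measure_compact h'.aestronglyMeasurable hφ
    (h'.norm_eq_one.mono fun x hx _ => hx.le) hψ hψφ
  have L1 := tendsto_integral_inner_of_approx (ν := γ)
    (fun K hK hKW => h.measure_compact K hK (hKW.trans hWΩ))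
    (g := fun x => kernelIntegral k Ω f x • σ x)
    (hu.aestronglyMeasurable.smul h.aestronglyMeasurable) hφ (C := ∫ y, ‖k y‖)
    (h.norm_eq_one.mono fun x hx _ => by
      rw [norm_smul, hx, mul_one]
      exact S.norm_kernelIntegral_le hk hks Ω hf1 x) hψ hψφ
  have L2 := tendsto_integral_inner_of_approx (ν := volume)
    (fun K hK _ => hK.measure_lt_top) (g := fun x => f x • S.kernelMeasure k Ω γ σ x)
    (hf.smul (aestronglyMeasurable_kernelMeasure h hΩ hk)) hφ
    (C := M * (γ (reach (tsupport k) (tsupport φ))).toReal)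
    (.of_forall fun x hx => by
      rw [norm_smul]
      exact (mul_le_of_le_one_left (norm_nonneg _) (hf1 x)).trans
        (norm_kernelMeasure_le h Subset.rfl hfin hM hx)) hψ hψφ
  simp only [real_inner_smul_right] at L1 L2
  refine tendsto_nhds_unique L0 ((L1.add L2).congr fun n => ?_)
  have h1 := h.leibniz_on hΩ hWΩ hk hks hWk hf hf1 (hψ n).1
  have h2 := h'.integral_hdiv _ (hψ n).1
  linarith

end Leibniz

end StratifiedGroup

/-! ### Weak* convergence tested on a dense class -/

section Density

variable {G F : Type*} [NormedAddCommGroup G] [NormedSpace ℝ G] [FiniteDimensional ℝ G]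
  [MeasurableSpace G] [BorelSpace G] [NormedAddCommGroup F] [InnerProductSpace ℝ F]

theorem integrable_inner_of_ae_norm_le_one {ν : Measure G} {g w : G → F} (hg : Integrable g ν)
    (hw : AEStronglyMeasurable w ν) (hw1 : ∀ᵐ x ∂ν, ‖w x‖ ≤ 1) :
    Integrable (fun x => inner ℝ (g x) (w x)) ν := by
  refine hg.mono (hg.1.inner hw) ?_
  filter_upwards [hw1] with x hx
  exact (norm_inner_le_norm _ _).trans (mul_le_of_le_one_right (norm_nonneg _) hx)

/-- Weak* convergence of bounded fields can be tested on `C^1` fields with compact support. -/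
theorem tendsto_integral_inner_of_c1Fields {Ω : Set G} (hΩ : IsOpen Ω) {ν : Measure G}
    (hν : ∀ K, IsCompact K → K ⊆ Ω → ν K < ∞) {w : ℝ → G → F} {w₀ : G → F}
    (hw : ∀ ε, 0 < ε → AEStronglyMeasurable (w ε) ν ∧ ∀ᵐ x ∂ν, ‖w ε x‖ ≤ 1)
    (hw₀ : AEStronglyMeasurable w₀ ν ∧ ∀ᵐ x ∂ν, ‖w₀ x‖ ≤ 1)
    (h : ∀ φ ∈ c1Fields G F Ω, Tendsto (fun ε => ∫ x in Ω, inner ℝ (φ x) (w ε x) ∂ν) (𝓝[>] 0)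
      (𝓝 (∫ x in Ω, inner ℝ (φ x) (w₀ x) ∂ν))) {g : G → F} (hg : IntegrableOn g Ω ν) :
    Tendsto (fun ε => ∫ x in Ω, inner ℝ (g x) (w ε x) ∂ν) (𝓝[>] 0)
      (𝓝 (∫ x in Ω, inner ℝ (g x) (w₀ x) ∂ν)) := by
  rw [Metric.tendsto_nhds]
  intro η hη
  obtain ⟨φ, hφ, hφg⟩ := exists_c1Fields_dist_integral_lt hΩ hν hg (ε := η / 3) (by positivity)
  have hφi : IntegrableOn φ Ω ν :=
    (integrableOn_of_mem_contFields hν (c1Fields_le_contFields Ω hφ)).integrableOn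
  -- The bound `|v| ≤ 1` makes the replacement of `g` by `φ` cost less than `η / 3` uniformly in
  -- `ε`.
  have key : ∀ v : G → F, AEStronglyMeasurable v ν → (∀ᵐ x ∂ν, ‖v x‖ ≤ 1) →
      |(∫ x in Ω, inner ℝ (φ x) (v x) ∂ν) - ∫ x in Ω, inner ℝ (g x) (v x) ∂ν| < η / 3 := by
    intro v hv hv1
    have hv1' := ae_restrict_of_ae (s := Ω) hv1
    rw [← integral_sub (integrable_inner_of_ae_norm_le_one hφi hv.restrict hv1')
      (integrable_inner_of_ae_norm_le_one hg hv.restrict hv1')]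
    refine lt_of_le_of_lt ?_ hφg
    rw [← Real.norm_eq_abs]
    refine norm_integral_le_of_norm_le (Integrable.sub hφi hg).norm ?_
    filter_upwards [hv1'] with x hx
    rw [← inner_sub_left]
    exact (norm_inner_le_norm _ _).trans (mul_le_of_le_one_right (norm_nonneg _) hx)
  have h0 := key w₀ hw₀.1 hw₀.2
  filter_upwards [(Metric.tendsto_nhds.1 (h φ hφ)) (η / 3) (by positivity), self_mem_nhdsWithin]
    with ε hε1 hε2
  have h1 := key (w ε) (hw ε hε2).1 (hw ε hε2).2
  rw [Real.dist_eq] at hε1 ⊢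
  rw [abs_lt] at *
  constructor <;> linarith [h0.1, h0.2, h1.1, h1.2, hε1.1, hε1.2]

end Density

/-! ### Commuting the mollifier with a test field -/

namespace StratifiedGroup

variable {G : Type*} [NormedAddCommGroup G] [InnerProductSpace ℝ G] [Group G]
  [FiniteDimensional ℝ G] [MeasurableSpace G] [BorelSpace G]
  {S : StratifiedGroup G} {Ω : Set G}
  {V : Type*} [NormedAddCommGroup V] [InnerProductSpace ℝ V] [FiniteDimensional ℝ V]

theorem exists_reach_closedBall_subset (S : StratifiedGroup G) (hΩ : IsOpen Ω) {K : Set G}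
    (hK : IsCompact K) (hKΩ : K ⊆ Ω) : ∃ r > 0, reach (Metric.closedBall 0 r) K ⊆ Ω := by
  have h : ∀ᶠ z in 𝓝 (0 : G), ∀ x ∈ K, z⁻¹ * x ∈ Ω := by
    refine hK.eventually_forall_of_forall_eventually fun x hx => ?_
    have hc : Continuous fun p : G × G => p.1⁻¹ * p.2 :=
      S.continuous_mul_comp (S.continuous_inv_comp continuous_fst) continuous_snd
    refine (hc.tendsto (0, x)).eventually (hΩ.mem_nhds ?_)
    simpa [S.inv_eq_neg, S.zero_mul'] using hKΩ hx
  obtain ⟨r, hr, hr'⟩ := Metric.nhds_basis_closedBall.mem_iff.1 h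
  refine ⟨r, hr, ?_⟩
  rintro y ⟨x, hx, hxy⟩
  have := hr' hxy x hx
  simpa using this

/-- Fubini: the integrand is bounded and lives on `tsupport φ ×ˢ reach (tsupport k) (tsupport φ)`, a
set of finite product measure. -/
theorem integral_mul_inner_kernel_swap (S : StratifiedGroup G) {ν : Measure G} [SFinite ν]
    {s : G → V} (hs : AEStronglyMeasurable s ν) (hs1 : ∀ᵐ x ∂ν, ‖s x‖ ≤ 1) {f : G → ℝ}
    (hf : AEStronglyMeasurable f) (hf1 : ∀ x, ‖f x‖ ≤ 1) {φ : G → V} (hφ : φ ∈ contFields G V Ω)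
    {k : G → ℝ} (hk : Continuous k) (hks : HasCompactSupport k)
    (hfin : ν (reach (tsupport k) (tsupport φ)) < ∞) :
    ∫ x in Ω, f x * inner ℝ (φ x) (∫ y in Ω, k (x * y⁻¹) • s y ∂ν) =
      ∫ y in Ω, inner ℝ (∫ x in Ω, (k (x * y⁻¹) * f x) • φ x) (s y) ∂ν := by
  set R := reach (tsupport k) (tsupport φ) with hR
  have hRc : IsCompact R := S.isCompact_reach hks hφ.2.1
  obtain ⟨M, hM0, hM⟩ := exists_norm_le_of_mem_contFields
    (show k ∈ contFields G ℝ univ from ⟨hk, hks, subset_univ _⟩)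
  obtain ⟨B, hB0, hB⟩ := exists_norm_le_of_mem_contFields hφ
  have hk0 : ∀ x y, x ∈ tsupport φ → y ∉ R → k (x * y⁻¹) = 0 := fun x y hx hy =>
    image_eq_zero_of_notMem_tsupport fun hm => hy ⟨x, hx, hm⟩
  have hφ0 : ∀ x, x ∉ tsupport φ → φ x = 0 := fun x => image_eq_zero_of_notMem_tsupport
  let g : G → G → ℝ := fun x y => f x * (k (x * y⁻¹) * inner ℝ (φ x) (s y))
  have hgm : AEStronglyMeasurable (Function.uncurry g) ((volume : Measure G).prod ν) := by
    refine hf.comp_fst.mul (AEStronglyMeasurable.mul ?_ ?_)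
    · exact (hk.comp (S.continuous_div_comp continuous_fst continuous_snd)).aestronglyMeasurable
    · exact (hφ.1.comp continuous_fst).aestronglyMeasurable.inner hs.comp_snd
  have hgint : Integrable (Function.uncurry g) ((volume : Measure G).prod ν) := by
    have hsub : Function.support (Function.uncurry g) ⊆ tsupport φ ×ˢ R := by
      rintro ⟨x, y⟩ hxy
      have hx : x ∈ tsupport φ := by
        by_contra h
        exact hxy (by simp [g, hφ0 x h])
      refine ⟨hx, ?_⟩
      by_contra h
      exact hxy (by simp [g, hk0 x y hx h])
    refine (integrableOn_iff_integrable_of_support_subset hsub).1 ?_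
    refine IntegrableOn.of_bound ?_ hgm.restrict (M * B) (ae_restrict_of_ae ?_)
    · rw [Measure.prod_prod]
      exact ENNReal.mul_lt_top hφ.2.1.isCompact.measure_lt_top hfin
    · filter_upwards [Measure.quasiMeasurePreserving_snd.ae hs1] with p hp
      simp only [Function.uncurry_def, g, norm_mul]
      refine (mul_le_of_le_one_left (by positivity) (hf1 _)).trans ?_
      refine mul_le_mul (hM _) ((norm_inner_le_norm _ _).trans ?_) (norm_nonneg _) hM0
      exact (mul_le_of_le_one_right (norm_nonneg _) hp).trans (hB _)
  have hgint' : Integrable (Function.uncurry g) ((volume.restrict Ω).prod (ν.restrict Ω)) := by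
    rw [Measure.prod_restrict]
    exact hgint.integrableOn
  have e1 : ∀ x, f x * inner ℝ (φ x) (∫ y in Ω, k (x * y⁻¹) • s y ∂ν) = ∫ y in Ω, g x y ∂ν := by
    intro x
    by_cases hx : x ∈ tsupport φ
    · have hi : Integrable (fun y => k (x * y⁻¹) • s y) (ν.restrict Ω) := by
        have hsub : Function.support (fun y => k (x * y⁻¹) • s y) ⊆ R := by
          intro y hy
          by_contra h
          exact hy (by simp [hk0 x y hx h])
        refine Integrable.integrableOn ((integrableOn_iff_integrable_of_support_subset hsub).1 ?_)
        refine IntegrableOn.of_bound hfin ((hk.comp (S.continuous_div_comp continuous_const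
          continuous_id)).aestronglyMeasurable.smul hs).restrict M (ae_restrict_of_ae ?_)
        filter_upwards [hs1] with y hy
        rw [norm_smul]
        exact (mul_le_of_le_one_right (norm_nonneg _) hy).trans (hM _)
      rw [← integral_inner hi, ← integral_const_mul]
      simp only [g, real_inner_smul_right]
    · simp [g, hφ0 x hx]
  have e2 : ∀ y, inner ℝ (∫ x in Ω, (k (x * y⁻¹) * f x) • φ x) (s y) = ∫ x in Ω, g x y := by
    intro y
    have hi : Integrable (fun x => (k (x * y⁻¹) * f x) • φ x) (volume.restrict Ω) := by
      have h1 : Integrable φ := integrableOn_of_mem_contFields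
        (fun _ hK _ => hK.measure_lt_top) hφ
      refine (h1.bdd_smul M ((hk.comp (S.continuous_mul_comp continuous_id
        continuous_const)).aestronglyMeasurable.mul hf) (.of_forall fun x => ?_)).integrableOn
      rw [Pi.mul_apply, norm_mul]
      exact (mul_le_of_le_one_right (norm_nonneg _) (hf1 x)).trans (hM _)
    rw [real_inner_comm, ← integral_inner hi]
    refine integral_congr_ae (.of_forall fun x => ?_)
    simp only [g, real_inner_smul_right, real_inner_comm (φ x)]
    ring
  simp only [e1, e2]
  exact integral_integral_swap hgint'

variable {d : S.HomogeneousDistance} {ρ : G → ℝ}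

theorem IsMollifier.integrable_rescale_div (hρ : S.IsMollifier d ρ) {ε : ℝ} (hε : 0 < ε) (y : G) :
    Integrable fun x => S.rescale ρ ε (x * y⁻¹) :=
  (S.measurePreserving_mul_right y⁻¹).integrable_comp_of_integrable (g := S.rescale ρ ε)
    ((hρ.continuous_rescale ε).integrable_of_hasCompactSupport (hρ.hasCompactSupport_rescale hε))

/-- The kernel has unit mass concentrating at `y`, where `φ x - φ y` is small by continuity. No
regularity of `f` enters, only `|f| ≤ 1`. -/
theorem IsMollifier.tendsto_integral_smul_sub (hρ : S.IsMollifier d ρ) {f : G → ℝ}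
    (hf1 : ∀ x, ‖f x‖ ≤ 1) {φ : G → V} (hφ : Continuous φ) (y : G) :
    Tendsto (fun ε => ∫ x in Ω, (S.rescale ρ ε (x * y⁻¹) * f x) • (φ x - φ y)) (𝓝[>] 0)
      (𝓝 0) := by
  rw [Metric.tendsto_nhds]
  intro η hη
  have hN : {z : G | ‖φ (z * y) - φ y‖ < η / 2} ∈ 𝓝 (0 : G) := by
    have hc : Continuous fun z : G => ‖φ (z * y) - φ y‖ :=
      ((hφ.comp (S.continuous_mul_comp continuous_id continuous_const)).sub continuous_const).norm
    refine (hc.tendsto 0).eventually_lt_const ?_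
    rw [S.zero_mul', sub_self, norm_zero]
    positivity
  filter_upwards [hρ.eventually_tsupport_rescale_subset hN, self_mem_nhdsWithin] with ε hε1 hε2
  have hint : Integrable fun x => S.rescale ρ ε (x * y⁻¹) * (η / 2) := by
    exact (hρ.integrable_rescale_div hε2 y).mul_const _
  rw [dist_zero_right]
  calc ‖∫ x in Ω, (S.rescale ρ ε (x * y⁻¹) * f x) • (φ x - φ y)‖
      ≤ ∫ x in Ω, S.rescale ρ ε (x * y⁻¹) * (η / 2) := by
        refine norm_integral_le_of_norm_le hint.integrableOn (.of_forall fun x => ?_)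
        rw [norm_smul, norm_mul, Real.norm_of_nonneg (hρ.rescale_nonneg hε2 _)]
        by_cases hx : x * y⁻¹ ∈ tsupport (S.rescale ρ ε)
        · have h1 : ‖φ (x * y⁻¹ * y) - φ y‖ < η / 2 := hε1 hx
          rw [inv_mul_cancel_right] at h1
          exact mul_le_mul (mul_le_of_le_one_right (hρ.rescale_nonneg hε2 _) (hf1 x)) h1.le
            (norm_nonneg _) (hρ.rescale_nonneg hε2 _)
        · simp [image_eq_zero_of_notMem_tsupport hx]
    _ ≤ ∫ x, S.rescale ρ ε (x * y⁻¹) * (η / 2) :=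
        setIntegral_le_integral hint (.of_forall fun x =>
          mul_nonneg (hρ.rescale_nonneg hε2 _) (by positivity))
    _ = η / 2 := by
        rw [integral_mul_const, S.integral_kernel_left, hρ.integral_rescale hε2, one_mul]
    _ < η := by linarith

theorem IsMollifier.norm_kernelIntegral_le_one (hρ : S.IsMollifier d ρ) {ε : ℝ} (hε : 0 < ε)
    (Ω : Set G) {f : G → ℝ} (hf1 : ∀ x, ‖f x‖ ≤ 1) (x : G) :
    ‖kernelIntegral (S.rescale ρ ε) Ω f x‖ ≤ 1 :=
  (S.norm_kernelIntegral_le (hρ.continuous_rescale ε) (hρ.hasCompactSupport_rescale hε) Ω hf1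
    x).trans (hρ.integral_norm_rescale hε).le

/-- After Fubini and the symmetry of `ρ`, the difference of the two integrals is the `ν`-integral of
`⟨q_ε, s⟩` with `q_ε = ρ_ε * (fφ) - (ρ_ε * f)φ`. This commutator tends to `0` pointwise and is
bounded with support in a fixed compact set, so dominated convergence applies even when `ν` is
singular. -/
theorem IsMollifier.tendsto_integral_inner_sub (hρ : S.IsMollifier d ρ) (hΩ : IsOpen Ω)
    {ν : Measure G} [SFinite ν] (hν : ∀ K, IsCompact K → K ⊆ Ω → ν K < ∞)
    {s : G → V} (hs : AEStronglyMeasurable s ν) (hs1 : ∀ᵐ x ∂ν, ‖s x‖ ≤ 1) {f : G → ℝ}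
    (hf : AEStronglyMeasurable f) (hf1 : ∀ x, ‖f x‖ ≤ 1) {φ : G → V}
    (hφ : φ ∈ contFields G V Ω) :
    Tendsto (fun ε =>
      (∫ x in Ω, f x * inner ℝ (φ x) (∫ y in Ω, S.rescale ρ ε (x * y⁻¹) • s y ∂ν)) -
        ∫ y in Ω, kernelIntegral (S.rescale ρ ε) Ω f y * inner ℝ (φ y) (s y) ∂ν) (𝓝[>] 0)
      (𝓝 0) := by
  have : ProperSpace G := FiniteDimensional.proper ℝ G
  obtain ⟨r, hr, hrΩ⟩ := S.exists_reach_closedBall_subset hΩ hφ.2.1 hφ.2.2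
  set R := reach (Metric.closedBall (0 : G) r) (tsupport φ) with hR
  have hRc : IsCompact R := S.isCompact_reach (isCompact_closedBall 0 r) hφ.2.1
  have hRν : ν R < ∞ := hν R hRc hrΩ
  obtain ⟨B, hB0, hB⟩ := exists_norm_le_of_mem_contFields hφ
  have hsmall := hρ.eventually_tsupport_rescale_subset (Metric.closedBall_mem_nhds (0 : G) hr)
  have hφi : Integrable φ := integrableOn_of_mem_contFields (fun _ hK _ => hK.measure_lt_top) hφ
  let q : ℝ → G → V := fun ε y => ∫ x in Ω, (S.rescale ρ ε (x * y⁻¹) * f x) • (φ x - φ y)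
  have hkf : ∀ ε, 0 < ε → ∀ y, Integrable fun x => S.rescale ρ ε (x * y⁻¹) * f x := by
    intro ε hε y
    exact Integrable.mul_bdd (c := 1) (hρ.integrable_rescale_div hε y) hf (.of_forall hf1)
  -- The symmetry of `ρ` is essential here: Fubini integrates the kernel in its first variable,
  -- whereas `ρ_ε * f` integrates it in the second.
  have hsym : ∀ ε x y, S.rescale ρ ε (x * y⁻¹) = S.rescale ρ ε (y * x⁻¹) := by
    intro ε x y
    rw [← hρ.rescale_inv, mul_inv_rev, inv_inv]
  have hu : ∀ ε y, ∫ x in Ω, S.rescale ρ ε (x * y⁻¹) * f x =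
      kernelIntegral (S.rescale ρ ε) Ω f y := fun ε y => by
    simp only [kernelIntegral, hsym ε _ y]
  have hφk : ∀ ε, 0 < ε → ∀ y, Integrable fun x => (S.rescale ρ ε (x * y⁻¹) * f x) • φ x :=
    fun ε hε y => (hkf ε hε y).smul_bdd B hφ.1.aestronglyMeasurable (.of_forall hB)
  have hq : ∀ ε, 0 < ε → ∀ y, q ε y = (∫ x in Ω, (S.rescale ρ ε (x * y⁻¹) * f x) • φ x) -
      kernelIntegral (S.rescale ρ ε) Ω f y • φ y := by
    intro ε hε y
    simp only [q, smul_sub]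
    rw [integral_sub (hφk ε hε y).integrableOn ((hkf ε hε y).smul_const _).integrableOn,
      integral_smul_const, hu]
  have hqm : ∀ ε, 0 < ε → AEStronglyMeasurable (q ε) ν := by
    intro ε hε
    have h1 : AEStronglyMeasurable
        (fun p : G × G => (S.rescale ρ ε (p.2 * p.1⁻¹) * f p.2) • φ p.2)
        (ν.prod (volume.restrict Ω)) :=
      (((hρ.continuous_rescale ε).comp (S.continuous_div_comp continuous_snd
        continuous_fst)).aestronglyMeasurable.mul hf.restrict.comp_snd).smul
        (hφ.1.comp continuous_snd).aestronglyMeasurable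
    refine (h1.integral_prod_right'.sub ((S.continuous_kernelIntegral (hρ.continuous_rescale ε)
      (hρ.hasCompactSupport_rescale hε) hΩ hf hf1).smul hφ.1).aestronglyMeasurable).congr ?_
    exact .of_forall fun y => (hq ε hε y).symm
  have hqB : ∀ᶠ ε in 𝓝[>] (0 : ℝ), ∀ y, ‖q ε y‖ ≤ R.indicator (fun _ => 2 * B) y := by
    filter_upwards [self_mem_nhdsWithin, hsmall] with ε hε hεr y
    by_cases hyR : y ∈ R
    · rw [indicator_of_mem hyR, hq ε hε]
      have hk1 : Integrable fun x => ‖S.rescale ρ ε (x * y⁻¹)‖ :=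
        (hρ.integrable_rescale_div hε y).norm
      have h1 : ‖∫ x in Ω, (S.rescale ρ ε (x * y⁻¹) * f x) • φ x‖ ≤ B := by
        calc _ ≤ ∫ x in Ω, ‖S.rescale ρ ε (x * y⁻¹)‖ * B := by
              refine norm_integral_le_of_norm_le (hk1.mul_const B).integrableOn
                (.of_forall fun x => ?_)
              rw [norm_smul, norm_mul]
              exact mul_le_mul (mul_le_of_le_one_right (norm_nonneg _) (hf1 x)) (hB x)
                (norm_nonneg _) (norm_nonneg _)
          _ ≤ ∫ x, ‖S.rescale ρ ε (x * y⁻¹)‖ * B :=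
              setIntegral_le_integral (hk1.mul_const B) (.of_forall fun x =>
                mul_nonneg (norm_nonneg _) hB0)
          _ = B := by
              rw [integral_mul_const, S.integral_kernel_left (fun z => ‖S.rescale ρ ε z‖),
                hρ.integral_norm_rescale hε, one_mul]
      have h2 : ‖kernelIntegral (S.rescale ρ ε) Ω f y • φ y‖ ≤ B := by
        rw [norm_smul]
        exact (mul_le_of_le_one_left (norm_nonneg _)
          (hρ.norm_kernelIntegral_le_one hε Ω hf1 y)).trans (hB y)
      exact (norm_sub_le _ _).trans (by linarith)
    · rw [indicator_of_notMem hyR]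
      have hyφ : φ y = 0 := image_eq_zero_of_notMem_tsupport fun hm => hyR
        ⟨y, hm, by simp [S.one_eq_zero, hr.le]⟩
      have : q ε y = 0 := by
        refine integral_eq_zero_of_ae (.of_forall fun x => ?_)
        by_cases hx : x ∈ tsupport φ
        · have hz : S.rescale ρ ε (x * y⁻¹) = 0 :=
            image_eq_zero_of_notMem_tsupport fun hm => hyR ⟨x, hx, hεr hm⟩
          simp [hz]
        · simp [image_eq_zero_of_notMem_tsupport hx, hyφ]
      rw [this, norm_zero]
  have hRi : Integrable (R.indicator fun _ => 2 * B) ν :=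
    (integrable_indicator_iff hRc.measurableSet).2 (integrableOn_const hRν.ne)
  have hlim : Tendsto (fun ε => ∫ y in Ω, inner ℝ (q ε y) (s y) ∂ν) (𝓝[>] 0) (𝓝 0) := by
    have h0 : Tendsto (fun ε => ∫ y in Ω, inner ℝ (q ε y) (s y) ∂ν) (𝓝[>] 0)
        (𝓝 (∫ y in Ω, inner ℝ (0 : V) (s y) ∂ν)) := by
      refine tendsto_integral_filter_of_dominated_convergence (R.indicator fun _ => 2 * B) ?_ ?_
        hRi.integrableOn ?_
      · filter_upwards [self_mem_nhdsWithin] with ε hε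
        exact ((hqm ε hε).inner hs).restrict
      · filter_upwards [hqB] with ε hε
        filter_upwards [ae_restrict_of_ae hs1] with y hy
        exact ((norm_inner_le_norm _ _).trans
          (mul_le_of_le_one_right (norm_nonneg _) hy)).trans (hε y)
      · exact .of_forall fun y => Tendsto.inner (f := fun ε => q ε y)
          (hρ.tendsto_integral_smul_sub hf1 hφ.1 y) tendsto_const_nhds
    simpa using h0
  refine hlim.congr' ?_
  filter_upwards [self_mem_nhdsWithin, hsmall, hqB] with ε hε hεr hεB
  have hφν : Integrable φ ν := integrableOn_of_mem_contFields hν hφ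
  have hi2 : Integrable (fun y => kernelIntegral (S.rescale ρ ε) Ω f y • φ y) ν :=
    hφν.bdd_smul 1 (S.continuous_kernelIntegral (hρ.continuous_rescale ε)
      (hρ.hasCompactSupport_rescale hε) hΩ hf hf1).aestronglyMeasurable
      (.of_forall (hρ.norm_kernelIntegral_le_one hε Ω hf1))
  rw [S.integral_mul_inner_kernel_swap hs hs1 hf hf1 hφ (hρ.continuous_rescale ε)
    (hρ.hasCompactSupport_rescale hε)
    ((measure_mono (reach_mono hεr Subset.rfl)).trans_lt hRν)]
  have hi1 : Integrable (q ε) ν := hRi.mono' (hqm ε hε) (.of_forall hεB)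
  have hN : ∀ y, inner ℝ (∫ x in Ω, (S.rescale ρ ε (x * y⁻¹) * f x) • φ x) (s y) =
      inner ℝ (q ε y) (s y) + kernelIntegral (S.rescale ρ ε) Ω f y * inner ℝ (φ y) (s y) := by
    intro y
    rw [hq ε hε, inner_sub_left, real_inner_smul_left, sub_add_cancel]
  have hi2' := integrable_inner_of_ae_norm_le_one hi2 hs hs1
  simp only [real_inner_smul_left] at hi2'
  simp only [hN]
  rw [integral_add (integrable_inner_of_ae_norm_le_one hi1 hs hs1).integrableOn
    hi2'.integrableOn, add_sub_cancel_right]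

end StratifiedGroup

/-! ### The weak* limit `1/2` -/

namespace StratifiedGroup

variable {G : Type*} [NormedAddCommGroup G] [InnerProductSpace ℝ G] [Group G]
  [FiniteDimensional ℝ G] [MeasurableSpace G] [BorelSpace G]
  {S : StratifiedGroup G} {Ω : Set G} {d : S.HomogeneousDistance} {ρ : G → ℝ}

theorem IsMollifier.eventually_reach_subset (hρ : S.IsMollifier d ρ) (hΩ : IsOpen Ω) {K : Set G}
    (hK : IsCompact K) (hKΩ : K ⊆ Ω) :
    ∀ᶠ ε in 𝓝[>] (0 : ℝ), reach (tsupport (S.rescale ρ ε)) K ⊆ Ω := by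
  obtain ⟨r, hr, hrΩ⟩ := S.exists_reach_closedBall_subset hΩ hK hKΩ
  filter_upwards [hρ.eventually_tsupport_rescale_subset
    (Metric.closedBall_mem_nhds (0 : G) hr)] with ε hε
  exact (reach_mono hε Subset.rfl).trans hrΩ

theorem IsMollifier.tendsto_kernelIntegral_one (hρ : S.IsMollifier d ρ) (hΩ : IsOpen Ω) {x : G}
    (hx : x ∈ Ω) :
    Tendsto (fun ε => kernelIntegral (S.rescale ρ ε) Ω (fun _ => 1) x) (𝓝[>] 0) (𝓝 1) := by
  refine tendsto_const_nhds.congr' ?_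
  filter_upwards [hρ.eventually_reach_subset hΩ isCompact_singleton (singleton_subset_iff.2 hx),
    self_mem_nhdsWithin] with ε hε hε0
  simp only [kernelIntegral, mul_one]
  rw [setIntegral_eq_integral_of_forall_compl_eq_zero fun y hy =>
    image_eq_zero_of_notMem_tsupport fun hm => hy (hε ⟨x, rfl, hm⟩),
    S.integral_kernel_right, hρ.integral_rescale hε0]

/-- Mollifications of a bounded function converge to it weakly* in `L^∞(Ω)`. -/
theorem IsMollifier.tendsto_integral_inner_kernelIntegral (hρ : S.IsMollifier d ρ)
    (hΩ : IsOpen Ω) {f : G → ℝ} (hf : AEStronglyMeasurable f) (hf1 : ∀ x, ‖f x‖ ≤ 1)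
    {g : G → ℝ} (hg : IntegrableOn g Ω) :
    Tendsto (fun ε => ∫ x in Ω, inner ℝ (g x) (kernelIntegral (S.rescale ρ ε) Ω f x)) (𝓝[>] 0)
      (𝓝 (∫ x in Ω, inner ℝ (g x) (f x))) := by
  have hone : ∀ x : G, ‖(fun _ : G => (1 : ℝ)) x‖ ≤ 1 := fun _ => by simp
  have hν : ∀ K, IsCompact K → K ⊆ Ω → (volume : Measure G) K < ∞ :=
    fun _ hK _ => hK.measure_lt_top
  refine tendsto_integral_inner_of_c1Fields hΩ hν (fun ε hε =>
    ⟨(S.continuous_kernelIntegral (hρ.continuous_rescale ε) (hρ.hasCompactSupport_rescale hε) hΩ hf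
      hf1).aestronglyMeasurable, .of_forall (hρ.norm_kernelIntegral_le_one hε Ω hf1)⟩)
    ⟨hf, .of_forall hf1⟩ (fun φ hφ => ?_) hg
  have hφc := c1Fields_le_contFields Ω hφ
  have hφf := integrable_inner_of_ae_norm_le_one (integrableOn_of_mem_contFields hν hφc) hf
    (.of_forall hf1)
  -- The commutator estimate is reused with `ν` the volume, `f` in the role of `s` and the constant
  -- `1` in the role of the function; it remains to know that `ρ_ε * 1` is eventually `1` at each
  -- point of `Ω`.
  have h1 := hρ.tendsto_integral_inner_sub (f := fun _ => 1) hΩ hν hf (.of_forall hf1)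
    aestronglyMeasurable_const hone hφc
  have h2 : Tendsto (fun ε => ∫ y in Ω, kernelIntegral (S.rescale ρ ε) Ω (fun _ => 1) y *
      inner ℝ (φ y) (f y)) (𝓝[>] 0) (𝓝 (∫ y in Ω, inner ℝ (φ y) (f y))) := by
    refine tendsto_integral_filter_of_dominated_convergence (fun y => ‖inner ℝ (φ y) (f y)‖) ?_ ?_
      hφf.norm.integrableOn ?_
    · filter_upwards [self_mem_nhdsWithin] with ε hε
      exact ((S.continuous_kernelIntegral (hρ.continuous_rescale ε)
        (hρ.hasCompactSupport_rescale hε) hΩ aestronglyMeasurable_const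
        hone).aestronglyMeasurable.mul hφf.1).restrict
    · filter_upwards [self_mem_nhdsWithin] with ε hε
      refine .of_forall fun y => ?_
      rw [norm_mul]
      exact mul_le_of_le_one_left (norm_nonneg _) (hρ.norm_kernelIntegral_le_one hε Ω hone y)
    · filter_upwards [ae_restrict_mem hΩ.measurableSet] with y hy
      simpa using (hρ.tendsto_kernelIntegral_one hΩ hy).mul_const (inner ℝ (φ y) (f y))
  have h3 := h1.add h2
  simp only [one_mul, sub_add_cancel, zero_add, smul_eq_mul] at h3
  exact h3

theorem aestronglyMeasurable_chi {E : Set G} (hE : NullMeasurableSet E) :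
    AEStronglyMeasurable (chi E) :=
  aestronglyMeasurable_const.indicator₀ hE

theorem norm_chi_le_one (E : Set G) (x : G) : ‖chi E x‖ ≤ 1 := by
  by_cases hx : x ∈ E <;> simp [chi, hx]

theorem chi_mul_chi (E : Set G) (x : G) : chi E x * chi E x = chi E x := by
  by_cases hx : x ∈ E <;> simp [chi, hx]

/-- The mollifications of `χ_E` converge weakly* to `1/2` with respect to `|D_H χ_E|`. -/
theorem IsHGradient.tendsto_integral_kernelIntegral_chi_mul {E : Set G} {γ : Measure G}
    {σ : G → S.HFiber} (h : S.IsHGradient Ω (chi E) γ σ) (hρ : S.IsMollifier d ρ) (hΩ : IsOpen Ω)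
    (hE : NullMeasurableSet E) {u : G → ℝ} (hu : IntegrableOn u Ω γ) :
    Tendsto (fun ε => ∫ x in Ω, kernelIntegral (S.rescale ρ ε) Ω (chi E) x * u x ∂γ) (𝓝[>] 0)
      (𝓝 (∫ x in Ω, (1 / 2 : ℝ) * u x ∂γ)) := by
  have : SigmaFinite γ := h.isRadonOn.sigmaFinite hΩ
  have hf := aestronglyMeasurable_chi hE
  have hf1 := norm_chi_le_one E
  have hσ1 : ∀ᵐ x ∂γ, ‖σ x‖ ≤ 1 := h.norm_eq_one.mono fun _ hx => hx.le
  -- Pairing `uσ` with `vσ` reduces the scalar claim to weak* convergence of the fields `u_ε σ`,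
  -- which can be tested on smooth fields.
  have hinner : ∀ v : G → ℝ, ∫ x in Ω, inner ℝ (u x • σ x) (v x • σ x) ∂γ =
      ∫ x in Ω, v x * u x ∂γ := fun v => by
    refine integral_congr_ae ?_
    filter_upwards [ae_restrict_of_ae h.norm_eq_one] with x hx
    rw [real_inner_smul_left, real_inner_smul_right, real_inner_self_eq_norm_sq, hx]
    ring
  have hkm : ∀ ε, 0 < ε → AEStronglyMeasurable (kernelIntegral (S.rescale ρ ε) Ω (chi E)) γ :=
    fun ε hε => (S.continuous_kernelIntegral (hρ.continuous_rescale ε)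
      (hρ.hasCompactSupport_rescale hε) hΩ hf hf1).aestronglyMeasurable
  have huσ : IntegrableOn (fun x => u x • σ x) Ω γ :=
    Integrable.smul_bdd hu 1 h.aestronglyMeasurable.restrict (ae_restrict_of_ae hσ1)
  have key := tendsto_integral_inner_of_c1Fields hΩ h.measure_compact
    (w := fun ε x => kernelIntegral (S.rescale ρ ε) Ω (chi E) x • σ x)
    (w₀ := fun x => (1 / 2 : ℝ) • σ x) (fun ε hε => ⟨(hkm ε hε).smul h.aestronglyMeasurable, ?_⟩)
    ⟨h.aestronglyMeasurable.const_smul (1 / 2 : ℝ), ?_⟩ (fun φ hφ => ?_) huσ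
  · simpa only [hinner] using key
  · filter_upwards [hσ1] with x hx
    rw [norm_smul]
    exact mul_le_one₀ (hρ.norm_kernelIntegral_le_one hε Ω hf1 x) (norm_nonneg _) hx
  · filter_upwards [hσ1] with x hx
    rw [norm_smul]
    exact mul_le_one₀ (by norm_num) (norm_nonneg _) hx
  have hφc := c1Fields_le_contFields Ω hφ
  have h1 := hρ.tendsto_integral_inner_sub hΩ h.measure_compact h.aestronglyMeasurable hσ1 hf hf1
    hφc
  have hdiv : IntegrableOn (fun x => chi E x * S.hdiv φ x) Ω :=
    ((integrableOn_of_mem_contFields (fun _ hK _ => hK.measure_lt_top)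
      (S.hdiv_mem_contFields hφ)).bdd_mul hf (.of_forall hf1)).integrableOn
  have h2 := hρ.tendsto_integral_inner_kernelIntegral hΩ hf hf1 hdiv
  -- This is where a characteristic function is needed: `χ_E² = χ_E` turns the limit of the left
  -- side back into the gradient.
  have h3 : ∫ x in Ω, inner ℝ (chi E x * S.hdiv φ x) (chi E x) =
      -∫ x in Ω, inner ℝ (φ x) (σ x) ∂γ := by
    rw [← h.integral_hdiv φ hφ]
    refine integral_congr_ae (.of_forall fun x => ?_)
    simp only [Real.inner_apply]
    rw [mul_right_comm, chi_mul_chi]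
  rw [h3] at h2
  simp only [real_inner_smul_right]
  rw [integral_const_mul]
  -- With `A = ∫ χ_E ⟨φ, ρ_ε * σγ⟩ dx` and `B = ∫ u_ε ⟨φ, σ⟩ dγ`, `h1` says `A - B → 0`, and by the
  -- Leibniz rule the quantity in `h2` is eventually `-B - A`. The sum is `-2B`, whence the factor
  -- `-1/2`.
  have h4 := ((h1.add h2).const_mul (-(1 / 2 : ℝ)))
  rw [zero_add, neg_mul_neg] at h4
  refine h4.congr' ?_
  filter_upwards [hρ.eventually_reach_subset hΩ hφ.2.1 hφ.2.2, self_mem_nhdsWithin] with ε hεr hε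
  have h5 := h.leibniz hΩ (hρ.continuous_rescale ε) (hρ.hasCompactSupport_rescale hε) hf hf1 hφ hεr
  have h6 : ∫ x in Ω, inner ℝ (chi E x * S.hdiv φ x)
      (kernelIntegral (S.rescale ρ ε) Ω (chi E) x) =
      ∫ x in Ω, kernelIntegral (S.rescale ρ ε) Ω (chi E) x * chi E x * S.hdiv φ x := by
    refine integral_congr_ae (.of_forall fun x => ?_)
    simp only [Real.inner_apply]
    ring
  rw [h6, h5]
  simp only [kernelMeasure]
  ring

end StratifiedGroup

end

theorem mainTheorem12 {G : Type*} [NormedAddCommGroup G] [InnerProductSpace ℝ G]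
    [FiniteDimensional ℝ G] [MeasurableSpace G] [BorelSpace G] [Group G]
    (S : StratifiedGroup G) (d : S.HomogeneousDistance)
    (Ω : Set G) (hΩ : IsOpen Ω) (E : Set G) (hEΩ : E ⊆ Ω)
    (hE : S.HasLocallyFiniteHPerimeter Ω E)
    (ρ : G → ℝ) (hρ : S.IsMollifier d ρ) :
    (∃ (γ : Measure G) (σ : G → S.HFiber),
      S.IsHGradient Ω (StratifiedGroup.chi E) γ σ) ∧
    ∀ (γ : Measure G) (σ : G → S.HFiber), S.IsHGradient Ω (StratifiedGroup.chi E) γ σ →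
      -- the Leibniz rule in `Ω^R_{2ε}`
      (∀ ε : ℝ, 0 < ε → (d.innerR Ω (2 * ε)).Nonempty →
        S.IsBVLoc (d.innerR Ω (2 * ε))
          (fun x => S.mollify ρ ε Ω (StratifiedGroup.chi E) x * StratifiedGroup.chi E x) ∧
        (∃ (γ' : Measure G) (σ' : G → S.HFiber),
          S.IsHGradient (d.innerR Ω (2 * ε))
            (fun x => S.mollify ρ ε Ω (StratifiedGroup.chi E) x * StratifiedGroup.chi E x)
            γ' σ') ∧
        ∀ (γ' : Measure G) (σ' : G → S.HFiber),
          S.IsHGradient (d.innerR Ω (2 * ε))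
            (fun x => S.mollify ρ ε Ω (StratifiedGroup.chi E) x * StratifiedGroup.chi E x)
            γ' σ' →
          (γ Ω < ∞ → γ' (d.innerR Ω (2 * ε)) < ∞) ∧
          ∀ φ ∈ S.Cc (d.innerR Ω (2 * ε)),
            ∫ x in d.innerR Ω (2 * ε), inner ℝ (φ x) (σ' x) ∂γ' =
              (∫ x in d.innerR Ω (2 * ε),
                S.mollify ρ ε Ω (StratifiedGroup.chi E) x * inner ℝ (φ x) (σ x) ∂γ) +
              ∫ x in d.innerR Ω (2 * ε),
                StratifiedGroup.chi E x * inner ℝ (φ x) (S.mollifyMeasure ρ ε Ω γ σ x)) ∧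
      -- weak* convergence to `1/2` in `L^∞(Ω; |D_H χ_E|)`
      (∀ ε : ℝ, 0 < ε →
        MemLp (S.mollify ρ ε Ω (StratifiedGroup.chi E)) ∞ (γ.restrict Ω)) ∧
      ∀ u : G → ℝ, IntegrableOn u Ω γ →
        Tendsto (fun ε : ℝ => ∫ x in Ω, S.mollify ρ ε Ω (StratifiedGroup.chi E) x * u x ∂γ)
          (𝓝[>] 0) (𝓝 (∫ x in Ω, (1 / 2 : ℝ) * u x ∂γ)) := by
  have hf := StratifiedGroup.aestronglyMeasurable_chi hE.1
  have hf1 := StratifiedGroup.norm_chi_le_one E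
  refine ⟨hE.2.exists_isHGradient hΩ, fun γ σ h => ⟨fun ε hε _ => ?_, fun ε hε => ?_, fun u hu =>
    h.tendsto_integral_kernelIntegral_chi_mul hρ hΩ hE.1 hu⟩⟩
  · have hW := d.isOpen_innerR Ω (2 * ε)
    have hWΩ := d.innerR_subset Ω (2 * ε)
    have hk := hρ.continuous_rescale ε
    have hks := hρ.hasCompactSupport_rescale hε
    -- The kernel reaches right distance at most `ε ≤ 2ε`, so mollifying at points of the inner set
    -- only sees `Ω`.
    have hWk : StratifiedGroup.reach (tsupport (S.rescale ρ ε)) (d.innerR Ω (2 * ε)) ⊆ Ω :=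
      d.reach_subset_of_subset_innerR
        (fun z hz => (hρ.dist_le_of_mem_tsupport_rescale hε hz).trans (by linarith)) Subset.rfl
    have hBV := h.isBVLoc_kernelIntegral_mul hΩ hWΩ hk hks hWk hf hf1
    refine ⟨hBV, hBV.exists_isHGradient hW, fun γ' σ' h' => ⟨fun hγ => ?_, fun φ hφ =>
      h.integral_inner_kernelIntegral_mul hΩ hWΩ hk hks hWk hf hf1 h' hφ⟩⟩
    rw [h'.measure_open _ hW Subset.rfl]
    exact h.hVariation_kernelIntegral_mul_lt_top hΩ hWΩ hk hks hWk hf hf1 hγ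
  · exact memLp_top_of_bound (S.continuous_kernelIntegral (hρ.continuous_rescale ε)
      (hρ.hasCompactSupport_rescale hε) hΩ hf hf1).aestronglyMeasurable 1
      (.of_forall (hρ.norm_kernelIntegral_le_one hε Ω hf1))
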